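/- \textbf{Notation.} All logarithms are to base $2$; $\log^{\circ c}$ is the $c$-fold iterate of $\log$; $\log^\star x$ is the least integer $c\ge 0$ with $\log^{\circ c}x\le 1$. For $k\in\mathbb Z$ let $\lambda_k(x)=\prod_{0\le i\le \min\{k,\log^\star x-1\}}\log^{\circ i}x$ (an empty product is $1$; in particular $\lambda_{-1}=1$). Write $[\![n]\!]=\{0,\dots,n-1\}$ and $|\mathbf e|=e_1+\dots+e_m$. For a polynomial $f(\mathbf x)$ in $m$ variables, $\overline\partial_{\mathbf e}f$ is its Hasse derivative, the coefficient of $\mathbf z^{\mathbf e}$ in $f(\mathbf x+\mathbf z)$. \textbf{Algorithm MME-B.} The input consists of $m,d$, of $r$, $s$ and a depth $t\ge 0$, of a polynomial $f\in(\mathbb Z/r^s\mathbb Z)[x_1,\dots,x_m]$ of individual degrees less than $d$, given by its coefficient vector of length $d^m$, and of points $\mathbf a_1,\dots,\mathbf a_N\in(\mathbb Z/r^s\mathbb Z)^m$. Residues are represented by $[\![r^s]\!]$. (0) Compute $f_{\mathbf e}=\overline\partial_{\mathbf e}f$ for all $\mathbf e\in\mathbb N^m$ with $|\mathbf e|<s$,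 and the coordinatewise remainders $\tilde{\mathbf a}_i\in[\![r]\!]^m$ of $\mathbf a_i$ modulo $r$. (1) If $t=0$: compute the values of all $f_{\mathbf e}$ at all points of the grid $[\![r]\!]^m$ modulo $r^s$ by substituting the elements of $[\![r]\!]$ for the last variable and recursing on the number of variables, and read off the $f_{\mathbf e}(\tilde{\mathbf a}_i)$. Go to (3). (2) If $t\ge 1$: let $M=d\,r^d$ and let $p_1<\dots<p_k$ be all primes at most $16\log M$. Lift the $f_{\mathbf e}$ to integer polynomials $\tilde f_{\mathbf e}$ with coefficients in $[\![r^s]\!]$. For each $\mathbf e$ with $|\mathbf e|<s$ and each $j\le k$ call MME-B recursively on $\tilde f_{\mathbf e}\bmod p_j^m$ and the points $\tilde{\mathbf a}_i\bmod p_j^m$, with parameters $(p_j,m,t-1)$ in place of $(r,s,t)$. Combine the results by the Chinese Remainder Theorem modulo $\prod_j p_j^m$ and reduce them modulo $r^s$ to get $f_{\mathbf e}(\tilde{\mathbf a}_i)$. (3) For each $i$ output $\sum_{|\mathbf e|<s} f_{\mathbf e}(\tilde{\mathbf a}_i)\,(\mathbf a_i-\tilde{\mathbf a}_i)^{\mathbf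 e}\in\mathbb Z/r^s\mathbb Z$. Time is counted in bit operations of a random access machine on which an arithmetic operation on natural numbers costs its schoolbook bit cost in the lengths of the operands, and moving a reference, reading an array cell or advancing a loop counter costs one step. \textbf{Theorem.} There are absolute constants $C,K>0$ and a polynomial $P$ with non-negative integer coefficients such that the following holds. Let $m,d,r,s,t,N$ be non-negative integers with $1\le s\le m$ and $t<\log^\star r$, let $f$ be an $m$-variate polynomial over $\mathbb Z/r^s\mathbb Z$ of individual degree less than $d$, and let $\mathbf a_1,\dots,\mathbf a_N\in(\mathbb Z/r^s\mathbb Z)^m$. Then, on the input $(f,\mathbf a_1,\dots,\mathbf a_N,r,s,t)$, MME-B outputs $f(\mathbf a_1),\dots,f(\mathbf a_N)$ in time at most \[ K\binom{m+s-1}{s-1}2^{Ctm}\,\lambda_t(d)^t\,\lambda_{t-1}(\log r)\Bigl(\bigl(\lambda_t(d)\log^{\circ t}r\bigr)^m+N\Bigr)\cdot P(m,d,\log r). \] -/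

import Mathlib

namespace MME

/-! ### The machine model

Algorithms are programs of a small imperative/functional language of natural numbers (of arbitrary
length), pairs and immutable arrays, with bounded loops and recursive procedures of bounded depth.
A program is a piece of syntax; the only things it can do with data are the instructions below, and
`Tm.run` charges each of them the number of bit operations that a random access machine needs for
it: arithmetic is charged at the schoolbook bit cost in the lengths of the operands, while moving a
reference, reading an array cell and advancing a loop counter are single steps. -/

/-- Types of data: natural numbers, pairs, arrays. -/
inductive Ty : Type
  | nat : Ty
  | prod : Ty → Ty → Ty
  | arr : Ty → Ty

/-- The values of each type; an array is the list of its entries. -/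
@[reducible] def Ty.Val : Ty → Type
  | .nat => ℕ
  | .prod σ τ => σ.Val × τ.Val
  | .arr τ => List τ.Val

/-- The value returned by a read outside the bounds of an array. -/
def Ty.dflt : (τ : Ty) → τ.Val
  | .nat => (0 : ℕ)
  | .prod σ τ => (σ.dflt, τ.dflt)
  | .arr _ => []

/-- Arithmetic on natural numbers: sum, truncated difference, product, quotient, remainder. -/
inductive BinOp : Type
  | plus | minus | times | quot | rem

def BinOp.eval : BinOp → ℕ → ℕ → ℕ
  | .plus, a, b => a + b
  | .minus, a, b => a - b
  | .times, a, b => a * b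
  | .quot, a, b => a / b
  | .rem, a, b => a % b

/-- Schoolbook bit cost; `Nat.size` is the length of the binary expansion. -/
def BinOp.cost : BinOp → ℕ → ℕ → ℕ
  | .plus, a, b => a.size + b.size + 1
  | .minus, a, b => a.size + b.size + 1
  | .times, a, b => (a.size + 1) * (b.size + 1)
  | .quot, a, b => (a.size + 1) * (b.size + 1)
  | .rem, a, b => (a.size + 1) * (b.size + 1)

/-- Program terms. `V` is the type of data variables and `W` that of procedure variables; programs
are parametric in both, so that a program cannot inspect data except through the instructions. -/
inductive Tm (V : Ty → Type) (W : Ty → Ty → Type) : Ty → Type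
  /-- a variable -/
  | var {τ : Ty} : V τ → Tm V W τ
  /-- a numeral -/
  | lit : ℕ → Tm V W .nat
  /-- an arithmetic operation -/
  | bin : BinOp → Tm V W .nat → Tm V W .nat → Tm V W .nat
  /-- the length of the binary expansion -/
  | bits : Tm V W .nat → Tm V W .nat
  /-- `ifLt a b x y`: if `a < b` then `x` else `y` -/
  | ifLt {τ : Ty} : Tm V W .nat → Tm V W .nat → Tm V W τ → Tm V W τ → Tm V W τ
  /-- `bind e f`: compute `e`, store it in a variable, go on with `f` -/
  | bind {σ τ : Ty} : Tm V W σ → (V σ → Tm V W τ) → Tm V W τ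
  | pair {σ τ : Ty} : Tm V W σ → Tm V W τ → Tm V W (.prod σ τ)
  | fst {σ τ : Ty} : Tm V W (.prod σ τ) → Tm V W σ
  | snd {σ τ : Ty} : Tm V W (.prod σ τ) → Tm V W τ
  /-- the empty array -/
  | nil {τ : Ty} : Tm V W (.arr τ)
  /-- `tab n f`: a new array with entries `f 0, …, f (n - 1)` -/
  | tab {τ : Ty} : Tm V W .nat → (V .nat → Tm V W τ) → Tm V W (.arr τ)
  /-- reading an array cell -/
  | get {τ : Ty} : Tm V W (.arr τ) → Tm V W .nat → Tm V W τ
  /-- the number of entries of an array -/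
  | len {τ : Ty} : Tm V W (.arr τ) → Tm V W .nat
  /-- concatenation of an array of arrays, by copying -/
  | concat {τ : Ty} : Tm V W (.arr (.arr τ)) → Tm V W (.arr τ)
  /-- `loop n x f`: `x := f i x` for `i = 0, …, n - 1` -/
  | loop {σ : Ty} : Tm V W .nat → Tm V W σ → (V .nat → V σ → Tm V W σ) → Tm V W σ
  /-- a call of a procedure -/
  | call {σ τ : Ty} : W σ τ → Tm V W σ → Tm V W τ
  /-- `recur n x base step`: call on `x` the procedure `F n`, where `F 0 = base` and `F (k + 1)` is
  `step k`, which may call `F k` -/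
  | recur {σ τ : Ty} : Tm V W .nat → Tm V W σ → (V σ → Tm V W τ) →
      (V .nat → W σ τ → V σ → Tm V W τ) → Tm V W τ

/-- The meaning of a procedure variable: the result and the time as functions of the argument. -/
@[reducible] def Proc (σ τ : Ty) : Type := σ.Val → τ.Val × ℕ

/-- The result of a program term and the time it takes. -/
def Tm.run : {τ : Ty} → Tm Ty.Val Proc τ → τ.Val × ℕ
  | _, .var x => (x, 1)
  | _, .lit n => (n, n.size + 1)
  | _, .bin o a b => (o.eval a.run.1 b.run.1, a.run.2 + b.run.2 + o.cost a.run.1 b.run.1)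
  | _, .bits a => (Nat.size a.run.1, a.run.2 + Nat.size a.run.1 + 1)
  | _, .ifLt a b x y =>
      (if a.run.1 < b.run.1 then x.run.1 else y.run.1,
        a.run.2 + b.run.2 + (Nat.size a.run.1 + Nat.size b.run.1 + 1) +
          if a.run.1 < b.run.1 then x.run.2 else y.run.2)
  | _, .bind e f => ((f e.run.1).run.1, e.run.2 + (f e.run.1).run.2 + 1)
  | _, .pair a b => ((a.run.1, b.run.1), a.run.2 + b.run.2 + 1)
  | _, .fst a => (a.run.1.1, a.run.2 + 1)
  | _, .snd a => (a.run.1.2, a.run.2 + 1)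
  | _, .nil => ([], 1)
  | _, .tab n f =>
      ((List.range n.run.1).map fun i => (f i).run.1,
        n.run.2 + ((List.range n.run.1).map fun i => (f i).run.2 + 1).sum + 1)
  | .(τ), .get (τ := τ) a i => (a.run.1.getD i.run.1 τ.dflt, a.run.2 + i.run.2 + 1)
  | _, .len a => (a.run.1.length, a.run.2 + 1)
  | _, .concat a =>
      (a.run.1.flatten, a.run.2 + (a.run.1.map fun l => l.length + 1).sum + 1)
  | .(σ), .loop (σ := σ) n x f =>
      let res : σ.Val × ℕ := Nat.rec x.run
        (fun i acc => ((f i acc.1).run.1, acc.2 + (f i acc.1).run.2 + 1)) n.run.1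
      (res.1, n.run.2 + res.2 + 1)
  | _, .call F x => ((F x.run.1).1, x.run.2 + (F x.run.1).2 + 1)
  | .(τ), .recur (σ := σ) (τ := τ) n x base step =>
      let F : Proc σ τ := Nat.rec (motive := fun _ => Proc σ τ) (fun v => (base v).run)
        (fun k F v => (step k F v).run) n.run.1
      ((F x.run.1).1, n.run.2 + x.run.2 + (F x.run.1).2 + 1)

/-- A program with input type `σ` and output type `τ`. -/
def Program (σ τ : Ty) : Type 1 :=
  (V : Ty → Type) → (W : Ty → Ty → Type) → V σ → Tm V W τ

/-- The output of a program on a given input. -/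
def Program.output {σ τ : Ty} (p : Program σ τ) (x : σ.Val) : τ.Val := (p Ty.Val Proc x).run.1

/-- The running time of a program on a given input. -/
def Program.time {σ τ : Ty} (p : Program σ τ) (x : σ.Val) : ℕ := (p Ty.Val Proc x).run.2

/-! ### Writing programs -/

section Code

variable {V : Ty → Type} {W : Ty → Ty → Type} {σ τ : Ty}

instance (n : ℕ) : OfNat (Tm V W .nat) n := ⟨.lit n⟩
instance : Add (Tm V W .nat) := ⟨.bin .plus⟩
instance : Sub (Tm V W .nat) := ⟨.bin .minus⟩
instance : Mul (Tm V W .nat) := ⟨.bin .times⟩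
instance : Div (Tm V W .nat) := ⟨.bin .quot⟩
instance : Mod (Tm V W .nat) := ⟨.bin .rem⟩

def letIn (e : Tm V W σ) (f : Tm V W σ → Tm V W τ) : Tm V W τ := .bind e fun x => f (.var x)

def tabulate (n : Tm V W .nat) (f : Tm V W .nat → Tm V W τ) : Tm V W (.arr τ) :=
  .tab n fun i => f (.var i)

def iter (n : Tm V W .nat) (x : Tm V W σ) (f : Tm V W .nat → Tm V W σ → Tm V W σ) : Tm V W σ :=
  .loop n x fun i y => f (.var i) (.var y)

def recursion (n : Tm V W .nat) (x : Tm V W σ) (base : Tm V W σ → Tm V W τ)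
    (step : Tm V W .nat → (Tm V W σ → Tm V W τ) → Tm V W σ → Tm V W τ) : Tm V W τ :=
  .recur n x (fun y => base (.var y)) fun k F y => step (.var k) (.call F) (.var y)

def single (x : Tm V W τ) : Tm V W (.arr τ) := tabulate 1 fun _ => x

/-- The array `v` with `x` put at its end. -/
def snoc (v : Tm V W (.arr τ)) (x : Tm V W τ) : Tm V W (.arr τ) :=
  .concat (tabulate 2 fun i => .ifLt i 1 v (single x))

/-! ### Subroutines -/

/-- `b ^ n` -/
def pow (b n : Tm V W .nat) : Tm V W .nat := iter n 1 fun _ x => x * b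

/-- `b ^ n mod q`, by repeated squaring; the loop state is (current square, remaining exponent,
result so far). -/
def powMod (b n q : Tm V W .nat) : Tm V W .nat :=
  .snd (.snd (iter (.bits n) (.pair (b % q) (.pair n 1)) fun _ st =>
    letIn (.fst st) fun x => letIn (.fst (.snd st)) fun k => letIn (.snd (.snd st)) fun y =>
      .pair (x * x % q) (.pair (k / 2) (.ifLt 0 (k % 2) (y * x % q) y))))

/-- The binomial coefficient of `a` and `k`. -/
def binomial (a k : Tm V W .nat) : Tm V W .nat := iter k 1 fun i x => x * (a - i) / (i + 1)

def arrSum (v : Tm V W (.arr .nat)) : Tm V W .nat := iter (.len v) 0 fun l x => x + .get v l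

def arrProd (v : Tm V W (.arr .nat)) : Tm V W .nat := iter (.len v) 1 fun l x => x * .get v l

/-- All entries of `v` modulo `q`. -/
def reduce (v : Tm V W (.arr .nat)) (q : Tm V W .nat) : Tm V W (.arr .nat) :=
  tabulate (.len v) fun l => .get v l % q

/-- `∑ l, v l * b ^ l`: the position of the index tuple `v` in a flat table whose indices have
coordinates smaller than `b`. -/
def code (b : Tm V W .nat) (v : Tm V W (.arr .nat)) : Tm V W .nat :=
  iter (.len v) 0 fun l x => x + .get v l * pow b l

/-- The array of all `e` in `ℕ ^ m` with `e 0 + ⋯ + e (m - 1) < s`. -/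
def exponents (m s : Tm V W .nat) : Tm V W (.arr (.arr .nat)) :=
  iter m (single .nil) fun _ L =>
    .concat (tabulate (.len L) fun j =>
      letIn (.get L j) fun v => tabulate (s - arrSum v) fun c => snoc v c)

/-- The Hasse derivative with respect to the monomial `x ^ e` of the polynomial over `ℤ / q` in `m`
variables, of individual degrees less than `d`, with coefficient table `f`. The coefficient at
`x ^ b` of the derivative is `binom (b + e) e` times the coefficient at `x ^ (b + e)` of `f`, and
the number in the loop is the binomial coefficient of the tuples `b + e` and `e`. -/
def hasse (m d q : Tm V W .nat) (e f : Tm V W (.arr .nat)) : Tm V W (.arr .nat) :=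
  tabulate (pow d m) fun b =>
    letIn (iter m 1 fun l x => letIn (b / pow d l % d + .get e l) fun a =>
      .ifLt a d (x * binomial a (.get e l) % q) 0) fun c =>
    c * .get f (b + code d e) % q

/-- Substitution of `x` for the last one of `l + 1` variables, by Horner's rule. -/
def substLast (d q l x : Tm V W .nat) (f : Tm V W (.arr .nat)) : Tm V W (.arr .nat) :=
  letIn (pow d l) fun D =>
    tabulate D fun u => iter d 0 fun c y => (y * x + .get f (u + D * (d - 1 - c))) % q

/-- The table of the values over `ℤ / q` of the polynomial with coefficient table `f` at all points
of `{0, …, r - 1} ^ m`. -/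
def evalGrid (m d r q : Tm V W .nat) (f : Tm V W (.arr .nat)) : Tm V W (.arr .nat) :=
  recursion m f (fun g => g) fun l rc g =>
    .concat (tabulate r fun x => rc (substLast d q l x g))

/-- The product of the `(a l - b l) ^ (e l)` modulo `q`. -/
def shiftMonomial (q : Tm V W .nat) (a b e : Tm V W (.arr .nat)) : Tm V W .nat :=
  iter (.len e) 1 fun l x => x * pow (.get a l - .get b l) (.get e l) % q

/-- The sum over the exponents `e` in `E` of `val e * (a - b) ^ e` modulo `q`; the value that
belongs to the exponent with number `j` is `val j`. -/
def taylor (q : Tm V W .nat) (E : Tm V W (.arr (.arr .nat))) (a b : Tm V W (.arr .nat))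
    (val : Tm V W .nat → Tm V W .nat) : Tm V W .nat :=
  iter (.len E) 0 fun j x => (x + val j * shiftMonomial q a b (.get E j)) % q

/-- The array of all primes at most `B`, in increasing order, by trial division. -/
def primesUpTo (B : Tm V W .nat) : Tm V W (.arr .nat) :=
  .concat (tabulate (B + 1) fun p =>
    .ifLt p 2 .nil
      (.ifLt (iter (p - 2) 0 fun i c => .ifLt (p % (i + 2)) 1 (c + 1) c) 1 (single p) .nil))

/-- For distinct primes `p j` and `Q` the product of the `n j = p j ^ m`: the array of the numbers
`Q / n j` times the inverse of `Q / n j` modulo `n j`. -/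
def crtBasis (m Q : Tm V W .nat) (p : Tm V W (.arr .nat)) : Tm V W (.arr .nat) :=
  tabulate (.len p) fun j =>
    letIn (pow (.get p j) m) fun n => letIn (Q / n) fun u =>
      u * powMod u (pow (.get p j) (m - 1) * (.get p j - 1) - 1) n

/-- Chinese remaindering: the number below `Q` with remainders `val j`. -/
def crt (Q : Tm V W .nat) (basis : Tm V W (.arr .nat)) (val : Tm V W .nat → Tm V W .nat) :
    Tm V W .nat :=
  iter (.len basis) 0 (fun j x => x + val j * .get basis j) % Q

/-! ### The algorithms -/

/-- The data `(f, (points, (r, s)))` of an instance over `ℤ / r ^ s`. -/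
abbrev Inst : Ty := .prod (.arr .nat) (.prod (.arr (.arr .nat)) (.prod .nat .nat))

/-- MME-Product-Set: evaluate all Hasse derivatives of order less than `s` on the grid
`{0, …, r - 1} ^ m`, then expand around the remainder modulo `r` of each point. -/
def productSet (m d : Tm V W .nat) (I : Tm V W Inst) : Tm V W (.arr .nat) :=
  letIn (.fst I) fun f => letIn (.fst (.snd I)) fun pts =>
  letIn (.fst (.snd (.snd I))) fun r => letIn (.snd (.snd (.snd I))) fun s =>
  letIn (pow r s) fun q =>
  letIn (exponents m s) fun E =>
  letIn (tabulate (.len E) fun j => hasse m d q (.get E j) f) fun D =>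
  letIn (tabulate (.len E) fun j => evalGrid m d r q (.get D j)) fun T =>
  letIn (tabulate (.len pts) fun i => reduce (.get pts i) r) fun red =>
  tabulate (.len pts) fun i => letIn (code r (.get red i)) fun pos =>
    taylor q E (.get pts i) (.get red i) fun j => .get (.get T j) pos

/-- The body of MME-B at positive depth; `rc` is MME-B at the depth below. -/
def mmeBStep (m d : Tm V W .nat) (rc : Tm V W Inst → Tm V W (.arr .nat)) (I : Tm V W Inst) :
    Tm V W (.arr .nat) :=
  letIn (.fst I) fun f => letIn (.fst (.snd I)) fun pts =>
  letIn (.fst (.snd (.snd I))) fun r => letIn (.snd (.snd (.snd I))) fun s =>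
  letIn (pow r s) fun q =>
  letIn (exponents m s) fun E =>
  -- the Hasse derivatives `f_e`, with coefficients in `{0, …, r ^ s - 1}`
  letIn (tabulate (.len E) fun j => hasse m d q (.get E j) f) fun D =>
  -- the remainders modulo `r` of the points
  letIn (tabulate (.len pts) fun i => reduce (.get pts i) r) fun red =>
  -- `M = d * r ^ d` and the primes up to `16 * log M`, rounded down, which is the logarithm
  -- of `M ^ 16` rounded down
  letIn (d * pow r d) fun M =>
  letIn (primesUpTo (.bits (pow M 16) - 1)) fun p =>
  letIn (tabulate (.len p) fun k => pow (.get p k) m) fun n =>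
  -- the polynomials and the points modulo the `p_k ^ m`
  letIn (tabulate (.len E) fun j => tabulate (.len p) fun k =>
    reduce (.get D j) (.get n k)) fun fs =>
  letIn (tabulate (.len p) fun k => tabulate (.len pts) fun i =>
    reduce (.get red i) (.get n k)) fun as =>
  -- the recursive calls
  letIn (tabulate (.len E) fun j => tabulate (.len p) fun k =>
    rc (.pair (.get (.get fs j) k) (.pair (.get as k) (.pair (.get p k) m)))) fun res =>
  -- the values of the `f_e` at the remainders of the points
  letIn (arrProd n) fun Q =>
  letIn (crtBasis m Q p) fun basis =>
  letIn (tabulate (.len E) fun j => tabulate (.len pts) fun i =>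
    crt Q basis (fun k => .get (.get (.get res j) k) i) % q) fun T =>
  -- the Taylor expansions
  tabulate (.len pts) fun i =>
    taylor q E (.get pts i) (.get red i) fun j => .get (.get T j) i

end Code

/-- MME-B. The input is `(m, (d, (t, instance)))`. -/
def mmeB : Program (.prod .nat (.prod .nat (.prod .nat Inst))) (.arr .nat) := fun _ _ inp =>
  letIn (.fst (.var inp)) fun m => letIn (.fst (.snd (.var inp))) fun d =>
  letIn (.fst (.snd (.snd (.var inp)))) fun t => letIn (.snd (.snd (.snd (.var inp)))) fun I =>
  recursion t I (fun J => productSet m d J) fun _ rc J => mmeBStep m d rc J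

/-! ### Inputs and outputs -/

/-- The coefficient vector of length `d ^ m` of a polynomial of individual degrees less than `d`:
the coefficient of `x ^ e` stands at position `∑ l, e l * d ^ l`. Residues are represented by the
natural numbers below the modulus. -/
noncomputable def coeffTable {m n : ℕ} (d : ℕ) (f : MvPolynomial (Fin m) (ZMod n)) : List ℕ :=
  (List.range (d ^ m)).map fun k =>
    (f.coeff (Finsupp.equivFunOnFinite.symm fun l : Fin m => k / d ^ (l : ℕ) % d)).val

/-- The input of MME-B for given `m`, `d`, `r`, `s`, depth `t`, polynomial and points. -/
noncomputable def mmeInput (m d r s t N : ℕ) (f : MvPolynomial (Fin m) (ZMod (r ^ s)))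
    (a : Fin N → Fin m → ZMod (r ^ s)) : ℕ × ℕ × ℕ × List ℕ × List (List ℕ) × ℕ × ℕ :=
  (m, d, t, coeffTable d f, List.ofFn fun i => List.ofFn fun l => (a i l).val, r, s)

/-! ### The functions in the time bound -/

/-- The iterated base 2 logarithm. -/
noncomputable def iterLog (c : ℕ) (x : ℝ) : ℝ := (Real.logb 2)^[c] x

/-- The least `c` such that the `c`-fold iterated logarithm is at most one. -/
noncomputable def logStar (x : ℝ) : ℕ := sInf {c : ℕ | iterLog c x ≤ 1}

/-- The product of the `i`-fold iterated logarithms of `x` for integers `i` with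
`0 ≤ i ≤ min k (logStar x - 1)`. -/
noncomputable def lam (k : ℤ) (x : ℝ) : ℝ :=
  ∏ i ∈ Finset.Icc (0 : ℤ) (min k ((logStar x : ℤ) - 1)), iterLog i.toNat x

end MME

/-! Correctness. Put `b = a mod r` coordinatewise. In the Taylor expansion of `f` at `b` the term of
order `e` carries `(a - b) ^ e`, which is divisible by `r ^ |e|`; modulo `r ^ s` only `|e| < s`
survives (`evalTable_taylor`). At depth 0 the values `f_e(b)` are read off a grid
(`getD_gridTable`). At positive depth `f_e(b)`, computed over the integers with representatives
below `r ^ s` and `r`, is smaller than `M ^ m` with `M = d * r ^ d` (`evalTable_lt`). A Chebyshev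
bound shows that the primes up to `16 log M` have product at least `M` (`le_primorial_size_pow`), so
Chinese remaindering modulo the `p ^ m` returns this integer itself (`crtWeight_eq`), not merely a
residue.

Running time. There is one number `S`, polynomial in `m`, `d`, `log r`, that bounds the lengths of
all numbers at all depths. Apart from recursive calls, a level above the bottom costs a fixed power
of `S` times `L * (d ^ m + N)`, where `L` is the number of exponents (`Spec.mmeBStep`); the bottom
level costs `L * (max d r ^ m + N)` with its own `r` (`Spec.productSet`). Each level makes `L` times
the number of primes many calls, with `p` in place of `r` and `m` in place of `s`. The primes, and
their number, are at most `32 d log r`. Unrolling gives the top-level binomial coefficient, a factor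
`4 ^ m` for each lower level, the product of the iterates of `x ↦ 32 d log x` at `r`, and the last
iterate to the power `m` (`depthCost_le`). The `j`-th iterate is at most `512 * d * max 1 (log d)`
times the `j`-fold logarithm of `r` (`iterate_primeLog_le`), and `d * max 1 (log d) ≤ λ_t(d)` for `t
≥ 1`. Thus the product of the iterates is bounded by `λ_t(d) ^ t * λ_{t-1}(log r)` up to powers of
512, which go into `2 ^ (21 t m)` (`closed_form_le`).

Cost accounting is compositional: `Spec` pairs a value with a step bound, and the classes `LePow`
and `LePowMul` turn sums and products of bounds into `S ^ k` or `S ^ k * X`. The exponents `k` are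
far from sharp; it only matters that they are absolute, since `P` absorbs them. -/

set_option synthInstance.maxSize 100000
set_option synthInstance.maxHeartbeats 400000

namespace MME

/-! ### A calculus of results and running times -/

/-- The program term `t` returns `v` within `c` steps. -/
def Spec {τ : Ty} (t : Tm Ty.Val Proc τ) (v : τ.Val) (c : ℕ) : Prop := t.run.1 = v ∧ t.run.2 ≤ c

namespace Spec

variable {σ τ : Ty}

theorem mono {t : Tm Ty.Val Proc τ} {v : τ.Val} {c c' : ℕ} (h : Spec t v c) (hc : c ≤ c') :
    Spec t v c' := ⟨h.1, h.2.trans hc⟩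

theorem congr {t : Tm Ty.Val Proc τ} {v v' : τ.Val} {c c' : ℕ} (h : Spec t v c) (hv : v = v')
    (hc : c ≤ c') : Spec t v' c' := ⟨h.1.trans hv, h.2.trans hc⟩

theorem var (v : τ.Val) : Spec (.var v) v 1 := ⟨rfl, le_rfl⟩

theorem natVar (n : ℕ) : Spec (.var n : Tm Ty.Val Proc .nat) n 1 := ⟨rfl, le_rfl⟩

theorem arrVar (l : List ℕ) : Spec (.var l : Tm Ty.Val Proc (.arr .nat)) l 1 := ⟨rfl, le_rfl⟩

theorem arrArrVar (l : List (List ℕ)) :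
    Spec (.var l : Tm Ty.Val Proc (.arr (.arr .nat))) l 1 := ⟨rfl, le_rfl⟩

theorem arrArrArrVar (l : List (List (List ℕ))) :
    Spec (.var l : Tm Ty.Val Proc (.arr (.arr (.arr .nat)))) l 1 := ⟨rfl, le_rfl⟩

theorem lit {v : ℕ} (n : ℕ) (h : n = v := by rfl) : Spec (.lit n) v (n.size + 1) :=
  ⟨h, le_rfl⟩

theorem bin (o : BinOp) {a b : Tm Ty.Val Proc .nat} {x y c₁ c₂ : ℕ} (ha : Spec a x c₁)
    (hb : Spec b y c₂) : Spec (.bin o a b) (o.eval x y) (c₁ + c₂ + o.cost x y) := by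
  obtain ⟨rfl, ha⟩ := ha
  obtain ⟨rfl, hb⟩ := hb
  exact ⟨rfl, by simp only [Tm.run]; gcongr⟩

section
variable {a b : Tm Ty.Val Proc .nat} {x y c₁ c₂ : ℕ}

theorem add (ha : Spec a x c₁) (hb : Spec b y c₂) :
    Spec (a + b) (x + y : ℕ) (c₁ + c₂ + (x.size + y.size + 1)) := bin .plus ha hb

theorem sub (ha : Spec a x c₁) (hb : Spec b y c₂) :
    Spec (a - b) (x - y : ℕ) (c₁ + c₂ + (x.size + y.size + 1)) := bin .minus ha hb

theorem mul (ha : Spec a x c₁) (hb : Spec b y c₂) :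
    Spec (a * b) (x * y : ℕ) (c₁ + c₂ + (x.size + 1) * (y.size + 1)) := bin .times ha hb

theorem div (ha : Spec a x c₁) (hb : Spec b y c₂) :
    Spec (a / b) (x / y : ℕ) (c₁ + c₂ + (x.size + 1) * (y.size + 1)) := bin .quot ha hb

theorem mod (ha : Spec a x c₁) (hb : Spec b y c₂) :
    Spec (a % b) (x % y : ℕ) (c₁ + c₂ + (x.size + 1) * (y.size + 1)) := bin .rem ha hb

theorem bits (ha : Spec a x c₁) : Spec (.bits a) x.size (c₁ + x.size + 1) := by
  obtain ⟨rfl, ha⟩ := ha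
  exact ⟨rfl, by simp only [Tm.run]; gcongr⟩

/-- Each branch is checked under its own outcome of the comparison, against one common value and one
common bound. -/
theorem ifLt {u w : Tm Ty.Val Proc τ} {v : τ.Val} {c : ℕ} (ha : Spec a x c₁) (hb : Spec b y c₂)
    (hu : x < y → Spec u v c) (hw : y ≤ x → Spec w v c) :
    Spec (.ifLt a b u w) v (c₁ + c₂ + (x.size + y.size + 1) + c) := by
  obtain ⟨rfl, ha⟩ := ha
  obtain ⟨rfl, hb⟩ := hb
  by_cases h : a.run.1 < b.run.1
  · exact ⟨by simp only [Tm.run]; rw [if_pos h]; exact (hu h).1,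
      by simp only [Tm.run]; rw [if_pos h]; have := (hu h).2; gcongr⟩
  · exact ⟨by simp only [Tm.run]; rw [if_neg h]; exact (hw (not_lt.1 h)).1,
      by simp only [Tm.run]; rw [if_neg h]; have := (hw (not_lt.1 h)).2; gcongr⟩
end

theorem bind {e : Tm Ty.Val Proc σ} {f : σ.Val → Tm Ty.Val Proc τ} {v : σ.Val} {w : τ.Val}
    {c c' : ℕ} (he : Spec e v c) (hf : Spec (f v) w c') : Spec (.bind e f) w (c + c' + 1) := by
  obtain ⟨rfl, he⟩ := he
  exact ⟨hf.1, by simp only [Tm.run]; have := hf.2; gcongr⟩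

theorem letIn {e : Tm Ty.Val Proc σ} {f : Tm Ty.Val Proc σ → Tm Ty.Val Proc τ} {v : σ.Val}
    {w : τ.Val} {c c' : ℕ} (he : Spec e v c) (hf : Spec (f (.var v)) w c') :
    Spec (letIn e f) w (c + c' + 1) := bind he hf

theorem pair {a : Tm Ty.Val Proc σ} {b : Tm Ty.Val Proc τ} {x : σ.Val} {y : τ.Val} {c c' : ℕ}
    (ha : Spec a x c) (hb : Spec b y c') :
    Spec (.pair a b) ((x, y) : σ.Val × τ.Val) (c + c' + 1) := by
  obtain ⟨rfl, ha⟩ := ha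
  obtain ⟨rfl, hb⟩ := hb
  exact ⟨rfl, by simp only [Tm.run]; gcongr⟩

theorem fst {a : Tm Ty.Val Proc (.prod σ τ)} {x : σ.Val × τ.Val} {c : ℕ} (ha : Spec a x c) :
    Spec (.fst a) x.1 (c + 1) := by
  obtain ⟨rfl, ha⟩ := ha
  exact ⟨rfl, by simp only [Tm.run]; gcongr⟩

theorem snd {a : Tm Ty.Val Proc (.prod σ τ)} {x : σ.Val × τ.Val} {c : ℕ} (ha : Spec a x c) :
    Spec (.snd a) x.2 (c + 1) := by
  obtain ⟨rfl, ha⟩ := ha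
  exact ⟨rfl, by simp only [Tm.run]; gcongr⟩

theorem nil : Spec (.nil : Tm Ty.Val Proc (.arr τ)) ([] : List τ.Val) 1 := ⟨rfl, le_rfl⟩

theorem sum_map_range_le {n c : ℕ} {g : ℕ → ℕ} (h : ∀ i < n, g i ≤ c) :
    ((List.range n).map g).sum ≤ n * c := by
  simpa using List.sum_le_card_nsmul ((List.range n).map g) c (by simpa using h)

theorem tabulate {n : Tm Ty.Val Proc .nat} {f : Tm Ty.Val Proc .nat → Tm Ty.Val Proc τ} {k c c' : ℕ}
    {g : ℕ → τ.Val} (hn : Spec n k c) (hf : ∀ i < k, Spec (f (.var i)) (g i) c') :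
    Spec (tabulate n f) ((List.range k).map g : List τ.Val) (c + k * (c' + 1) + 1) := by
  obtain ⟨rfl, hn⟩ := hn
  refine ⟨List.map_congr_left fun i hi => (hf i (List.mem_range.1 hi)).1, ?_⟩
  have := sum_map_range_le (g := fun i => (f (.var i)).run.2 + 1) fun i hi =>
    Nat.add_le_add_right (hf i hi).2 1
  simp only [MME.tabulate, Tm.run]
  gcongr

theorem get {a : Tm Ty.Val Proc (.arr τ)} {i : Tm Ty.Val Proc .nat} {v : List τ.Val} {k c c' : ℕ}
    (ha : Spec a v c) (hi : Spec i k c') : Spec (.get a i) (v.getD k τ.dflt) (c + c' + 1) := by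
  obtain ⟨rfl, ha⟩ := ha
  obtain ⟨rfl, hi⟩ := hi
  exact ⟨rfl, by simp only [Tm.run]; gcongr⟩

theorem getNat {a : Tm Ty.Val Proc (.arr .nat)} {i : Tm Ty.Val Proc .nat} {v : List ℕ} {k c c' : ℕ}
    (ha : Spec a v c) (hi : Spec i k c') : Spec (.get a i) (v.getD k 0) (c + c' + 1) := get ha hi

theorem getArr {a : Tm Ty.Val Proc (.arr (.arr .nat))} {i : Tm Ty.Val Proc .nat}
    {v : List (List ℕ)} {k c c' : ℕ} (ha : Spec a v c) (hi : Spec i k c') :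
    Spec (.get a i) (v.getD k []) (c + c' + 1) := get ha hi

theorem getArrArr {a : Tm Ty.Val Proc (.arr (.arr (.arr .nat)))} {i : Tm Ty.Val Proc .nat}
    {v : List (List (List ℕ))} {k c c' : ℕ} (ha : Spec a v c) (hi : Spec i k c') :
    Spec (.get a i) (v.getD k []) (c + c' + 1) := get ha hi

theorem len {a : Tm Ty.Val Proc (.arr τ)} {v : List τ.Val} {c : ℕ} (ha : Spec a v c) :
    Spec (.len a) v.length (c + 1) := by
  obtain ⟨rfl, ha⟩ := ha
  exact ⟨rfl, by simp only [Tm.run]; gcongr⟩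

theorem concat {a : Tm Ty.Val Proc (.arr (.arr τ))} {v : List (List τ.Val)} {c : ℕ}
    (ha : Spec a v c) :
    Spec (.concat a) (v.flatten : List τ.Val) (c + (v.map fun l => l.length + 1).sum + 1) := by
  obtain ⟨rfl, ha⟩ := ha
  exact ⟨rfl, by simp only [Tm.run]; gcongr⟩

/-- The sequence `v` is the loop invariant in closed form: a round has to be checked only at the
state `v i`. -/
theorem iter {n : Tm Ty.Val Proc .nat} {x : Tm Ty.Val Proc σ}
    {f : Tm Ty.Val Proc .nat → Tm Ty.Val Proc σ → Tm Ty.Val Proc σ} {k c₁ c₂ c : ℕ}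
    (v : ℕ → σ.Val) (hn : Spec n k c₁) (hx : Spec x (v 0) c₂)
    (hf : ∀ i < k, Spec (f (.var i) (.var (v i))) (v (i + 1)) c) :
    Spec (iter n x f) (v k) (c₁ + (c₂ + k * (c + 1)) + 1) := by
  obtain ⟨hk, hn⟩ := hn
  have key : ∀ j : ℕ, j ≤ k → (Nat.rec x.run (fun i acc =>
      ((f (.var i) (.var acc.1)).run.1, acc.2 + (f (.var i) (.var acc.1)).run.2 + 1)) j :
      σ.Val × ℕ).1 = v j ∧ (Nat.rec x.run (fun i acc =>
      ((f (.var i) (.var acc.1)).run.1, acc.2 + (f (.var i) (.var acc.1)).run.2 + 1)) j :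
      σ.Val × ℕ).2 ≤ c₂ + j * (c + 1) := by
    intro j
    induction j with
    | zero => intro _; exact ⟨hx.1, by simpa using hx.2⟩
    | succ j ih =>
      intro hj
      obtain ⟨h1, h2⟩ := ih (by omega)
      have := hf j (by omega)
      simp only [h1]
      refine ⟨this.1, ?_⟩
      have := this.2
      rw [Nat.succ_mul]
      omega
  obtain ⟨h1, h2⟩ := key k le_rfl
  simp only [Spec, MME.iter, Tm.run, hk]
  exact ⟨h1, by gcongr⟩

/-- `Q j y w c` says that the procedure of level `j` returns `w` on `y` within `c` steps. -/
theorem recursion {n : Tm Ty.Val Proc .nat} {x : Tm Ty.Val Proc σ}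
    {base : Tm Ty.Val Proc σ → Tm Ty.Val Proc τ}
    {step : Tm Ty.Val Proc .nat → (Tm Ty.Val Proc σ → Tm Ty.Val Proc τ) → Tm Ty.Val Proc σ →
      Tm Ty.Val Proc τ} {k c₁ c₂ c : ℕ} {v : σ.Val} {w : τ.Val}
    (Q : ℕ → σ.Val → τ.Val → ℕ → Prop) (hn : Spec n k c₁) (hx : Spec x v c₂)
    (hbase : ∀ y w c, Q 0 y w c → Spec (base (.var y)) w c)
    (hstep : ∀ j < k, ∀ rc : Tm Ty.Val Proc σ → Tm Ty.Val Proc τ,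
      (∀ u y w c c', Q j y w c → Spec u y c' → Spec (rc u) w (c + c' + 1)) →
      ∀ y w c, Q (j + 1) y w c → Spec (step (.var j) rc (.var y)) w c)
    (h : Q k v w c) : Spec (recursion n x base step) w (c₁ + c₂ + c + 1) := by
  obtain ⟨hk, hn⟩ := hn
  obtain ⟨rfl, hx⟩ := hx
  have key : ∀ j : ℕ, j ≤ k → ∀ y w c, Q j y w c →
      ((Nat.rec (motive := fun _ => Proc σ τ) (fun v => (base (.var v)).run)
        (fun k F v => (step (.var k) (.call F) (.var v)).run) j : Proc σ τ) y).1 = w ∧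
      ((Nat.rec (motive := fun _ => Proc σ τ) (fun v => (base (.var v)).run)
        (fun k F v => (step (.var k) (.call F) (.var v)).run) j : Proc σ τ) y).2 ≤ c := by
    intro j
    induction j with
    | zero => intro _ y w c h; exact hbase y w c h
    | succ j ih =>
      intro hj y w c h
      -- The body is checked against any `rc` that meets the specification `Q j`. Here `rc` is the
      -- call of level `j`, whose own step is the `+ 1` in `c + c' + 1`.
      refine hstep j (by omega) _ (fun u y w c c' h hu => ?_) y w c h
      obtain ⟨rfl, hu⟩ := hu
      obtain ⟨h1, h2⟩ := ih (by omega) _ w c h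
      refine ⟨h1, ?_⟩
      simp only [Tm.run]
      omega
  obtain ⟨h1, h2⟩ := key k le_rfl _ _ _ h
  simp only [Spec, MME.recursion, Tm.run, hk]
  exact ⟨h1, by gcongr⟩

end Spec

/-! ### Bounds by powers of a parameter -/

/-- `a ≤ S ^ k` for `S ≥ 2`. -/
class LePow (S a : ℕ) (k : outParam ℕ) : Prop where
  two_le : 2 ≤ S
  le : a ≤ S ^ k

namespace LePow

variable {S a b i j : ℕ}

/-- The exponent `i` is read off the shape of `a` by the instances, and only `i ≤ k` is left to
decide. The explicit powers of `S` below are verified in this way. -/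
theorem le_of (k : ℕ) [h : LePow S a i] (hk : i ≤ k := by decide) : a ≤ S ^ k :=
  h.le.trans (Nat.pow_le_pow_right (by have := h.two_le; omega) hk)

theorem of_le (hS : 2 ≤ S) (h : a ≤ S) : LePow S a 1 := ⟨hS, by simpa⟩

instance [ha : LePow S a i] [hb : LePow S b j] : LePow S (a + b) (max i j + 1) where
  two_le := ha.two_le
  le := by
    have h := ha.two_le
    have h1 : a ≤ S ^ max i j := le_of _ (le_max_left i j)
    have h2 : b ≤ S ^ max i j := le_of _ (le_max_right i j)
    rw [pow_succ]
    nlinarith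

instance [ha : LePow S a i] [hb : LePow S b j] : LePow S (a * b) (i + j) where
  two_le := ha.two_le
  le := by rw [pow_add]; exact Nat.mul_le_mul ha.le hb.le

instance [ha : LePow S a i] : LePow S (a - b) i where
  two_le := ha.two_le
  le := (Nat.sub_le _ _).trans ha.le

theorem pow_of (hS : 2 ≤ S) (k : ℕ) : LePow S (S ^ k) k := ⟨hS, le_rfl⟩

theorem two_pow (hS : 2 ≤ S) (n : ℕ) : LePow S (2 ^ n) n := ⟨hS, Nat.pow_le_pow_left hS n⟩

instance [h : Fact (2 ≤ S)] : LePow S 0 0 := ⟨h.1, by simp⟩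

instance [h : Fact (2 ≤ S)] : LePow S 1 0 := ⟨h.1, by simp⟩

instance [h : Fact (2 ≤ S)] : LePow S 2 1 := two_pow h.1 1

instance [h : Fact (2 ≤ S)] : LePow S 16 4 := two_pow h.1 4

instance [h : Fact (2 ≤ S)] : LePow S 128 7 := two_pow h.1 7

instance [h : Fact (2 ≤ S)] : LePow S S 1 := of_le h.1 le_rfl

instance [h : Fact (2 ≤ S)] (k : ℕ) : LePow S (S ^ k) k := pow_of h.1 k

end LePow

theorem size_mul_le (a b : ℕ) : (a * b).size ≤ a.size + b.size := by
  rw [Nat.size_le, pow_add]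
  exact Nat.mul_lt_mul'' (Nat.lt_size_self a) (Nat.lt_size_self b)

theorem size_sum_le {ι : Type*} (s : Finset ι) {f : ι → ℕ} {c : ℕ} (h : ∀ i ∈ s, (f i).size ≤ c) :
    (∑ i ∈ s, f i).size ≤ s.card + (c + 1) := by
  have h1 : ∑ i ∈ s, f i ≤ s.card * 2 ^ c := by
    simpa using Finset.sum_le_card_nsmul s f (2 ^ c) fun i hi => (Nat.size_le.1 (h i hi)).le
  refine (Nat.size_le_size h1).trans ((size_mul_le _ _).trans ?_)
  rw [Nat.size_pow]
  gcongr
  exact Nat.size_le.2 Nat.lt_two_pow_self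

theorem size_le_self (a : ℕ) : a.size ≤ a := Nat.size_le.2 Nat.lt_two_pow_self

theorem size_pow_le (a n : ℕ) : (a ^ n).size ≤ n * a.size + 1 := by
  induction n with
  | zero => simp
  | succ n ih =>
    rw [pow_succ, Nat.succ_mul]
    exact (size_mul_le _ _).trans (by omega)

namespace LePow

variable {S a b i j : ℕ}

instance [ha : LePow S a.size i] [hb : LePow S b.size j] : LePow S (a + b).size (max i j + 1) where
  two_le := ha.two_le
  le := by
    have h := ha.two_le
    have h1 : a.size ≤ S ^ max i j := le_of _ (le_max_left i j)
    have h2 : b.size ≤ S ^ max i j := le_of _ (le_max_right i j)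
    have h3 : 1 ≤ S ^ max i j := Nat.one_le_pow _ _ (by omega)
    have hm : (a + b).size ≤ max a.size b.size + 1 := by
      rw [Nat.size_le, pow_succ]
      have := (Nat.lt_size_self a).trans_le (Nat.pow_le_pow_right two_pos (le_max_left _ b.size))
      have := (Nat.lt_size_self b).trans_le (Nat.pow_le_pow_right two_pos (le_max_right a.size _))
      omega
    rw [pow_succ]
    have : max a.size b.size ≤ S ^ max i j := max_le h1 h2
    nlinarith

instance [ha : LePow S a.size i] [hb : LePow S b.size j] :
    LePow S (a * b).size (max i j + 1) where
  two_le := ha.two_le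
  le := (size_mul_le a b).trans (LePow.le : a.size + b.size ≤ _)

instance [ha : LePow S a.size i] : LePow S (a - b).size i where
  two_le := ha.two_le
  le := (Nat.size_le_size (Nat.sub_le _ _)).trans ha.le

instance [ha : LePow S a.size i] : LePow S (a / b).size i where
  two_le := ha.two_le
  le := (Nat.size_le_size (Nat.div_le_self _ _)).trans ha.le

instance (priority := low) sizeMod [ha : LePow S a.size i] : LePow S (a % b).size i where
  two_le := ha.two_le
  le := (Nat.size_le_size (Nat.mod_le _ _)).trans ha.le

/-- A remainder is bounded by its modulus in preference to its dividend, so that loop states reduced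
modulo `q` do not grow from round to round. -/
instance sizeModRight [ha : LePow S a.size i] [NeZero a] : LePow S (b % a).size i where
  two_le := ha.two_le
  le := (Nat.size_le_size (Nat.mod_lt _ (NeZero.pos a)).le).trans ha.le

instance [ha : LePow S a.size i] [hb : LePow S b j] : LePow S (a ^ b).size (i + j + 1) where
  two_le := ha.two_le
  le := by
    have := Fact.mk ha.two_le
    refine (size_pow_le a b).trans ?_
    have : b * a.size + 1 ≤ S ^ (max (j + i) 0 + 1) := LePow.le
    rwa [add_comm i j, ← Nat.max_zero (j + i)]

instance (priority := low) sizeSelf [ha : LePow S a i] : LePow S a.size i where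
  two_le := ha.two_le
  le := (size_le_self a).trans ha.le

end LePow
/-- `a ≤ S ^ k * X` for `S ≥ 2` and `X ≥ 1`. -/
class LePowMul (S X a : ℕ) (k : outParam ℕ) : Prop where
  two_le : 2 ≤ S
  one_le : 1 ≤ X
  le : a ≤ S ^ k * X

namespace LePowMul

variable {S X Y a b i j : ℕ}

/-- `S` collects the polynomial factors, while `X` stands for a quantity that must enter only
linearly, such as `d ^ m` or the number of points or exponents. -/
theorem le_of (k : ℕ) [h : LePowMul S X a i] (hk : i ≤ k := by decide) : a ≤ S ^ k * X :=
  h.le.trans (Nat.mul_le_mul_right _ (Nat.pow_le_pow_right (by have := h.two_le; omega) hk))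

theorem of_le (hS : 2 ≤ S) (hX : 1 ≤ X) (h : a ≤ X) : LePowMul S X a 0 := ⟨hS, hX, by simpa⟩

instance (priority := low) ofLePow [h : LePow S a i] [hX : Fact (1 ≤ X)] : LePowMul S X a i :=
  ⟨h.two_le, hX.1, h.le.trans (Nat.le_mul_of_pos_right _ hX.1)⟩

instance [hS : Fact (2 ≤ S)] [hX : Fact (1 ≤ X)] : LePowMul S X X 0 := of_le hS.1 hX.1 le_rfl

instance [hS : Fact (2 ≤ S)] [hX : Fact (1 ≤ X)] (k : ℕ) : LePowMul S X (S ^ k * X) k :=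
  ⟨hS.1, hX.1, le_rfl⟩

instance [ha : LePowMul S X a i] [hb : LePowMul S X b j] :
    LePowMul S X (a + b) (max i j + 1) where
  two_le := ha.two_le
  one_le := ha.one_le
  le := by
    have h := ha.two_le
    have h1 : a ≤ S ^ max i j * X := le_of _ (le_max_left i j)
    have h2 : b ≤ S ^ max i j * X := le_of _ (le_max_right i j)
    rw [pow_succ]
    nlinarith

instance mulLeft [ha : LePow S a i] [hb : LePowMul S X b j] : LePowMul S X (a * b) (i + j) where
  two_le := ha.two_le
  one_le := hb.one_le
  le := by rw [pow_add, mul_assoc]; exact Nat.mul_le_mul ha.le hb.le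

instance mulRight [ha : LePowMul S X a i] [hb : LePow S b j] : LePowMul S X (a * b) (i + j) where
  two_le := ha.two_le
  one_le := ha.one_le
  le := by rw [pow_add, mul_right_comm]; exact Nat.mul_le_mul ha.le hb.le

instance mul [ha : LePowMul S X a i] [hb : LePowMul S Y b j] :
    LePowMul S (X * Y) (a * b) (i + j) where
  two_le := ha.two_le
  one_le := Nat.mul_pos ha.one_le hb.one_le
  le := by rw [pow_add, mul_mul_mul_comm]; exact Nat.mul_le_mul ha.le hb.le

end LePowMul

/-! ### Subroutines -/

theorem Spec.var' {S : ℕ} [hS : Fact (2 ≤ S)] {τ : Ty} (v : τ.Val) : Spec (.var v) v S :=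
  (Spec.var v).mono (by have := hS.1; omega)

theorem getD_mem {α : Type} {l : List α} {i : ℕ} (x : α) (hi : i < l.length) : l.getD i x ∈ l := by
  rw [List.getD_eq_getElem _ _ hi]
  exact List.getElem_mem hi

theorem size_getD_le {S : ℕ} {l : List ℕ} (hs : ∀ x ∈ l, x.size ≤ S) (i : ℕ) : (l.getD i 0).size ≤ S := by
  by_cases hi : i < l.length
  · exact hs _ (getD_mem _ hi)
  · rw [List.getD_eq_default _ _ (by omega)]
    simp

/-! ### Powers, modular powers and binomial coefficients. -/

section Arithmetic

variable {S : ℕ} [hS : Fact (2 ≤ S)] {b n q : Tm Ty.Val Proc .nat} {vb vn vq : ℕ}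

theorem Spec.pow (hb : Spec b vb S) (hn : Spec n vn S) (hbs : vb.size ≤ S) (hns : vn ≤ S) :
    Spec (pow b n) (vb ^ vn : ℕ) (S ^ 20) := by
  have := LePow.of_le hS.1 hbs
  have := LePow.of_le hS.1 hns
  refine (Spec.iter (c := S ^ 15) (fun i => vb ^ i) hn (.lit 1) fun i hi => ?_).mono ?_
  · have := LePow.of_le hS.1 (hi.le.trans hns)
    exact ((Spec.var _).mul hb).mono (LePow.le_of 15)
  · exact LePow.le_of 20 (by norm_num)

/-- After `i` rounds the low `i` bits of the exponent have been used, and `vn < 2 ^ vn.size` ends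
the loop. The cost depends on the length of the exponent and not on its value, which is needed for
exponents of the size of `p ^ m`. -/
theorem Spec.powMod (hb : Spec b vb S) (hn : Spec n vn S) (hq : Spec q vq S) (hbs : vb.size ≤ S)
    (hns : vn.size ≤ S) (hqs : vq.size ≤ S) (hq1 : 1 < vq) :
    Spec (powMod b n q) (vb ^ vn % vq : ℕ) (S ^ 50) := by
  have := LePow.of_le hS.1 hbs
  have := LePow.of_le hS.1 hns
  have := LePow.of_le hS.1 hqs
  have : NeZero vq := ⟨by omega⟩
  have key := Spec.iter (σ := .prod .nat (.prod .nat .nat)) (n := .bits n)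
    (x := .pair (b % q) (.pair n 1)) (f := fun _ st =>
      MME.letIn (.fst st) fun x => MME.letIn (.fst (.snd st)) fun k =>
      MME.letIn (.snd (.snd st)) fun y =>
        .pair (x * x % q) (.pair (k / 2) (.ifLt 0 (k % 2) (y * x % q) y)))
    (fun i => (vb ^ 2 ^ i % vq, vn / 2 ^ i, vb ^ (vn % 2 ^ i) % vq)) (c := S ^ 40) hn.bits
    (c₂ := S ^ 20) ?_ fun i hi => ?_
  · refine ((Spec.snd (Spec.snd key))).congr ?_ ?_
    · show vb ^ (vn % 2 ^ vn.size) % vq = _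
      rw [Nat.mod_eq_of_lt (Nat.lt_size_self vn)]
    · exact LePow.le_of 50 (by norm_num)
  · refine (((hb.mod hq).congr (by simp) le_rfl).pair ((hn.congr (by simp) le_rfl).pair
      (.lit 1 (by simp [Nat.mod_one, Nat.mod_eq_of_lt hq1])))).mono ?_
    exact LePow.le_of 20 (by norm_num)
  · refine Spec.mono (Spec.letIn (v := (vb ^ 2 ^ i % vq : ℕ)) (Spec.var _).fst
      (Spec.letIn (v := (vn / 2 ^ i : ℕ)) (Spec.var _).snd.fst
      (Spec.letIn (v := (vb ^ (vn % 2 ^ i) % vq : ℕ)) (Spec.var _).snd.snd (Spec.pair (Spec.congr (((Spec.var _).mul (Spec.var _)).mod hq)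
      ?_ le_rfl) (Spec.pair (Spec.congr ((Spec.var _).div (Spec.lit 2)) ?_ le_rfl)
      (Spec.ifLt (c := S ^ 20) (.lit 0) ((Spec.var _).mod (.lit 2)) (fun h => ?_)
      fun h => ?_)))))) ?_
    · rw [pow_succ, pow_mul, sq, ← Nat.mul_mod]
    · rw [pow_succ, Nat.div_div_eq_div_mul]
    · refine (((Spec.var _).mul (Spec.var _)).mod hq).congr ?_ ?_
      · rw [← Nat.mul_mod, ← pow_add]
        congr 2
        rw [pow_succ, Nat.mod_mul]
        have : vn / 2 ^ i % 2 = 1 := by omega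
        rw [this, mul_one]
      · exact LePow.le_of 20 (by norm_num)
    · refine (Spec.var _).congr ?_ ?_
      · congr 2
        rw [pow_succ, Nat.mod_mul]
        have : vn / 2 ^ i % 2 = 0 := by omega
        rw [this, mul_zero, add_zero]
      · exact LePow.le_of 20 (by norm_num)
    · exact LePow.le_of 40 (by norm_num)

/-- The division in the loop is exact because `choose b (i + 1) * (i + 1) = choose b i * (b - i)`.
Intermediate values stay below `2 ^ vb`, up to equality, hence have short expansions. -/
theorem Spec.binomial (hb : Spec b vb S) (hn : Spec n vn S) (hbs : vb ≤ S) (hns : vn ≤ S) :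
    Spec (binomial b n) (vb.choose vn) (S ^ 40) := by
  have := LePow.of_le hS.1 hbs
  have := LePow.of_le hS.1 hns
  refine (Spec.iter (c := S ^ 30) (fun i => vb.choose i) hn (.lit 1 (by simp))
    fun i hi => ?_).mono ?_
  · have := LePow.of_le hS.1 (hi.le.trans hns)
    have : LePow S (vb.choose i).size 3 := ⟨hS.1, (Nat.size_le_size (Nat.choose_le_two_pow vb i)).trans
      (by rw [Nat.size_pow]; exact LePow.le_of 3)⟩
    refine ((((Spec.var _).mul (hb.sub (Spec.var _)))).div ((Spec.var _).add (.lit 1))).congr ?_ ?_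
    · rw [← Nat.choose_succ_right_eq]
      simp
    · exact LePow.le_of 30 (by norm_num)
  · exact LePow.le_of 40 (by norm_num)

end Arithmetic

/-! ### Sums, products, reductions and codes of arrays. -/

section Lists

variable {S : ℕ} [hS : Fact (2 ≤ S)] {b q : Tm Ty.Val Proc .nat} {v w e : Tm Ty.Val Proc (.arr .nat)}
  {vb vq : ℕ} {l l' le : List ℕ}

theorem sum_range_getD (l : List ℕ) : ∑ i ∈ Finset.range l.length, l.getD i 0 = l.sum := by
  rw [Finset.sum_range, ← Fin.sum_univ_getElem]
  simp

theorem prod_range_getD (l : List ℕ) : ∏ i ∈ Finset.range l.length, l.getD i 0 = l.prod := by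
  rw [Finset.prod_range, ← Fin.prod_univ_getElem]
  simp

theorem getD_lt {l : List ℕ} {q : ℕ} (hq : 0 < q) (h : ∀ x ∈ l, x < q) (i : ℕ) :
    l.getD i 0 < q := by
  by_cases hi : i < l.length
  · rw [List.getD_eq_getElem _ _ hi]
    exact h _ (List.getElem_mem hi)
  · rwa [List.getD_eq_default _ _ (by omega)]

theorem Spec.arrSum (hv : Spec v l S) (hl : l.length ≤ S) (hs : l.sum.size ≤ S) :
    Spec (arrSum v) l.sum (S ^ 30) := by
  have := LePow.of_le hS.1 hl
  refine (Spec.iter (c := S ^ 20) (fun i => ∑ j ∈ Finset.range i, l.getD j 0) hv.len (.lit 0)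
    fun i hi => ?_).congr (sum_range_getD l) ?_
  · have h1 : ∑ j ∈ Finset.range (i + 1), l.getD j 0 ≤ l.sum := by
      rw [← sum_range_getD]
      exact Finset.sum_le_sum_of_subset (by simpa using hi)
    rw [Finset.sum_range_succ] at h1 ⊢
    have := LePow.of_le hS.1 ((Nat.size_le_size ((Nat.le_add_right _ _).trans h1)).trans hs)
    have := LePow.of_le hS.1 ((Nat.size_le_size ((Nat.le_add_left _ _).trans h1)).trans hs)
    exact ((Spec.var _).add (hv.getNat (.var _))).mono (LePow.le_of 20)
  · exact LePow.le_of 30 (by norm_num)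

/-- Positive entries make every partial product at most the full one, whose length is assumed to be
bounded. -/
theorem Spec.arrProd (hv : Spec v l S) (hl : l.length ≤ S) (hs : l.prod.size ≤ S)
    (h0 : ∀ x ∈ l, 0 < x) : Spec (arrProd v) l.prod (S ^ 30) := by
  have := LePow.of_le hS.1 hl
  refine (Spec.iter (c := S ^ 20) (fun i => ∏ j ∈ Finset.range i, l.getD j 0) hv.len (.lit 1)
    fun i hi => ?_).congr (prod_range_getD l) ?_
  · have h1 : ∏ j ∈ Finset.range (i + 1), l.getD j 0 ≤ l.prod := by
      rw [← prod_range_getD]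
      refine Finset.prod_le_prod_of_subset_of_one_le' (by simpa using hi) fun j hj _ => ?_
      rw [List.getD_eq_getElem _ _ (by simpa using hj)]
      exact h0 _ (List.getElem_mem _)
    have h2 : 0 < ∏ j ∈ Finset.range i, l.getD j 0 := by
      refine Finset.prod_pos fun j hj => ?_
      rw [List.getD_eq_getElem _ _ (by simp at hj; omega)]
      exact h0 _ (List.getElem_mem _)
    have h3 : 0 < l.getD i 0 := by
      rw [List.getD_eq_getElem _ _ hi]
      exact h0 _ (List.getElem_mem _)
    rw [Finset.prod_range_succ] at h1 ⊢
    have := LePow.of_le hS.1 ((Nat.size_le_size ((Nat.le_mul_of_pos_right _ h3).trans h1)).trans hs)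
    have := LePow.of_le hS.1 ((Nat.size_le_size ((Nat.le_mul_of_pos_left _ h2).trans h1)).trans hs)
    exact ((Spec.var _).mul (hv.getNat (.var _))).mono (LePow.le_of 20)
  · exact LePow.le_of 30 (by norm_num)

theorem map_range_getD {α β : Type} (l : List α) (x : α) (F : α → β) :
    (List.range l.length).map (fun i => F (l.getD i x)) = l.map F :=
  List.ext_getElem (by simp) fun i hi _ => by simp at hi; simp [hi]

theorem getD_map_range {α : Type} (n : ℕ) (F : ℕ → α) (x : α) {i : ℕ} (hi : i < n) :
    ((List.range n).map F).getD i x = F i := by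
  rw [List.getD_eq_getElem _ _ (by simpa)]
  simp

theorem Spec.reduce {X : ℕ} (hv : Spec v l S) (hq : Spec q vq S) (hqs : vq.size ≤ S)
    (hs : ∀ x ∈ l, x.size ≤ S) (hX : 1 ≤ X) (hl : l.length ≤ X) :
    Spec (reduce v q) (l.map (· % vq)) (S ^ 30 * X) := by
  have := LePow.of_le hS.1 hqs
  have := Fact.mk hX
  have := LePowMul.of_le hS.1 hX hl
  refine (Spec.tabulate (c' := S ^ 15) (g := fun i => l.getD i 0 % vq) hv.len
    fun i hi => ?_).congr (map_range_getD l 0 (· % vq)) (LePowMul.le_of 30)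
  have := LePow.of_le hS.1 (size_getD_le hs i)
  exact ((hv.getNat (.var _)).mod hq).mono (LePow.le_of 15)

theorem Spec.code (hb : Spec b vb S) (hv : Spec v l S) (hbs : vb.size ≤ S)
    (hl : l.length ≤ S) (hs : ∀ x ∈ l, x.size ≤ S) :
    Spec (code b v) (∑ i ∈ Finset.range l.length, l.getD i 0 * vb ^ i : ℕ) (S ^ 50) := by
  have := LePow.of_le hS.1 hbs
  have := LePow.of_le hS.1 hl
  have hg : ∀ i, LePow S (l.getD i 0).size 1 := fun i => .of_le hS.1 (size_getD_le hs i)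
  have hsum : ∀ i ≤ l.length, (∑ j ∈ Finset.range i, l.getD j 0 * vb ^ j).size ≤ S ^ 20 := by
    intro i hi
    refine (size_sum_le (c := S ^ 10) _ fun j hj => ?_).trans ?_
    · have := LePow.of_le hS.1 ((Finset.mem_range.1 hj).le.trans (hi.trans hl))
      exact LePow.le_of 10
    · have := LePow.of_le hS.1 (hi.trans hl)
      rw [Finset.card_range]
      exact LePow.le_of 20
  refine (Spec.iter (c := S ^ 40) (fun i => ∑ j ∈ Finset.range i, l.getD j 0 * vb ^ j) hv.len
    (.lit 0) fun i hi => ?_).mono ?_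
  · have : LePow S (∑ j ∈ Finset.range i, l.getD j 0 * vb ^ j).size 20 := ⟨hS.1, hsum i hi.le⟩
    have := LePow.of_le hS.1 (hi.le.trans hl)
    rw [Finset.sum_range_succ]
    refine ((Spec.var _).add ((hv.getNat (.var _)).mul (Spec.pow hb (Spec.var' _) hbs
      (hi.le.trans hl)))).mono (LePow.le_of 40)
  · exact LePow.le_of 50 (by norm_num)

end Lists

/-! ### The exponent vectors of order less than `s` and their number. -/

section Exponents

variable {S : ℕ} [hS : Fact (2 ≤ S)]

theorem Spec.single {τ : Ty} {x : Tm Ty.Val Proc τ} {a : τ.Val} {c : ℕ} (hx : Spec x a c) :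
    Spec (single x) ([a] : List τ.Val) (c + 16) :=
  (Spec.tabulate (g := fun _ => a) (Spec.lit 1) fun _ _ => hx).congr rfl (by
    have : Nat.size 1 = 1 := rfl
    omega)

theorem Spec.snoc {v : Tm Ty.Val Proc (.arr .nat)} {x : Tm Ty.Val Proc .nat} {l : List ℕ}
    {a c₁ c₂ : ℕ} (hv : Spec v l c₁) (hx : Spec x a c₂) :
    Spec (snoc v x) (l ++ [a]) (2 * c₁ + 2 * c₂ + l.length + 128) := by
  refine (Spec.concat (Spec.tabulate (g := fun i => if i < 1 then l else [a])
    (c' := c₁ + c₂ + 36) (Spec.lit 2) fun i hi => Spec.mono (Spec.ifLt (c := c₁ + c₂ + 16) (.var i)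
      (.lit 1) (fun h => ?_) fun h => ?_) ?_)).congr (by simp [List.range_succ]) ?_
  · rw [if_pos h]; exact hv.mono (by omega)
  · rw [if_neg (by omega)]; exact hx.single.mono (by omega)
  · have : i.size ≤ i := size_le_self i
    have : Nat.size 1 = 1 := rfl
    omega
  · have : Nat.size 2 = 2 := rfl
    simp [List.range_succ]
    omega

/-- The lists of length `l` with sum less than `s`. -/
def expList (s : ℕ) : ℕ → List (List ℕ)
  | 0 => [[]]
  | l + 1 => ((expList s l).map fun v => (List.range (s - v.sum)).map fun c => v ++ [c]).flatten

theorem mem_expList {s : ℕ} (hs : 1 ≤ s) {l : ℕ} {v : List ℕ} :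
    v ∈ expList s l ↔ v.length = l ∧ v.sum < s := by
  induction l generalizing v with
  | zero => simp only [expList, List.mem_singleton, List.length_eq_zero_iff]
            exact ⟨by rintro rfl; simpa, fun h => h.1⟩
  | succ l ih =>
    simp only [expList, List.mem_flatten, List.mem_map]
    constructor
    · rintro ⟨_, ⟨w, hw, rfl⟩, h⟩
      obtain ⟨c, hc, rfl⟩ := List.mem_map.1 h
      obtain ⟨h1, h2⟩ := ih.1 hw
      rw [List.mem_range] at hc
      simp [h1]
      omega
    · rintro ⟨h1, h2⟩
      have hne : v ≠ [] := by rintro rfl; simp at h1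
      have h3 := List.dropLast_append_getLast hne
      have h4 : v.dropLast.sum + v.getLast hne = v.sum := by
        conv_rhs => rw [← h3]
        simp
      refine ⟨_, ⟨v.dropLast, ih.2 ⟨by simp [h1], by omega⟩, rfl⟩, ?_⟩
      exact List.mem_map.2 ⟨v.getLast hne, by rw [List.mem_range]; omega, h3⟩

theorem nodup_expList (s l : ℕ) : (expList s l).Nodup := by
  induction l with
  | zero => simp [expList]
  | succ l ih =>
    rw [expList, List.nodup_flatten]
    constructor
    · intro _ h
      obtain ⟨v, _, rfl⟩ := List.mem_map.1 h
      exact List.nodup_range.map fun _ _ h => by simpa using h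
    · rw [List.pairwise_map]
      refine ih.imp fun {v w} hvw x hx hy => hvw ?_
      obtain ⟨_, _, rfl⟩ := List.mem_map.1 hx
      obtain ⟨_, _, h⟩ := List.mem_map.1 hy
      exact (List.append_inj_left' h rfl).symm

theorem list_sum_range (n : ℕ) (f : ℕ → ℕ) :
    ((List.range n).map f).sum = ∑ i ∈ Finset.range n, f i := rfl

/-- The weight of `v` counts its continuations by `j` further coordinates with total still below
`s`. With this weight the induction on `l` closes: summing over the last coordinate turns weight `j`
into weight `j + 1` by the hockey-stick identity. The case `j = 0` is the plain count. -/
theorem sum_choose_expList {s : ℕ} (hs : 1 ≤ s) (l j : ℕ) :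
    ((expList s l).map fun v => (s - 1 - v.sum + j).choose j).sum =
      (s - 1 + j + l).choose (j + l) := by
  induction l generalizing j with
  | zero => simp [expList]
  | succ l ih =>
    have := ih (j + 1)
    rw [expList, List.map_flatten, List.sum_flatten, List.map_map, List.map_map]
    rw [show s - 1 + j + (l + 1) = s - 1 + (j + 1) + l by ring,
      show j + (l + 1) = j + 1 + l by ring, ← this]
    congr 1
    refine List.map_congr_left fun v hv => ?_
    have hv := ((mem_expList hs).1 hv).2
    have h1 : s - v.sum = s - 1 - v.sum + 1 := by omega
    simp only [Function.comp, List.map_map]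
    rw [h1, list_sum_range, ← Finset.sum_range_reflect]
    rw [show s - 1 - v.sum + (j + 1) = s - 1 - v.sum + j + 1 by ring, ← Nat.sum_range_add_choose]
    refine Finset.sum_congr rfl fun c hc => ?_
    rw [Finset.mem_range] at hc
    simp only [Function.comp, List.sum_append, List.sum_singleton]
    congr 2
    omega

theorem length_expList {s : ℕ} (hs : 1 ≤ s) (l : ℕ) :
    (expList s l).length = (l + s - 1).choose (s - 1) := by
  have := sum_choose_expList hs l 0
  simp at this
  rw [this, ← Nat.choose_symm_add, show s - 1 + l = l + s - 1 by omega]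

theorem length_expList_mono {s : ℕ} (hs : 1 ≤ s) {l m : ℕ} (h : l ≤ m) :
    (expList s l).length ≤ (expList s m).length := by
  rw [length_expList hs, length_expList hs]
  exact Nat.choose_le_choose _ (by omega)

/-- The lists of shorter vectors are no longer than the final one, so the same `X` bounds every
round. -/
theorem Spec.exponents {m s : Tm Ty.Val Proc .nat} {vm vs X : ℕ} (hm : Spec m vm S)
    (hs : Spec s vs S) (hvm : vm ≤ S) (hvs : vs ≤ S) (hs1 : 1 ≤ vs)
    (hX : (expList vs vm).length ≤ X) :
    Spec (exponents m s) (expList vs vm) (S ^ 100 * X) := by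
  have h1 : 1 ≤ X := by
    have := length_expList_mono hs1 (Nat.zero_le vm)
    simp [expList] at this
    omega
  have := Fact.mk h1
  have := LePow.of_le hS.1 hvm
  have := LePow.of_le hS.1 hvs
  refine (Spec.iter (σ := .arr (.arr .nat)) (c := S ^ 80 * X) (expList vs) hm Spec.nil.single
    fun i hi => ?_).mono (LePowMul.le_of 100)
  have hi1 := LePowMul.of_le hS.1 h1 ((length_expList_mono hs1 hi.le).trans hX)
  have := LePow.of_le hS.1 (hi.le.trans hvm)
  refine Spec.congr (Spec.concat (Spec.tabulate (c' := S ^ 60) (g := fun j => (fun v : List ℕ =>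
    (List.range (vs - v.sum)).map fun c => v ++ [c]) ((expList vs i).getD j []))
    (Spec.var _).len fun j hj => ?_)) ?_ ?_
  · obtain ⟨h2, h3⟩ := (mem_expList hs1).1 (getD_mem [] hj)
    refine Spec.mono (Spec.letIn (v := (expList vs i).getD j []) (Spec.getArr (.var _) (.var _))
      (Spec.tabulate (c' := S ^ 40) (Spec.sub hs (Spec.arrSum
        (S := S) (l := (expList vs i).getD j []) (Spec.var' _) (by omega)
        ((size_le_self _).trans (by omega)))) fun c hc => Spec.mono (Spec.snoc (.var _) (.var _)) ?_)) ?_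
    · have : LePow S ((expList vs i).getD j []).length 1 := .of_le hS.1 (by omega)
      exact LePow.le_of 40
    · have : LePow S ((expList vs i).getD j []).sum 1 := .of_le hS.1 (by omega)
      exact LePow.le_of 60
  · exact congrArg List.flatten (map_range_getD (expList vs i) [] fun v : List ℕ =>
      (List.range (vs - v.sum)).map fun c => v ++ [c])
  · have : ∀ L : List (List ℕ), ((L.map fun v : List ℕ => (List.range (vs - v.sum)).map
        fun c => v ++ [c]).map fun l => l.length + 1).sum ≤ L.length * (S + 1) := fun L => by
      rw [List.map_map]
      refine (List.sum_le_card_nsmul _ (S + 1) fun x hx => ?_).trans (by simp)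
      obtain ⟨v, _, rfl⟩ := List.mem_map.1 hx
      simp
      omega
    have h2 := this (expList vs i)
    rw [← map_range_getD (expList vs i) [] fun v : List ℕ => (List.range (vs - v.sum)).map
        fun c => v ++ [c]] at h2
    refine (Nat.add_le_add_right (Nat.add_le_add_left h2 _) _).trans ?_
    exact LePowMul.le_of 80

end Exponents

/-! ### Costs of Taylor sums, Hasse derivatives and grid evaluation. -/

section Polynomials

variable {S : ℕ} [hS : Fact (2 ≤ S)] {m d q r : Tm Ty.Val Proc .nat} {vm vd vq vr : ℕ}

theorem Spec.shiftMonomial {a b e : Tm Ty.Val Proc (.arr .nat)} {la lb le : List ℕ}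
    (hq : Spec q vq S) (ha : Spec a la S) (hb : Spec b lb S) (he : Spec e le S)
    (hqs : vq.size ≤ S) (hq1 : 1 < vq) (has : ∀ x ∈ la, x.size ≤ S)
    (hbs : ∀ x ∈ lb, x.size ≤ S) (hle : le.length ≤ S) (hes : ∀ x ∈ le, x ≤ S) :
    Spec (shiftMonomial q a b e) ((∏ i ∈ Finset.range le.length,
      (la.getD i 0 - lb.getD i 0) ^ le.getD i 0) % vq : ℕ) (S ^ 150) := by
  have := LePow.of_le hS.1 hqs
  have := LePow.of_le hS.1 hle
  have : NeZero vq := ⟨by omega⟩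
  refine (Spec.iter (c := S ^ 140) (fun i => (∏ i ∈ Finset.range i,
      (la.getD i 0 - lb.getD i 0) ^ le.getD i 0) % vq) he.len
      (.lit 1 (by simp [Nat.mod_eq_of_lt hq1])) fun i hi => ?_).mono ?_
  swap
  · exact LePow.le_of 150
  have h1 : le.getD i 0 ≤ S := hes _ (getD_mem _ hi)
  have i1 := LePow.of_le hS.1 h1
  have i2 := LePow.of_le hS.1 (size_getD_le has i)
  have i3 := LePow.of_le hS.1 (size_getD_le hbs i)
  -- The arguments of `pow` are compound and cost more than `S`; hence `Spec.pow` is applied at the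
  -- scale `S ^ 6`.
  have h2 : S ≤ S ^ 6 := LePow.le_of 6
  have : Fact (2 ≤ S ^ 6) := ⟨hS.1.trans h2⟩
  have hp : Spec (MME.pow (.get a (.var i) - .get b (.var i)) (.get e (.var i)))
      ((la.getD i 0 - lb.getD i 0) ^ le.getD i 0 : ℕ) ((S ^ 6) ^ 20) :=
    Spec.pow (((ha.getNat (.var _)).sub (hb.getNat (.var _))).mono (LePow.le_of 6))
      ((he.getNat (.var _)).mono (LePow.le_of 6)) (LePow.le_of 6) (h1.trans h2)
  rw [← pow_mul] at hp
  refine Spec.congr (((Spec.var _).mul hp).mod hq) ?_ (LePow.le_of 140)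
  rw [Finset.prod_range_succ, Nat.mul_mod, Nat.mod_mod, ← Nat.mul_mod]

theorem Spec.taylor {E : Tm Ty.Val Proc (.arr (.arr .nat))} {a b : Tm Ty.Val Proc (.arr .nat)}
    {lE : List (List ℕ)} {la lb : List ℕ} {val : Tm Ty.Val Proc .nat → Tm Ty.Val Proc .nat}
    {w : ℕ → ℕ} {X c : ℕ} (hc : c + 2 ≤ S)
    (hq : Spec q vq S) (hE : Spec E lE c) (ha : Spec a la S) (hb : Spec b lb S)
    (hval : ∀ j < lE.length, Spec (val (.var j)) (w j) S) (hw : ∀ j < lE.length, (w j).size ≤ S)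
    (hqs : vq.size ≤ S) (hq1 : 1 < vq) (has : ∀ x ∈ la, x.size ≤ S)
    (hbs : ∀ x ∈ lb, x.size ≤ S) (hle : ∀ e ∈ lE, e.length ≤ S)
    (hes : ∀ e ∈ lE, ∀ x ∈ e, x ≤ S) (hX1 : 1 ≤ X) (hX : lE.length ≤ X) :
    Spec (taylor q E a b val) ((∑ j ∈ Finset.range lE.length, w j *
      ∏ i ∈ Finset.range (lE.getD j []).length,
        (la.getD i 0 - lb.getD i 0) ^ (lE.getD j []).getD i 0) % vq : ℕ) (S ^ 200 * X) := by
  have := Fact.mk hX1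
  have := LePow.of_le hS.1 hqs
  have := LePowMul.of_le hS.1 hX1 hX
  have : LePow S c 1 := .of_le hS.1 (by omega)
  have : NeZero vq := ⟨by omega⟩
  refine (Spec.iter (c := S ^ 180) (fun i => (∑ j ∈ Finset.range i, w j *
      ∏ i ∈ Finset.range (lE.getD j []).length,
        (la.getD i 0 - lb.getD i 0) ^ (lE.getD j []).getD i 0) % vq) hE.len
      (.lit 0 (by simp)) fun j hj => ?_).mono ?_
  swap
  · exact LePowMul.le_of 200
  have he := getD_mem [] hj
  have := LePow.of_le hS.1 (hw j hj)
  refine Spec.congr (((Spec.var _).add ((hval j hj).mul (Spec.shiftMonomial hq ha hb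
    ((hE.getArr (.var j)).mono (by omega)) hqs hq1 has hbs (hle _ he) (hes _ he)))).mod hq)
    ?_ (LePow.le_of 180)
  rw [Finset.sum_range_succ, Nat.add_mod, Nat.mod_mod, Nat.mul_mod, Nat.mod_mod, ← Nat.mul_mod,
    ← Nat.add_mod]

/-- The coefficient modulo `q` of `x ^ b` in the Hasse derivative with respect to `x ^ e` of the
monomial `x ^ (b + e)` in `l` variables, of individual degrees less than `d`. -/
def hasseCoeff (d q : ℕ) (e : ℕ → ℕ) (b : ℕ) : ℕ → ℕ
  | 0 => 1
  | l + 1 => if b / d ^ l % d + e l < d then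
      hasseCoeff d q e b l * (b / d ^ l % d + e l).choose (e l) % q else 0

theorem hasseCoeff_lt {d q : ℕ} (hq : 1 < q) (e : ℕ → ℕ) (b l : ℕ) : hasseCoeff d q e b l < q := by
  cases l with
  | zero => exact hq
  | succ l =>
    rw [hasseCoeff]
    split_ifs
    · exact Nat.mod_lt _ (by omega)
    · omega

/-- Adding the code of `e` to the index `b` is digitwise addition of exponents whenever no digit
overflows; otherwise `hasseCoeff` is zero and the entry read does not matter. -/
def hasseTable (m d q : ℕ) (e f : List ℕ) : List ℕ :=
  (List.range (d ^ m)).map fun b => hasseCoeff d q (fun i => e.getD i 0) b m *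
    f.getD (b + ∑ i ∈ Finset.range e.length, e.getD i 0 * d ^ i) 0 % q

theorem Spec.hasse {e f : Tm Ty.Val Proc (.arr .nat)} {le lf : List ℕ} {X c : ℕ} (hc : c + 2 ≤ S)
    (hm : Spec m vm S) (hd : Spec d vd S) (hq : Spec q vq S) (he : Spec e le c) (hf : Spec f lf S)
    (hms : vm ≤ S) (hds : vd ≤ S) (hqs : vq.size ≤ S) (hq1 : 1 < vq)
    (hle : le.length ≤ S) (hes : ∀ x ∈ le, x ≤ S) (hfs : ∀ x ∈ lf, x.size ≤ S) (hX1 : 1 ≤ X)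
    (hX : vd ^ vm ≤ X) :
    Spec (hasse m d q e f) (hasseTable vm vd vq le lf) (S ^ 200 * X) := by
  have := Fact.mk hX1
  have := LePow.of_le hS.1 hqs
  have := LePow.of_le hS.1 hms
  have := LePow.of_le hS.1 hds
  have := LePow.of_le hS.1 hle
  have := LePowMul.of_le hS.1 hX1 hX
  have : LePow S c 1 := .of_le hS.1 (by omega)
  have : NeZero vq := ⟨by omega⟩
  have hes' : ∀ x ∈ le, x.size ≤ S := fun x hx => (size_le_self x).trans (hes x hx)
  refine Spec.mono (Spec.tabulate (c' := S ^ 180) (Spec.pow hd hm ((size_le_self _).trans hds) hms)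
    fun b hb => ?_) (LePowMul.le_of 200)
  have : LePow S b.size 3 := ⟨hS.1, (Nat.size_le_size hb.le).trans (LePow.le_of 3)⟩
  have := LePow.of_le hS.1 (size_getD_le hfs
    (b + ∑ i ∈ Finset.range le.length, le.getD i 0 * vd ^ i))
  have : LePow S (hasseCoeff vd vq (fun i => le.getD i 0) b vm).size 1 :=
    .of_le hS.1 ((Nat.size_le_size (hasseCoeff_lt hq1 _ _ _).le).trans hqs)
  have hsum : LePow S (∑ i ∈ Finset.range le.length, le.getD i 0 * vd ^ i).size 10 := by
    refine ⟨hS.1, (size_sum_le (c := S ^ 5) _ fun i hi => ?_).trans ?_⟩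
    · have := LePow.of_le hS.1 (size_getD_le hes' i)
      have := LePow.of_le hS.1 ((Finset.mem_range.1 hi).le.trans hle)
      exact LePow.le_of 5
    · rw [Finset.card_range]
      exact LePow.le_of 10
  refine Spec.mono (Spec.letIn (Spec.iter (c := S ^ 150) (hasseCoeff vd vq (fun i => le.getD i 0) b)
    hm (Spec.lit 1) fun l hl => ?_) (((Spec.var _).mul (hf.getNat ((Spec.var b).add
      (Spec.code hd (he.mono (by omega)) ((size_le_self _).trans hds) hle hes')))).mod hq))
      (LePow.le_of 180)
  have hel : LePow S (le.getD l 0) 1 := by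
    refine .of_le hS.1 ?_
    by_cases hi : l < le.length
    · exact hes _ (getD_mem _ hi)
    · rw [List.getD_eq_default _ _ (by omega)]; simp
  have hpow : Spec (MME.pow d (.var l)) (vd ^ l : ℕ) (S ^ 20) :=
    Spec.pow hd (.var' _) ((size_le_self _).trans hds) (hl.le.trans hms)
  have := LePow.of_le hS.1 (hl.le.trans hms)
  have : LePow S (hasseCoeff vd vq (fun i => le.getD i 0) b l).size 1 :=
    .of_le hS.1 ((Nat.size_le_size (hasseCoeff_lt hq1 _ _ _).le).trans hqs)
  have : LePow S (b / vd ^ l % vd) 1 := by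
    refine .of_le hS.1 ?_
    -- Remainders modulo zero are not reduced, but for `vd = 0` the table is empty because `l < vm`.
    rcases Nat.eq_zero_or_pos vd with h | h
    · have : b < vd ^ vm := hb
      rw [h, zero_pow (by omega)] at this
      omega
    · exact (Nat.mod_lt _ h).le.trans hds
  refine Spec.mono (Spec.letIn (v := (b / vd ^ l % vd + le.getD l 0 : ℕ)) (((((Spec.var b).div hpow).mod hd)).add (he.getNat (.var l)))
    (Spec.ifLt (τ := .nat) (v := hasseCoeff vd vq (fun i => le.getD i 0) b (l + 1)) (c := S ^ 120) (.var _) hd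
      (fun h => ?_) fun h => ?_)) (LePow.le_of 150)
  · rw [hasseCoeff, if_pos h]
    have : LePow S ((b / vd ^ l % vd + le.getD l 0).choose (le.getD l 0)).size 10 :=
      ⟨hS.1, (Nat.size_le_size (Nat.choose_le_two_pow _ _)).trans
        (by rw [Nat.size_pow]; exact LePow.le_of 10)⟩
    exact Spec.mono ((Spec.mul (.var _) (Spec.binomial (.var' _) ((he.getNat (.var l)).mono
      (by omega)) (h.le.trans hds) (by have := hel.le; omega))).mod hq) (LePow.le_of 120)
  · rw [hasseCoeff, if_neg (by omega)]
    exact Spec.mono (.lit 0) (LePow.le_of 120)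

/-- The polynomial in the first `l` variables obtained by substituting `x` for the last one. -/
def substTable (d q l x : ℕ) (f : List ℕ) : List ℕ :=
  (List.range (d ^ l)).map fun u => (∑ c ∈ Finset.range d, f.getD (u + d ^ l * c) 0 * x ^ c) % q

theorem Spec.substLast {f : Tm Ty.Val Proc (.arr .nat)} {l x : Tm Ty.Val Proc .nat} {lf : List ℕ}
    {vl vx X : ℕ} (hd : Spec d vd S) (hq : Spec q vq S) (hl : Spec l vl S) (hx : Spec x vx S)
    (hf : Spec f lf S) (hds : vd ≤ S) (hls : vl ≤ S) (hqs : vq.size ≤ S) (hq1 : 1 < vq)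
    (hxs : vx.size ≤ S) (hfs : ∀ x ∈ lf, x.size ≤ S) (hX1 : 1 ≤ X) (hX : vd ^ vl ≤ X) :
    Spec (substLast d q l x f) (substTable vd vq vl vx lf) (S ^ 100 * X) := by
  have := Fact.mk hX1
  have := LePow.of_le hS.1 hqs
  have := LePow.of_le hS.1 hds
  have := LePow.of_le hS.1 hls
  have := LePow.of_le hS.1 hxs
  have := LePowMul.of_le hS.1 hX1 hX
  have : NeZero vq := ⟨by omega⟩
  refine Spec.mono (Spec.letIn (v := (vd ^ vl : ℕ))
    (Spec.pow hd hl ((size_le_self _).trans hds) hls) (Spec.tabulate (c' := S ^ 80) (.var _)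
      fun u hu => ?_)) (LePowMul.le_of 100)
  have : LePow S u.size 3 := ⟨hS.1, (Nat.size_le_size hu.le).trans (LePow.le_of 3)⟩
  -- Horner's invariant: after `i` rounds the state is the value of the polynomial formed by the top
  -- `i` coefficients.
  refine Spec.congr (Spec.iter (c := S ^ 50) (fun i => (∑ j ∈ Finset.range i,
    lf.getD (u + vd ^ vl * (vd - i + j)) 0 * vx ^ j) % vq) hd (.lit 0 (by simp)) fun i hi => ?_)
    (by simp) (LePow.le_of 80)
  have := LePow.of_le hS.1 (hi.le.trans hds)
  have := LePow.of_le hS.1 (size_getD_le hfs (u + vd ^ vl * (vd - 1 - i)))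
  refine Spec.congr ((((Spec.var _).mul hx).add (hf.getNat ((Spec.var u).add
    ((Spec.var (τ := .nat) (vd ^ vl : ℕ)).mul ((hd.sub (.lit 1)).sub (.var i)))))).mod hq) ?_ ?_
  swap
  · exact LePow.le_of 50
  rw [Finset.sum_range_succ', Nat.add_mod, Nat.mul_mod, Nat.mod_mod, ← Nat.mul_mod, ← Nat.add_mod,
    Finset.sum_mul]
  congr 2
  · refine Finset.sum_congr rfl fun j hj => ?_
    rw [show vd - i + j = vd - (i + 1) + (j + 1) by omega, pow_succ, mul_assoc]
  · rw [pow_zero, mul_one, show vd - 1 - i = vd - (i + 1) + 0 by omega]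

/-- The table of values on the grid `{0, …, r - 1} ^ l`. -/
def gridTable (d r q : ℕ) : ℕ → List ℕ → List ℕ
  | 0, f => f
  | l + 1, f => ((List.range r).map fun x => gridTable d r q l (substTable d q l x f)).flatten

theorem length_gridTable (d r q l : ℕ) {f : List ℕ} (hf : f.length = d ^ l) :
    (gridTable d r q l f).length = r ^ l := by
  induction l generalizing f with
  | zero => simpa [gridTable] using hf
  | succ l ih =>
    have : ∀ x, (gridTable d r q l (substTable d q l x f)).length = r ^ l := fun x =>
      ih (by simp [substTable])
    simp [gridTable, Function.comp_def, this, pow_succ']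

theorem substTable_lt {d q l x : ℕ} (hq : 0 < q) (f : List ℕ) : ∀ y ∈ substTable d q l x f, y < q := by
  intro y hy
  obtain ⟨u, _, rfl⟩ := List.mem_map.1 hy
  exact Nat.mod_lt _ hq

/-- The cost with `j` variables left is `(j + 1) * S ^ 150 * Z ^ j`. The `r` calls one level down
multiply `Z ^ l` by `r ≤ Z`, and the substitutions (`r * d ^ l`) and the copying (`r * r ^ l`) add
one more multiple of `Z ^ (l + 1)`. Thus the overhead grows linearly in the number of variables. -/
theorem Spec.evalGrid {f : Tm Ty.Val Proc (.arr .nat)} {lf : List ℕ} {Z : ℕ}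
    (hm : Spec m vm S) (hd : Spec d vd 1) (hr : Spec r vr S) (hq : Spec q vq 1) (hf : Spec f lf S)
    (hms : vm ≤ S) (hds : vd ≤ S) (hrs : vr.size ≤ S) (hqs : vq.size ≤ S) (hq1 : 1 < vq)
    (hlf : lf.length = vd ^ vm) (hfs : ∀ x ∈ lf, x < vq) (hdZ : vd ≤ Z) (hrZ : vr ≤ Z)
    (hZ : 1 ≤ Z) :
    Spec (evalGrid m d r q f) (gridTable vd vr vq vm lf) (S ^ 200 * Z ^ vm) := by
  have h200 : S + S + (vm + 1) * (S ^ 150 * Z ^ vm) + 1 ≤ S ^ 200 * Z ^ vm := by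
    have := LePow.of_le hS.1 hms
    have := Fact.mk (Nat.one_le_pow vm Z hZ)
    exact LePowMul.le_of 200
  refine Spec.mono (Spec.recursion (fun j g w c => g.length = vd ^ j ∧ (∀ x ∈ g, x < vq) ∧
    w = gridTable vd vr vq j g ∧ c = (j + 1) * (S ^ 150 * Z ^ j)) hm hf ?_ ?_
      ⟨hlf, hfs, rfl, rfl⟩) h200
  · rintro g w c ⟨-, -, rfl, rfl⟩
    refine (Spec.var _).mono ?_
    have : 1 ≤ S ^ 150 := Nat.one_le_pow _ _ (by have := hS.1; omega)
    simpa using this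
  · rintro l hl rc hrc g w c ⟨hg, hgs, rfl, rfl⟩
    have hZl : 1 ≤ Z ^ l := Nat.one_le_pow _ _ hZ
    have hlen : ∀ x, (substTable vd vq l x g).length = vd ^ l := fun x => by simp [substTable]
    have hY : 1 ≤ Z ^ (l + 1) := Nat.one_le_pow _ _ hZ
    have h1 : S + vr * ((l + 1) * (S ^ 150 * Z ^ l) + S ^ 100 * Z ^ l + 1 + 1) + 1 +
        vr * (vr ^ l + 1) + 1 ≤ ((l + 1 : ℕ) + 1) * (S ^ 150 * Z ^ (l + 1)) := by
      have a1 : vr * Z ^ l ≤ Z ^ (l + 1) := by rw [pow_succ']; gcongr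
      have a2 : vr * vr ^ l ≤ Z ^ (l + 1) := by rw [pow_succ']; gcongr
      have a3 : vr ≤ Z ^ (l + 1) := (Nat.le_mul_of_pos_right _ hZl).trans a1
      have := Fact.mk hY
      have i1 := LePowMul.of_le hS.1 hY a1
      have i2 := LePowMul.of_le hS.1 hY a2
      have i3 := LePowMul.of_le hS.1 hY a3
      have h : S + (S ^ 100 * (vr * Z ^ l) + 2 * vr) + 1 + (vr * vr ^ l + vr) + 1 ≤
        S ^ 150 * Z ^ (l + 1) := LePowMul.le_of 150
      have h' := Nat.mul_le_mul_left ((l + 1) * S ^ 150) a1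
      calc _ = (l + 1) * S ^ 150 * (vr * Z ^ l) +
            (S + (S ^ 100 * (vr * Z ^ l) + 2 * vr) + 1 + (vr * vr ^ l + vr) + 1) := by ring
        _ ≤ (l + 1) * S ^ 150 * Z ^ (l + 1) + S ^ 150 * Z ^ (l + 1) := add_le_add h' h
        _ = _ := by ring
    refine Spec.mono (Spec.concat (Spec.tabulate hr fun x hx => hrc _ _ _ _ _
      ⟨hlen x, substTable_lt (by omega) g, rfl, rfl⟩ (Spec.substLast (X := Z ^ l) (hd.mono (by omega)) (hq.mono (by omega)) (.var' _)
        (.var' _) (.var' _) hds (hl.le.trans hms) hqs hq1 ((Nat.size_le_size hx.le).trans hrs)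
        (fun y hy => (Nat.size_le_size (hgs y hy).le).trans hqs) hZl
        (Nat.pow_le_pow_left hdZ l)))) ((Nat.le_of_eq ?_).trans h1)
    congr 2
    simp [Function.comp_def, length_gridTable _ _ _ _ (hlen _)]

end Polynomials

/-! ### Costs of the list of primes and of Chinese remaindering. -/

section Primes

variable {S : ℕ} [hS : Fact (2 ≤ S)]

/-- The primes at most `B` in increasing order. -/
def primeList (B : ℕ) : List ℕ := (List.range (B + 1)).filter Nat.Prime

theorem card_filter_dvd_eq_zero_iff {p : ℕ} (hp : 2 ≤ p) :
    ((Finset.range (p - 2)).filter fun i => p % (i + 2) < 1).card = 0 ↔ p.Prime := by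
  rw [Finset.card_eq_zero, Finset.filter_eq_empty_iff, Nat.prime_def_lt']
  constructor
  · refine fun h => ⟨hp, fun a h2 ha hd => h (x := a - 2) (by rw [Finset.mem_range]; omega) ?_⟩
    rw [Nat.sub_add_cancel h2, Nat.mod_eq_zero_of_dvd hd]
    exact one_pos
  · rintro ⟨-, h⟩ i hi hlt
    rw [Finset.mem_range] at hi
    exact h (i + 2) (by omega) (by omega) (Nat.dvd_of_mod_eq_zero (by omega))

theorem flatten_map_ite {α : Type} (l : List α) (p : α → Prop) [DecidablePred p] :
    (l.map fun a => if p a then [a] else []).flatten = l.filter p := by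
  induction l with
  | nil => rfl
  | cons a l ih =>
    by_cases h : p a <;> simp [h, ih]

theorem Spec.primesUpTo {B : Tm Ty.Val Proc .nat} {vB : ℕ} (hB : Spec B vB S) (hBs : vB ≤ S) :
    Spec (primesUpTo B) (primeList vB) (S ^ 60) := by
  have := LePow.of_le hS.1 hBs
  refine Spec.congr (Spec.concat (Spec.tabulate (τ := .arr .nat) (c' := S ^ 40)
    (g := fun p => if p.Prime then [p] else []) (hB.add (.lit 1)) fun p hp => ?_))
    (flatten_map_ite _ _) ?_
  · have hpS : p ≤ S + 1 := by omega
    have : LePow S p 2 := ⟨hS.1, hpS.trans (LePow.le_of 2)⟩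
    refine Spec.mono (Spec.ifLt (τ := .arr .nat) (c := S ^ 30) (.natVar p) (.lit 2) (fun h => ?_)
      fun h => ?_) ?_
    rotate_left 2
    · exact LePow.le_of 40
    · rw [if_neg fun hp => by have := hp.two_le; omega]
      exact Spec.nil.mono (LePow.le_of 30)
    · have hloop := Spec.iter (n := .var p - 2) (x := 0) (f := fun i c =>
        .ifLt (.var p % (i + 2)) 1 (c + 1) c) (c := S ^ 15)
        (fun j => ((Finset.range j).filter fun i => p % (i + 2) < 1).card)
        ((Spec.natVar p).sub (.lit 2)) (.lit 0) fun i hi => ?_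
      · refine Spec.mono (Spec.ifLt (c := S ^ 10) hloop (.lit 1) (fun h' => ?_) fun h' => ?_) ?_
        · rw [if_pos ((card_filter_dvd_eq_zero_iff h).1 (by omega))]
          exact (Spec.natVar p).single.mono (LePow.le_of 10)
        · rw [if_neg fun hp => by
            have := (card_filter_dvd_eq_zero_iff h).2 hp
            omega]
          exact Spec.nil.mono (LePow.le_of 10)
        · have : LePow S ((Finset.range (p - 2)).filter fun i => p % (i + 2) < 1).card 2 :=
            ⟨hS.1, ((Finset.card_filter_le _ _).trans (by simp)).trans (LePow.le_of 2 : p ≤ S ^ 2)⟩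
          exact LePow.le_of 30
      · have : LePow S i 2 := ⟨hS.1, (by omega : i ≤ p).trans (LePow.le_of 2)⟩
        have : LePow S ((Finset.range i).filter fun i => p % (i + 2) < 1).card 2 :=
          ⟨hS.1, ((Finset.card_filter_le _ _).trans (by simp)).trans (LePow.le_of 2 : i ≤ S ^ 2)⟩
        refine Spec.mono (Spec.ifLt (c := S ^ 10) ((Spec.natVar p).mod ((Spec.natVar i).add (.lit 2)))
          (.lit 1) (fun h' => ?_) fun h' => ?_) ?_
        rotate_left 2
        · exact LePow.le_of 15
        · rw [Finset.range_add_one, Finset.filter_insert, if_pos h',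
            Finset.card_insert_of_notMem (by simp)]
          exact Spec.mono ((Spec.var _).add (.lit 1)) (LePow.le_of 10)
        · rw [Finset.range_add_one, Finset.filter_insert, if_neg (by omega)]
          exact Spec.mono (.var _) (LePow.le_of 10)
  · have h1 : (((List.range (vB + 1)).map fun p => if p.Prime then [p] else []).map
        fun l => l.length + 1).sum ≤ (vB + 1) * 2 := by
      rw [List.map_map]
      refine Spec.sum_map_range_le fun i _ => ?_
      simp only [Function.comp]
      split_ifs <;> simp
    refine (Nat.add_le_add_right (Nat.add_le_add_left h1 _) _).trans (LePow.le_of 60)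

/-- The number `Q / n` times the inverse of `Q / n` modulo `n = p ^ m`. -/
def crtWeight (m Q p : ℕ) : ℕ := Q / p ^ m * ((Q / p ^ m) ^ (p ^ (m - 1) * (p - 1) - 1) % p ^ m)

theorem Spec.crtBasis {m Q : Tm Ty.Val Proc .nat} {p : Tm Ty.Val Proc (.arr .nat)} {vm vQ c : ℕ}
    {lp : List ℕ} (hc : c + 2 ≤ S) (hm : Spec m vm S) (hQ : Spec Q vQ S) (hp : Spec p lp c)
    (hms : vm ≤ S) (hm1 : 1 ≤ vm) (hQs : vQ.size ≤ S) (hlp : lp.length ≤ S)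
    (hps : ∀ x ∈ lp, x.size ≤ S) (hp2 : ∀ x ∈ lp, 2 ≤ x) :
    Spec (crtBasis m Q p) (lp.map (crtWeight vm vQ)) (S ^ 7000) := by
  have := LePow.of_le hS.1 hms
  have := LePow.of_le hS.1 hQs
  have := LePow.of_le hS.1 hlp
  have : LePow S c 1 := .of_le hS.1 (by omega)
  refine Spec.congr (Spec.tabulate (c' := S ^ 6800)
    (g := fun j => crtWeight vm vQ (lp.getD j 0)) hp.len fun j hj => ?_)
    (map_range_getD lp 0 (crtWeight vm vQ)) (LePow.le_of 7000)
  have hx := getD_mem 0 hj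
  have hget : Spec (.get p (.var j)) (lp.getD j 0) S := (hp.getNat (.natVar j)).mono (by omega)
  generalize lp.getD j 0 = x at hx hget
  have i1 := LePow.of_le hS.1 (hps x hx)
  have h2 := hp2 x hx
  have h1 : 1 ≤ x ^ (vm - 1) * (x - 1) := Nat.mul_pos (Nat.pow_pos (by omega)) (by omega)
  have h6 : S ≤ S ^ 6 := LePow.le_of 6
  have f6 : Fact (2 ≤ S ^ 6) := ⟨hS.1.trans h6⟩
  -- The exponent `φ(x ^ vm) - 1` is itself computed by a call of `pow` and costs up to `S ^ 130`;
  -- at that scale `Spec.powMod` gives `(S ^ 130) ^ 50 = S ^ 6500`, one of the largest exponents in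
  -- the file.
  have h130 : S ≤ S ^ 130 := LePow.le_of 130
  have f130 : Fact (2 ≤ S ^ 130) := ⟨hS.1.trans h130⟩
  have i2 : LePow S (x ^ vm).size 3 := ⟨hS.1, LePow.le_of 3⟩
  have hpow : ∀ (t : Tm Ty.Val Proc .nat) (k : ℕ), Spec t k (S ^ 6) → k ≤ S →
      Spec (MME.pow (.get p (.var j)) t) (x ^ k : ℕ) (S ^ 120) := fun t k ht hk =>
    (Spec.pow (hget.mono h6) ht ((hps x hx).trans h6) (hk.trans h6)).mono
      (by rw [← pow_mul])
  have hmod : Spec (MME.powMod (.var (vQ / x ^ vm : ℕ)) (MME.pow (.get p (.var j)) (m - 1) *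
      (.get p (.var j) - 1) - 1) (.var (x ^ vm : ℕ))) ((vQ / x ^ vm) ^
        (x ^ (vm - 1) * (x - 1) - 1) % x ^ vm : ℕ) (S ^ 6500) := by
    refine (Spec.powMod (S := S ^ 130) (Spec.var' _) ?_ (Spec.var' _) (LePow.le_of 130) ?_
      (LePow.le_of 130) ?_).mono (by rw [← pow_mul])
    · exact ((((hpow _ _ ((hm.sub (.lit 1)).mono (LePow.le_of 6)) (by omega)).mul
        (hget.sub (.lit 1)))).sub (.lit 1)).mono (LePow.le_of 130)
    · have : LePow S (vm - 1) 1 := .of_le hS.1 (by omega)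
      exact LePow.le_of 130
    · exact Nat.one_lt_pow (by omega) (by omega)
  have : NeZero (x ^ vm) := ⟨(Nat.pow_pos (by omega)).ne'⟩
  exact Spec.mono (Spec.letIn (v := (x ^ vm : ℕ)) (hpow m vm (hm.mono (LePow.le_of 6)) hms)
    (Spec.letIn (v := (vQ / x ^ vm : ℕ)) (hQ.div (.natVar _)) (Spec.mul (.natVar _)
      hmod))) (LePow.le_of 6800)

/-- Chinese remaindering. -/
theorem Spec.crt {Q : Tm Ty.Val Proc .nat} {basis : Tm Ty.Val Proc (.arr .nat)} {vQ : ℕ}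
    {lb : List ℕ} {val : Tm Ty.Val Proc .nat → Tm Ty.Val Proc .nat} {w : ℕ → ℕ}
    (hQ : Spec Q vQ S) (hb : Spec basis lb S)
    (hval : ∀ j < lb.length, Spec (val (.var j)) (w j) S) (hw : ∀ j < lb.length, (w j).size ≤ S)
    (hQs : vQ.size ≤ S) (hlb : lb.length ≤ S) (hbs : ∀ x ∈ lb, x.size ≤ S) :
    Spec (crt Q basis val) ((∑ j ∈ Finset.range lb.length, w j * lb.getD j 0) % vQ : ℕ)
      (S ^ 60) := by
  have := LePow.of_le hS.1 hQs
  have := LePow.of_le hS.1 hlb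
  have hsum : ∀ i ≤ lb.length, LePow S (∑ j ∈ Finset.range i, w j * lb.getD j 0).size 20 := by
    refine fun i hi => ⟨hS.1, (size_sum_le (c := S ^ 10) _ fun j hj => ?_).trans ?_⟩
    · have := LePow.of_le hS.1 (hw j ((Finset.mem_range.1 hj).trans_le hi))
      have := LePow.of_le hS.1 (size_getD_le hbs j)
      exact LePow.le_of 10
    · have := LePow.of_le hS.1 (hi.trans hlb)
      rw [Finset.card_range]
      exact LePow.le_of 20
  have := hsum _ le_rfl
  refine Spec.mono (Spec.mod (Spec.iter (c := S ^ 40)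
    (fun i => ∑ j ∈ Finset.range i, w j * lb.getD j 0) hb.len (.lit 0) fun i hi => ?_) hQ)
    (LePow.le_of 60)
  have := hsum i hi.le
  have := LePow.of_le hS.1 (hw i hi)
  have := LePow.of_le hS.1 (size_getD_le hbs i)
  rw [Finset.sum_range_succ]
  exact Spec.mono ((Spec.var _).add ((hval i hi).mul (hb.getNat (.natVar i)))) (LePow.le_of 40)

end Primes

/-! ### Values of polynomials given by coefficient tables -/

/-- The value at `a` of the polynomial in `l` variables, of individual degrees less than `d`, whose
coefficient at `x ^ e` is `g (∑ i, e i * d ^ i)`. -/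
def evalTable (d : ℕ) : ℕ → (ℕ → ℕ) → (ℕ → ℕ) → ℕ
  | 0, g, _ => g 0
  | l + 1, g, a => evalTable d l (fun u => ∑ c ∈ Finset.range d, g (u + d ^ l * c) * a l ^ c) a

/-- The exponents of individual degrees less than `d`. -/
abbrev expBox (d m : ℕ) : Finset (Fin m → ℕ) := Fintype.piFinset fun _ => Finset.range d

theorem sum_expBox_succ {M : Type*} [AddCommMonoid M] (d l : ℕ) (F : (Fin (l + 1) → ℕ) → M) :
    ∑ k ∈ expBox d (l + 1), F k =
      ∑ k ∈ expBox d l, ∑ c ∈ Finset.range d, F (Fin.snoc (α := fun _ => ℕ) k c) := by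
  rw [← Finset.sum_product']
  refine Finset.sum_bij' (fun k _ => (Fin.init k, k (Fin.last l)))
    (fun p _ => Fin.snoc (α := fun _ => ℕ) p.1 p.2) ?_ ?_ ?_ ?_ ?_
  · intro k hk
    simp only [Fintype.mem_piFinset, Finset.mem_product] at hk ⊢
    exact ⟨fun i => hk _, hk _⟩
  · intro p hp
    simp only [Fintype.mem_piFinset, Finset.mem_product] at hp ⊢
    intro i
    refine Fin.lastCases ?_ (fun i => ?_) i
    · simpa using hp.2
    · simpa using hp.1 i
  · intro k _; simp
  · intro p _; simp
  · intro k _; simp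

theorem evalTable_eq_sum (d m : ℕ) (g a : ℕ → ℕ) : evalTable d m g a =
    ∑ k ∈ expBox d m, g (∑ i, k i * d ^ (i : ℕ)) * ∏ i : Fin m, a i ^ k i := by
  induction m generalizing g with
  | zero => simp [evalTable, expBox]
  | succ l ih =>
    rw [evalTable, ih, sum_expBox_succ]
    refine Finset.sum_congr rfl fun k _ => ?_
    rw [Finset.sum_mul]
    refine Finset.sum_congr rfl fun c _ => ?_
    simp only [Fin.sum_univ_castSucc, Fin.prod_univ_castSucc, Fin.snoc_castSucc, Fin.snoc_last,
      Fin.val_castSucc, Fin.val_last]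
    rw [mul_comm c]
    ring

theorem code_lt {d m : ℕ} {k : Fin m → ℕ} (hk : k ∈ expBox d m) : ∑ i, k i * d ^ (i : ℕ) < d ^ m := by
  simp only [Fintype.mem_piFinset, Finset.mem_range] at hk
  exact (finFunctionFinEquiv fun i => (⟨k i, hk i⟩ : Fin d)).2

theorem digit_code {d m : ℕ} {k : Fin m → ℕ} (hk : k ∈ expBox d m) (j : Fin m) :
    (∑ i, k i * d ^ (i : ℕ)) / d ^ (j : ℕ) % d = k j := by
  simp only [Fintype.mem_piFinset, Finset.mem_range] at hk
  have := congrFun (finFunctionFinEquiv.symm_apply_apply fun i => (⟨k i, hk i⟩ : Fin d)) j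
  exact congrArg Fin.val this

theorem evalTable_modEq {d m q : ℕ} {g g' a a' : ℕ → ℕ} (hg : ∀ u < d ^ m, g u ≡ g' u [MOD q])
    (ha : ∀ i < m, a i ≡ a' i [MOD q]) : evalTable d m g a ≡ evalTable d m g' a' [MOD q] := by
  rw [evalTable_eq_sum, evalTable_eq_sum]
  refine Nat.ModEq.sum fun k hk => (hg _ (code_lt hk)).mul (Nat.ModEq.prod fun i _ => ?_)
  exact (ha i i.2).pow _

/-- There are `d ^ m` monomials, each contributing less than `r ^ m * (r ^ (d - 1)) ^ m` as `s ≤ m`.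
This is the origin of `M = d * r ^ d` and of the exponent `m` on the primes. -/
theorem evalTable_lt {d m r s : ℕ} {g a : ℕ → ℕ} (hd : 1 ≤ d) (hr : 1 ≤ r) (hs : s ≤ m)
    (hg : ∀ u < d ^ m, g u < r ^ s) (ha : ∀ i < m, a i < r) :
    evalTable d m g a < (d * r ^ d) ^ m := by
  have h1 : ∀ k ∈ expBox d m, g (∑ i, k i * d ^ (i : ℕ)) * ∏ i : Fin m, a i ^ k i <
      r ^ m * (r ^ (d - 1)) ^ m := by
    intro k hk
    have h2 : ∏ i : Fin m, a i ^ k i ≤ (r ^ (d - 1)) ^ m := by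
      refine (Finset.prod_le_pow_card _ _ (r ^ (d - 1)) fun i _ => ?_).trans (by simp)
      simp only [Fintype.mem_piFinset, Finset.mem_range] at hk
      exact (Nat.pow_le_pow_left (ha i i.2).le _).trans
        (Nat.pow_le_pow_right hr (by have := hk i; omega))
    have h3 := (hg _ (code_lt hk)).trans_le (Nat.pow_le_pow_right hr hs)
    have h4 : 0 < (r ^ (d - 1)) ^ m := Nat.pow_pos (Nat.pow_pos hr)
    exact (Nat.mul_le_mul_left _ h2).trans_lt (Nat.mul_lt_mul_of_pos_right h3 h4)
  rw [evalTable_eq_sum]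
  have h5 : (expBox d m).Nonempty := ⟨fun _ => 0, by simp [expBox]; omega⟩
  refine (Finset.sum_lt_sum_of_nonempty h5 h1).trans_le (le_of_eq ?_)
  obtain ⟨d, rfl⟩ : ∃ d', d = d' + 1 := ⟨d - 1, by omega⟩
  simp [expBox]
  rw [← mul_pow, ← mul_pow, pow_succ']

theorem getD_flatten_map_range {n L : ℕ} {F : ℕ → List ℕ} (hF : ∀ x, (F x).length = L) {x u : ℕ}
    (hx : x < n) (hu : u < L) : ((List.range n).map F).flatten.getD (u + x * L) 0 = (F x).getD u 0 := by
  induction n generalizing x with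
  | zero => omega
  | succ n ih =>
    have hlen : ((List.range n).map F).flatten.length = n * L := by
      simp [Function.comp_def, hF]
    rw [List.range_succ, List.map_append, List.flatten_append, List.getD_eq_getElem?_getD]
    rcases Nat.lt_succ_iff_lt_or_eq.1 hx with h | rfl
    · have : u + x * L < n * L := by
        have := Nat.mul_le_mul_right L (Nat.succ_le_of_lt h)
        rw [Nat.succ_mul] at this
        omega
      rw [List.getElem?_append_left (by omega), ← List.getD_eq_getElem?_getD, ih h]
    · rw [List.getElem?_append_right (by omega), hlen, Nat.add_sub_cancel]
      simp

/-- The last variable is substituted first, so its value selects a block of length `r ^ l` of the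
table; by induction the point `a` stands at the number with base `r` digits `a i`. -/
theorem getD_gridTable {d r q l : ℕ} (hq : 0 < q) {f : List ℕ} (hf : f.length = d ^ l)
    (hfq : ∀ x ∈ f, x < q) {a : ℕ → ℕ} (ha : ∀ i < l, a i < r) :
    (gridTable d r q l f).getD (∑ i ∈ Finset.range l, a i * r ^ i) 0 =
      evalTable d l (f.getD · 0) a % q := by
  induction l generalizing f with
  | zero =>
    simp only [gridTable, evalTable, Finset.range_zero, Finset.sum_empty]
    rw [Nat.mod_eq_of_lt (getD_lt hq hfq 0)]
  | succ l ih =>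
    rw [gridTable, Finset.sum_range_succ, getD_flatten_map_range (L := r ^ l)
      (fun x => length_gridTable _ _ _ _ (by simp [substTable])) (ha l (by omega)),
      ih (by simp [substTable]) (substTable_lt hq f) fun i hi => ha i (by omega)]
    · refine evalTable_modEq (fun u hu => ?_) fun i _ => Nat.ModEq.rfl
      dsimp only
      rw [substTable, getD_map_range _ _ _ hu]
      exact Nat.mod_modEq _ _
    · have := code_lt (d := r) (k := fun i : Fin l => a i)
        (by simpa [expBox] using fun i : Fin l => ha i (by omega))
      rwa [← Finset.sum_range (fun i => a i * r ^ i)] at this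

/-! ### Hasse derivatives and Taylor expansion -/

/-- The coefficients of the Hasse derivative with respect to `x ^ e`. -/
def hasseFun (d m : ℕ) (e : Fin m → ℕ) (g : ℕ → ℕ) (b : ℕ) : ℕ :=
  (∏ i : Fin m, if b / d ^ (i : ℕ) % d + e i < d then (b / d ^ (i : ℕ) % d + e i).choose (e i)
    else 0) * g (b + ∑ i, e i * d ^ (i : ℕ))

theorem add_pow_range {k D : ℕ} (hk : k < D) (x h : ℕ) :
    (x + h) ^ k = ∑ e ∈ Finset.range D, k.choose e * x ^ (k - e) * h ^ e := by
  rw [add_comm, add_pow]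
  rw [Finset.sum_subset (Finset.range_subset_range.2 (show k + 1 ≤ D from hk))]
  · exact Finset.sum_congr rfl fun e _ => by rw [Nat.cast_id]; ring
  · intro e _ he
    rw [Finset.mem_range] at he
    rw [Nat.choose_eq_zero_of_lt (by omega)]
    simp

/-- Substitute `k = b + e`. Summands on the left with an overflowing digit vanish by the guard,
those on the right with some `k i < e i` by the binomial coefficient, and the rest correspond
bijectively. -/
theorem evalTable_hasseFun (d m : ℕ) (e : Fin m → ℕ) (g x : ℕ → ℕ) :
    evalTable d m (hasseFun d m e g) x = ∑ k ∈ expBox d m, g (∑ i, k i * d ^ (i : ℕ)) *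
      ∏ i : Fin m, ((k i).choose (e i) * x i ^ (k i - e i)) := by
  rw [evalTable_eq_sum]
  have h1 : ∀ b ∈ expBox d m, hasseFun d m e g (∑ i, b i * d ^ (i : ℕ)) * ∏ i : Fin m, x i ^ b i =
      (∏ i : Fin m, if b i + e i < d then (b i + e i).choose (e i) else 0) *
        g (∑ i, (b i + e i) * d ^ (i : ℕ)) * ∏ i : Fin m, x i ^ b i := by
    intro b hb
    simp only [hasseFun, digit_code hb, add_mul, Finset.sum_add_distrib]
  rw [Finset.sum_congr rfl h1]
  rw [← Finset.sum_filter_of_ne (p := fun b => ∀ i, b i + e i < d),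
    ← Finset.sum_filter_of_ne (p := fun k => ∀ i, e i ≤ k i) (s := expBox d m)
      (f := fun k => g (∑ i, k i * d ^ (i : ℕ)) * _)]
  · refine Finset.sum_bij' (fun b _ i => b i + e i) (fun k _ i => k i - e i) ?_ ?_ ?_ ?_ ?_
    · intro b hb
      simp only [Finset.mem_filter, Fintype.mem_piFinset, Finset.mem_range] at hb ⊢
      exact ⟨hb.2, fun i => by omega⟩
    · intro k hk
      simp only [Finset.mem_filter, Fintype.mem_piFinset, Finset.mem_range] at hk ⊢
      exact ⟨fun i => by have := hk.1 i; omega, fun i => by have := hk.1 i; have := hk.2 i; omega⟩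
    · intro b _
      funext i
      exact Nat.add_sub_cancel _ _
    · intro k hk
      simp only [Finset.mem_filter] at hk
      funext i
      exact Nat.sub_add_cancel (hk.2 i)
    · intro b hb
      simp only [Finset.mem_filter] at hb
      rw [Finset.prod_mul_distrib, Finset.prod_congr rfl fun i _ => if_pos (hb.2 i)]
      simp only [Nat.add_sub_cancel]
      ring
  · intro k _ hne i
    by_contra h
    refine hne ?_
    rw [Finset.prod_eq_zero (Finset.mem_univ i), mul_zero]
    rw [Nat.choose_eq_zero_of_lt (by omega), zero_mul]
  · intro b _ hne i
    by_contra h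
    refine hne ?_
    rw [Finset.prod_eq_zero (Finset.mem_univ i) (if_neg h), zero_mul, zero_mul]

/-- The binomial theorem in each variable, multiplied out. Any box side `D ≥ d` is allowed, the
additional terms being zero, so that the box can be made to contain all exponents of order less than
`s`. -/
theorem evalTable_add {d m D : ℕ} (hD : d ≤ D) (g x h : ℕ → ℕ) :
    evalTable d m g (fun i => x i + h i) =
      ∑ e ∈ expBox D m, evalTable d m (hasseFun d m e g) x * ∏ i : Fin m, h i ^ e i := by
  simp only [evalTable_hasseFun, Finset.sum_mul]
  rw [Finset.sum_comm, evalTable_eq_sum]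
  refine Finset.sum_congr rfl fun k hk => ?_
  simp only [Fintype.mem_piFinset, Finset.mem_range] at hk
  simp only [mul_assoc, ← Finset.mul_sum]
  congr 1
  rw [Finset.prod_congr rfl fun i _ => add_pow_range ((hk i).trans_le hD) (x i) (h i),
    Finset.prod_univ_sum]
  exact Finset.sum_congr rfl fun e _ => by simp only [Finset.prod_mul_distrib]

theorem hasseCoeff_modEq {d q m : ℕ} (e : ℕ → ℕ) (b : ℕ) : hasseCoeff d q e b m ≡
    ∏ i : Fin m, (if b / d ^ (i : ℕ) % d + e i < d then (b / d ^ (i : ℕ) % d + e i).choose (e i)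
      else 0) [MOD q] := by
  induction m with
  | zero => simp [hasseCoeff, Nat.ModEq.refl]
  | succ m ih =>
    rw [hasseCoeff, Fin.prod_univ_castSucc]
    simp only [Fin.val_castSucc, Fin.val_last]
    split_ifs with h
    · exact (Nat.mod_modEq _ _).trans (ih.mul_right _)
    · rw [mul_zero]

theorem evalTable_hasseTable {d q m : ℕ} {e f : List ℕ} (he : e.length = m) (a : ℕ → ℕ) :
    evalTable d m ((hasseTable m d q e f).getD · 0) a ≡
      evalTable d m (hasseFun d m (fun i => e.getD i 0) (f.getD · 0)) a [MOD q] := by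
  refine evalTable_modEq (fun u hu => ?_) fun _ _ => Nat.ModEq.rfl
  rw [hasseTable, getD_map_range _ _ _ hu, hasseFun, he, Finset.sum_range]
  exact (Nat.mod_modEq _ _).trans ((hasseCoeff_modEq _ u).mul_right _)

theorem sum_expList_eq {M : Type*} [AddCommMonoid M] {m s : ℕ} (hs : 1 ≤ s) (ψ : (Fin m → ℕ) → M) :
    ∑ j ∈ Finset.range (expList s m).length, ψ (fun i => ((expList s m).getD j []).getD i 0) =
      ∑ e ∈ (expBox s m).filter (fun e => ∑ i, e i < s), ψ e := by
  refine Finset.sum_bij (fun j _ i => ((expList s m).getD j []).getD i 0) ?_ ?_ ?_ ?_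
  · intro j hj
    obtain ⟨h1, h2⟩ := (mem_expList hs).1 (getD_mem [] (Finset.mem_range.1 hj))
    have h3 : ∑ i : Fin m, ((expList s m).getD j []).getD i 0 < s := by
      rw [← sum_range_getD, h1] at h2
      rwa [← Finset.sum_range (fun i => ((expList s m).getD j []).getD i 0)]
    simp only [Finset.mem_filter, Fintype.mem_piFinset, Finset.mem_range]
    refine ⟨fun i => lt_of_le_of_lt ?_ h3, h3⟩
    exact Finset.single_le_sum (f := fun i : Fin m => ((expList s m).getD j []).getD i 0)
      (fun _ _ => Nat.zero_le _) (Finset.mem_univ i)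
  · intro j hj j' hj' h
    rw [Finset.mem_range] at hj hj'
    have h1 := ((mem_expList hs).1 (getD_mem [] hj)).1
    have h1' := ((mem_expList hs).1 (getD_mem [] hj')).1
    have h2 : (expList s m).getD j [] = (expList s m).getD j' [] := by
      refine List.ext_getElem (by omega) fun i hi hi' => ?_
      have := congrFun h ⟨i, by omega⟩
      rwa [List.getD_eq_getElem _ _ hi, List.getD_eq_getElem _ _ hi'] at this
    rw [List.getD_eq_getElem _ _ hj, List.getD_eq_getElem _ _ hj'] at h2
    exact (nodup_expList s m).getElem_inj_iff.1 h2
  · intro e he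
    simp only [Finset.mem_filter] at he
    have : List.ofFn e ∈ expList s m := (mem_expList hs).2 ⟨by simp, by simpa [List.sum_ofFn] using he.2⟩
    obtain ⟨j, hj, h⟩ := List.getElem_of_mem this
    refine ⟨j, Finset.mem_range.2 hj, ?_⟩
    funext i
    rw [List.getD_eq_getElem _ _ hj, h]
    simp
  · intro j _; rfl

/-- Taylor expansion modulo `r ^ s` around a point that is congruent modulo `r`. -/
theorem evalTable_taylor {d m r s : ℕ} (hs : 1 ≤ s) {f : List ℕ} {a b : ℕ → ℕ}
    (hb : ∀ i < m, b i ≤ a i) (hr : ∀ i < m, r ∣ a i - b i) {w : ℕ → ℕ}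
    (hw : ∀ j < (expList s m).length, w j ≡ evalTable d m
      ((hasseTable m d (r ^ s) ((expList s m).getD j []) f).getD · 0) b [MOD r ^ s]) :
    ∑ j ∈ Finset.range (expList s m).length, w j *
      ∏ i ∈ Finset.range ((expList s m).getD j []).length,
        (a i - b i) ^ ((expList s m).getD j []).getD i 0 ≡
    evalTable d m (f.getD · 0) a [MOD r ^ s] := by
  have h1 : evalTable d m (f.getD · 0) a ≡
      evalTable d m (f.getD · 0) (fun i => b i + (a i - b i)) [MOD r ^ s] :=
    evalTable_modEq (fun _ _ => Nat.ModEq.rfl) fun i hi => by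
      rw [Nat.add_sub_cancel' (hb i hi)]
  refine Nat.ModEq.trans ?_ h1.symm
  rw [evalTable_add (show d ≤ d + s by omega)]
  have h2 : ∑ e ∈ expBox (d + s) m, evalTable d m (hasseFun d m e (f.getD · 0)) b *
      ∏ i : Fin m, (a i - b i) ^ e i ≡ ∑ e ∈ (expBox s m).filter (fun e => ∑ i, e i < s),
      evalTable d m (hasseFun d m e (f.getD · 0)) b * ∏ i : Fin m, (a i - b i) ^ e i [MOD r ^ s] := by
    rw [← Finset.sum_filter_add_sum_filter_not _ (fun e : Fin m → ℕ => ∑ i, e i < s)]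
    have h3 : (expBox (d + s) m).filter (fun e => ∑ i, e i < s) =
        (expBox s m).filter (fun e => ∑ i, e i < s) := by
      ext e
      simp only [Finset.mem_filter, Fintype.mem_piFinset, Finset.mem_range]
      refine ⟨fun h => ⟨fun i => lt_of_le_of_lt ?_ h.2, h.2⟩, fun h => ⟨fun i => by
        have := h.1 i; omega, h.2⟩⟩
      exact Finset.single_le_sum (f := e) (fun _ _ => Nat.zero_le _) (Finset.mem_univ i)
    rw [h3]
    -- For `|e| ≥ s` the monomial in `a - b` is divisible by `r ^ |e|`, hence by `r ^ s`.
    have h4 : ∑ e ∈ (expBox (d + s) m).filter (fun e => ¬ ∑ i, e i < s),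
        evalTable d m (hasseFun d m e (f.getD · 0)) b * ∏ i : Fin m, (a i - b i) ^ e i ≡ 0 [MOD r ^ s] := by
      rw [Nat.modEq_zero_iff_dvd]
      refine Finset.dvd_sum fun e he => Dvd.dvd.mul_left ?_ _
      have h5 : ∏ i, r ^ e i ∣ ∏ i : Fin m, (a i - b i) ^ e i :=
        Finset.prod_dvd_prod_of_dvd _ _ fun i _ => pow_dvd_pow_of_dvd (hr i i.2) _
      rw [Finset.prod_pow_eq_pow_sum] at h5
      exact (pow_dvd_pow r (not_lt.1 (Finset.mem_filter.1 he).2)).trans h5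
    exact (Nat.ModEq.add_left _ h4).trans (by rw [add_zero])
  refine Nat.ModEq.trans ?_ h2.symm
  rw [← sum_expList_eq hs (fun e => evalTable d m (hasseFun d m e (f.getD · 0)) b *
    ∏ i : Fin m, (a i - b i) ^ e i)]
  refine Nat.ModEq.sum fun j hj => ?_
  rw [Finset.mem_range] at hj
  have h6 := ((mem_expList hs).1 (getD_mem [] hj)).1
  refine ((hw j hj).trans (evalTable_hasseTable h6 b)).mul ?_
  rw [Finset.prod_range, h6]

/-! ### Instances and MME-Product-Set. -/

section

/-- `f` is the coefficient table of a polynomial over `ℤ / r ^ s` in `m` variables, of individual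
degrees less than `d`, and `pts` is a list of points. -/
structure IsInst (m d r s : ℕ) (f : List ℕ) (pts : List (List ℕ)) : Prop where
  length_table : f.length = d ^ m
  table_lt : ∀ x ∈ f, x < r ^ s
  length_point : ∀ a ∈ pts, a.length = m
  point_lt : ∀ a ∈ pts, ∀ x ∈ a, x < r ^ s

/-- The values modulo `q` at the points. -/
def evalList (m d q : ℕ) (f : List ℕ) (pts : List (List ℕ)) : List ℕ :=
  pts.map fun a => evalTable d m (f.getD · 0) (a.getD · 0) % q

theorem length_hasseTable (m d q : ℕ) (e f : List ℕ) : (hasseTable m d q e f).length = d ^ m := by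
  simp [hasseTable]

theorem hasseTable_lt {m d q : ℕ} (hq : 0 < q) (e f : List ℕ) : ∀ x ∈ hasseTable m d q e f, x < q := by
  intro y hy
  obtain ⟨u, _, rfl⟩ := List.mem_map.1 hy
  exact Nat.mod_lt _ hq

theorem getD_map_mod (a : List ℕ) (r i : ℕ) : (a.map (· % r)).getD i 0 = a.getD i 0 % r := by
  by_cases hi : i < a.length
  · rw [List.getD_eq_getElem _ _ (by simpa), List.getD_eq_getElem _ _ hi]; simp
  · rw [List.getD_eq_default _ _ (by simpa using hi), List.getD_eq_default _ _ (by omega)]; simp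

theorem getD_map {α β : Type} (l : List α) (F : α → β) (x : α) (y : β) {i : ℕ} (hi : i < l.length) :
    (l.map F).getD i y = F (l.getD i x) := by
  rw [List.getD_eq_getElem _ _ (by simpa), List.getD_eq_getElem _ _ hi]; simp

/-- Step (3) of the algorithm yields the value. -/
theorem taylor_eq {m d r s q : ℕ} {E : List (List ℕ)} (hs : 1 ≤ s) (hq : q = r ^ s)
    (hE : E = expList s m) {f a : List ℕ} {w : ℕ → ℕ}
    (hw : ∀ j < E.length, w j ≡ evalTable d m
      ((hasseTable m d (q) (E.getD j []) f).getD · 0)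
      ((a.map (· % r)).getD · 0) [MOD q]) :
    (∑ j ∈ Finset.range E.length, w j *
      ∏ i ∈ Finset.range (E.getD j []).length,
        (a.getD i 0 - (a.map (· % r)).getD i 0) ^ (E.getD j []).getD i 0) % q =
    evalTable d m (f.getD · 0) (a.getD · 0) % q := by
  subst hq hE
  refine evalTable_taylor hs (a := (a.getD · 0)) (b := ((a.map (· % r)).getD · 0))
    (fun i _ => ?_) (fun i _ => ?_) hw
  · rw [getD_map_mod]
    exact Nat.mod_le _ _
  · rw [getD_map_mod]
    exact Nat.dvd_sub_mod _

variable {S : ℕ} [hS : Fact (2 ≤ S)]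

-- For each exponent there is one Hasse table of length `d ^ m` and one grid computation of cost
-- about `Z ^ m`; for each point there is one Taylor sum over all exponents. This gives the product
-- of the number of exponents with `Z ^ m + pts.length`.
set_option maxHeartbeats 1000000 in
theorem Spec.productSet {m d r s Z : ℕ} {f : List ℕ} {pts : List (List ℕ)}
    (hI : IsInst m d r s f pts) (h16 : 16 ≤ S) (hm : m ≤ S) (hd : d ≤ S) (hr2 : 2 ≤ r)
    (hs : 1 ≤ s) (hsm : s ≤ m) (hd1 : 1 ≤ d) (hq : (r ^ s).size ≤ S) (hdZ : d ≤ Z) (hrZ : r ≤ Z) :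
    Spec (productSet (.var m) (.var d) (.var ((f, pts, r, s) :
      List ℕ × List (List ℕ) × ℕ × ℕ) : Tm Ty.Val Proc Inst)) (evalList m d (r ^ s) f pts)
      (S ^ 300 * ((expList s m).length * (Z ^ m + pts.length))) := by
  obtain ⟨q, hqdef⟩ : ∃ q, q = r ^ s := ⟨_, rfl⟩
  obtain ⟨E, hE⟩ : ∃ E, E = expList s m := ⟨_, rfl⟩
  obtain ⟨W, hW⟩ : ∃ W, W = Z ^ m + pts.length := ⟨_, rfl⟩
  rw [← hqdef] at hq
  have hpt := hI.point_lt
  have htab := hI.table_lt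
  rw [← hqdef] at hpt htab
  rw [← hqdef, ← hE, ← hW]
  have hrq : r ≤ q := hqdef ▸ Nat.le_self_pow (by omega) r
  have hrs : r.size ≤ S := (Nat.size_le_size hrq).trans hq
  have hq1 : 1 < q := by omega
  have hZ1 : 1 ≤ Z ^ m := Nat.one_le_pow _ _ (by omega)
  have hE1 : 1 ≤ E.length := by
    have := length_expList_mono hs (Nat.zero_le m)
    simpa [hE, expList] using this
  have hW1 : 1 ≤ W := by omega
  have hEW : 1 ≤ E.length * W := Nat.mul_pos hE1 hW1
  have fE := Fact.mk hE1
  have fW := Fact.mk hW1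
  have fEW := Fact.mk hEW
  have i1 : LePowMul S W (Z ^ m) 0 := .of_le hS.1 hW1 (by omega)
  have i2 : LePowMul S W pts.length 0 := .of_le hS.1 hW1 (by omega)
  have i3 : LePowMul S (E.length * W) E.length 0 := .of_le hS.1 hEW (Nat.le_mul_of_pos_right _ hW1)
  have i4 : LePowMul S (E.length * W) pts.length 0 :=
    .of_le hS.1 hEW ((by omega : _ ≤ W).trans (Nat.le_mul_of_pos_left _ hE1))
  have h5 : 1 + 1 + pts.length * (S ^ 250 * E.length + 1) + 1 ≤ S ^ 270 * (E.length * W) := by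
    rw [mul_comm pts.length]
    generalize E.length = L at *
    generalize pts.length = N at *
    exact LePowMul.le_of 270
  have hEl : ∀ e ∈ E, e.length ≤ S := fun e he => by
    have := ((mem_expList hs).1 (hE ▸ he)).1; omega
  have hEx : ∀ e ∈ E, ∀ x ∈ e, x ≤ S := fun e he x hx => by
    have := ((mem_expList hs).1 (hE ▸ he)).2
    have := List.single_le_sum (fun _ _ => Nat.zero_le _) x hx
    omega
  have hsz : ∀ x, x < q → x.size ≤ S := fun x hx => (Nat.size_le_size hx.le).trans hq
  have hlt := hasseTable_lt (m := m) (d := d) (by omega : 0 < q)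
  refine Spec.mono (Spec.letIn (v := f) (Spec.var _).fst (Spec.letIn (σ := .arr (.arr .nat))
    (v := pts) (Spec.var _).snd.fst
    (Spec.letIn (v := r) (Spec.var _).snd.snd.fst (Spec.letIn (v := s) (Spec.var _).snd.snd.snd
    (Spec.letIn (v := q) ((Spec.pow (.var' _) (.var' _) hrs (hsm.trans hm)).congr hqdef.symm le_rfl)
    (Spec.letIn (σ := .arr (.arr .nat)) (v := E)
      ((Spec.exponents (X := E.length) (.var' _) (.var' _) hm (hsm.trans hm) hs
        (hE ▸ le_rfl)).congr hE.symm le_rfl)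
    (Spec.letIn (σ := .arr (.arr .nat))
      (v := (List.range E.length).map fun j => hasseTable m d q (E.getD j []) f)
      (Spec.tabulate (arrArrVar E).len fun j hj => Spec.hasse (c := 3) (by omega) (.var' _) (.var' _)
        (.var' _) ((arrArrVar E).getArr (.natVar j)) (.var' _) hm hd hq hq1 (hEl _ (getD_mem _ hj))
        (hEx _ (getD_mem _ hj)) (fun x hx => hsz _ (htab x hx)) hZ1
        (Nat.pow_le_pow_left hdZ m))
    (Spec.letIn (σ := .arr (.arr .nat))
      (v := (List.range E.length).map fun j => gridTable d r q m (hasseTable m d q (E.getD j []) f))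
      (Spec.tabulate (arrArrVar E).len fun j hj => Spec.evalGrid (.var' _) (.var _) (.var' _)
        (.var _) ((((arrArrVar _).getArr (.natVar j)).congr (getD_map_range _ _ _ hj)
          le_rfl).mono (by omega)) hm hd hrs hq hq1 (length_hasseTable _ _ _ _ _) (hlt _ _)
          hdZ hrZ (by omega))
    (Spec.letIn (σ := .arr (.arr .nat)) (v := pts.map fun a => a.map (· % r))
      (Spec.congr (Spec.tabulate (g := fun i => (pts.getD i []).map (· % r)) (arrArrVar pts).len
        fun i hi => Spec.reduce (X := S)
          (((arrArrVar pts).getArr (.natVar i)).mono (by omega)) (.var' _) hrs ?_ ?_ ?_)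
        (map_range_getD pts [] fun a => a.map (· % r)) le_rfl)
    (Spec.congr (c' := S ^ 270 * (E.length * W)) (Spec.tabulate (c' := S ^ 250 * E.length)
      (g := fun i => evalTable d m (f.getD · 0)
      ((pts.getD i []).getD · 0) % q) (arrArrVar pts).len fun i hi => ?_)
      (map_range_getD pts [] fun a => evalTable d m (f.getD · 0) (a.getD · 0) % q) h5))))))))))
      ?_
  · exact fun x hx => hsz _ (hpt _ (getD_mem _ hi) x hx)
  · omega
  · exact (hI.length_point _ (getD_mem _ hi)).le.trans hm
  · set a := pts.getD i [] with ha
    have hal : a.length = m := hI.length_point _ (getD_mem _ hi)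
    have hax : ∀ x ∈ a, x < q := hpt _ (getD_mem _ hi)
    have hbx : ∀ x ∈ a.map (· % r), x < r := fun x hx => by
      obtain ⟨y, _, rfl⟩ := List.mem_map.1 hx
      exact Nat.mod_lt _ (by omega)
    have hred : Spec (.get (.var (pts.map fun a => a.map (· % r)) :
        Tm Ty.Val Proc (.arr (.arr .nat))) (.var i)) (a.map (· % r)) 3 :=
      ((arrArrVar _).getArr (.natVar i)).congr (getD_map _ _ _ _ hi) le_rfl
    set pos := ∑ i ∈ Finset.range (a.map (· % r)).length, (a.map (· % r)).getD i 0 * r ^ i with hpos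
    have hval : ∀ j < E.length, (gridTable d r q m (hasseTable m d q (E.getD j []) f)).getD pos 0 =
        evalTable d m ((hasseTable m d q (E.getD j []) f).getD · 0) ((a.map (· % r)).getD · 0) % q := by
      intro j hj
      rw [hpos, List.length_map, hal]
      exact getD_gridTable (by omega) (length_hasseTable _ _ _ _ _) (hlt _ _) fun i _ =>
        getD_lt (by omega) hbx i
    refine Spec.mono (Spec.letIn (v := pos) (Spec.code (.var' _) (hred.mono (by omega)) hrs
      (by simpa [hal]) fun x hx => hsz _ ((hbx x hx).trans_le hrq))
      (Spec.congr (Spec.taylor (c := 1) (w := fun j => evalTable d m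
        ((hasseTable m d q (E.getD j []) f).getD · 0) ((a.map (· % r)).getD · 0) % q)
        (by omega) (.var' _) (arrArrVar E) (((arrArrVar pts).getArr (.natVar i)).mono (by omega))
        (hred.mono (by omega)) (fun j hj => ?_) (fun j hj => hsz _ (Nat.mod_lt _ (by omega))) hq hq1
        (fun x hx => hsz _ (hax x hx)) (fun x hx => hsz _ ((hbx x hx).trans_le hrq)) hEl hEx hE1
        le_rfl) (taylor_eq hs hqdef hE fun j hj => Nat.mod_modEq _ _) le_rfl)) (LePowMul.le_of 250)
    exact ((((arrArrVar _).getArr (.natVar j)).congr (getD_map_range _ _ _ hj) le_rfl).getNat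
      (.natVar pos)).congr (hval j hj) (by omega)
  · generalize E.length = L at *
    generalize pts.length = N at *
    generalize Z ^ m = A at *
    exact LePowMul.le_of 300

end

/-! ### Chinese remaindering and the primes up to a bound -/

/-- Euler's theorem: since `φ(p ^ m) = p ^ (m - 1) * (p - 1)`, the power with exponent `φ(p ^ m) -
1` is the inverse. -/
theorem crtWeight_modEq_one {m Q p : ℕ} (hp : p.Prime) (hm : 1 ≤ m) (hQ : (Q / p ^ m).Coprime p) :
    crtWeight m Q p ≡ 1 [MOD p ^ m] := by
  have h1 : 1 ≤ p ^ (m - 1) * (p - 1) :=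
    Nat.mul_pos (Nat.pow_pos hp.pos) (Nat.sub_pos_of_lt hp.one_lt)
  have h2 := Nat.ModEq.pow_totient (hQ.pow_right m)
  rw [Nat.totient_prime_pow hp hm] at h2
  refine (Nat.ModEq.mul_left _ (Nat.mod_modEq _ _)).trans ?_
  rwa [← pow_succ', Nat.sub_add_cancel h1]

theorem crtWeight_lt {m Q p : ℕ} (hp : 0 < p) (hQ : 0 < Q) (hd : p ^ m ∣ Q) :
    crtWeight m Q p < Q := by
  have h1 : 0 < p ^ m := Nat.pow_pos hp
  calc crtWeight m Q p < Q / p ^ m * p ^ m := Nat.mul_lt_mul_of_pos_left (Nat.mod_lt _ h1)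
        (Nat.div_pos (Nat.le_of_dvd hQ hd) h1)
    _ = Q := Nat.div_mul_cancel hd

/-- The weight of a prime is 1 modulo its own `p ^ m` and 0 modulo the others, which divide `Q / p ^
m`. So the sum is congruent to `y` modulo every `p ^ m`, hence modulo `Q`, and `y < Q`. -/
theorem crtWeight_eq {m : ℕ} {lp : List ℕ} (hp : ∀ p ∈ lp, p.Prime) (hn : lp.Nodup) (hm : 1 ≤ m)
    {w : ℕ → ℕ} {y : ℕ} (hy : y < (lp.map (· ^ m)).prod)
    (hw : ∀ j < lp.length, w j ≡ y [MOD lp.getD j 0 ^ m]) :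
    (∑ j ∈ Finset.range lp.length,
      w j * (lp.map (crtWeight m (lp.map (· ^ m)).prod)).getD j 0) % (lp.map (· ^ m)).prod = y := by
  set Q := (lp.map (· ^ m)).prod with hQ
  have hco : lp.Pairwise (Function.onFun Nat.Coprime (· ^ m)) :=
    hn.pairwise_of_forall_ne fun a ha b hb hab =>
      ((Nat.coprime_primes (hp a ha) (hp b hb)).2 hab).pow m m
  have hQe : ∀ p ∈ lp, Q = p ^ m * ((lp.erase p).map (· ^ m)).prod := fun p h => by
    rw [hQ, (List.perm_cons_erase h).map _ |>.prod_eq, List.map_cons, List.prod_cons]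
  have hdiv : ∀ p ∈ lp, Q / p ^ m = ((lp.erase p).map (· ^ m)).prod := fun p h => by
    rw [hQe p h, Nat.mul_div_cancel_left _ (Nat.pow_pos (hp p h).pos)]
  have key : (∑ j ∈ Finset.range lp.length, w j * (lp.map (crtWeight m Q)).getD j 0) ≡ y
      [MOD Q] := by
    rw [hQ, Nat.modEq_list_map_prod_iff hco]
    intro p hpl
    obtain ⟨i, hi, rfl⟩ := List.mem_iff_getElem.1 hpl
    rw [← Finset.add_sum_erase _ _ (Finset.mem_range.2 hi)]
    have hget : ∀ j, j < lp.length → (lp.map (crtWeight m Q)).getD j 0 = crtWeight m Q (lp.getD j 0) :=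
      fun j hj => getD_map _ _ _ _ hj
    have hi' : lp.getD i 0 = lp[i] := List.getD_eq_getElem _ _ hi
    have h1 : w i * (lp.map (crtWeight m Q)).getD i 0 ≡ y * 1 [MOD lp[i] ^ m] := by
      rw [hget i hi]
      have := hw i hi
      rw [hi'] at this ⊢
      refine this.mul (crtWeight_modEq_one (hp _ hpl) hm ?_)
      rw [hdiv _ hpl]
      refine Nat.coprime_list_prod_left_iff.2 fun x hx => ?_
      obtain ⟨z, hz, rfl⟩ := List.mem_map.1 hx
      obtain ⟨hne, hz⟩ := (List.Nodup.mem_erase_iff hn).1 hz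
      exact ((Nat.coprime_primes (hp z hz) (hp _ hpl)).2 hne).pow_left m
    have h2 : ∑ j ∈ (Finset.range lp.length).erase i, w j * (lp.map (crtWeight m Q)).getD j 0 ≡ 0
        [MOD lp[i] ^ m] := by
      refine (Nat.modEq_zero_iff_dvd).2 (Finset.dvd_sum fun j hj => Dvd.dvd.mul_left ?_ _)
      rw [Finset.mem_erase, Finset.mem_range] at hj
      rw [hget j hj.2, List.getD_eq_getElem _ _ hj.2]
      refine Dvd.dvd.mul_right ?_ _
      rw [hdiv _ (List.getElem_mem _)]
      refine List.dvd_prod (List.mem_map_of_mem (f := (· ^ m)) ?_)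
      exact (List.Nodup.mem_erase_iff hn).2 ⟨fun h => hj.1 (((List.Nodup.getElem_inj_iff hn).1 h).symm), hpl⟩
    simpa using h1.add h2
  exact Nat.mod_eq_of_modEq key hy

theorem prime_of_mem_primeList {B p : ℕ} (h : p ∈ primeList B) : p.Prime := by
  simpa using (List.mem_filter.1 h).2

theorem le_of_mem_primeList {B p : ℕ} (h : p ∈ primeList B) : p ≤ B := by
  have := List.mem_range.1 (List.mem_filter.1 h).1
  omega

theorem nodup_primeList (B : ℕ) : (primeList B).Nodup := List.nodup_range.filter _

theorem length_primeList_le (B : ℕ) : (primeList B).length ≤ B + 1 := by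
  simpa [primeList] using List.length_filter_le (fun p => decide p.Prime) (List.range (B + 1))

theorem prod_primeList (B : ℕ) : (primeList B).prod = primorial B := by
  have : (primeList B).toFinset = (Finset.range (B + 1)).filter Nat.Prime := by
    ext p
    simp [primeList]
  rw [primorial, ← this, List.prod_toFinset _ (nodup_primeList B), List.map_id']

/-- Monotonicity of the primorial lets one explicit value at `k` serve all `n` from `k` to below `16
* b`. -/
theorem two_pow_succ_le_primorial_pow_of_le {k b n : ℕ} (hk : 2 ^ b ≤ primorial k) (hkn : k ≤ n)
    (hn : n < 16 * b) : 2 ^ (n + 1) ≤ primorial n ^ 16 :=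
  calc 2 ^ (n + 1) ≤ 2 ^ (b * 16) := Nat.pow_le_pow_right (by norm_num) (by omega)
    _ = (2 ^ b) ^ 16 := pow_mul _ _ _
    _ ≤ primorial n ^ 16 := Nat.pow_le_pow_left (hk.trans (primorial_mono hkn)) 16

-- In logarithms the claim is `(n + 1) log 2 ≤ 16 θ(n)`. Chebyshev's bound gives `θ(n)` as at least
-- `n log 2` minus terms of order `√n log n`; with `y = √n` and a linear bound for `log y` this
-- becomes a quadratic inequality in `y`.
open Real in
theorem two_pow_succ_le_primorial_pow_of_ge {n : ℕ} (hn : 512 ≤ n) :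
    2 ^ (n + 1) ≤ primorial n ^ 16 := by
  have h0 : (512 : ℝ) ≤ n := by exact_mod_cast hn
  set y := √(n : ℝ) with hy
  have hyn : y * y = n := mul_self_sqrt (by linarith)
  have hy1 : (22.6 : ℝ) ≤ y := le_sqrt_of_sq_le (by norm_num; linarith)
  have hlogn : log n = 2 * log y := by
    rw [← hyn, log_mul (by linarith) (by linarith)]; ring
  -- The tangent of the logarithm at 32, a power of two, so that its only constant is `log 2`.
  have hlogy : log y ≤ y / 32 + 5 * log 2 - 1 := by
    have h1 := log_le_sub_one_of_pos (x := y / 32) (by linarith)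
    rw [log_div (by linarith) (by norm_num), show (32 : ℝ) = 2 ^ 5 by norm_num, log_pow] at h1
    push_cast at h1
    linarith
  have hlog1 : log ((n : ℝ) + 1) ≤ log n + log 2 := by
    rw [← log_mul (by linarith) (by norm_num)]
    exact log_le_log (by linarith) (by linarith)
  have h2 := log_two_gt_d9
  have h3 := log_two_lt_d9
  have hth := Chebyshev.theta_ge n
  rw [Chebyshev.theta_eq_log_primorial, Nat.floor_natCast] at hth
  have hpos : (0 : ℝ) < primorial n := by exact_mod_cast primorial_pos n
  have key : ((n : ℝ) + 1) * log 2 ≤ 16 * log (primorial n) := by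
    have h4 : log y * y ≤ (y / 32 + 5 * 0.6931471808 - 1) * y :=
      mul_le_mul_of_nonneg_right (by linarith) (by linarith)
    have h5 : log (primorial n) ≥ (y * y) * log 2 - (2 * log y + log 2) - 4 * (log y * y) := by
      rw [hyn]
      have : 2 * y * log n = 4 * (log y * y) := by rw [hlogn]; ring
      linarith
    have h6 : y * y * 0.6931471803 ≤ y * y * log 2 :=
      mul_le_mul_of_nonneg_left h2.le (by positivity)
    nlinarith
  have h7 : (2 : ℝ) ^ (n + 1) ≤ (primorial n : ℝ) ^ 16 := by
    rw [← log_le_log_iff (by positivity) (by positivity), log_pow, log_pow]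
    push_cast
    exact key
  exact_mod_cast h7

theorem two_pow_succ_le_primorial_pow {n : ℕ} (hn : 16 ≤ n) : 2 ^ (n + 1) ≤ primorial n ^ 16 := by
  rcases lt_or_ge n 224 with h | h
  -- `primorial 13 = 30030 ≥ 2 ^ 14`, and `16 * 14 = 224`.
  · refine two_pow_succ_le_primorial_pow_of_le (k := 13) (b := 14) ?_ (by omega) (by omega)
    norm_num [primorial, Finset.prod_filter, Finset.prod_range_succ]
  · rcases lt_or_ge n 592 with h' | h'
    -- `primorial 31 = 200560490130 ≥ 2 ^ 37`, and `16 * 37 = 592`.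
    · refine two_pow_succ_le_primorial_pow_of_le (k := 31) (b := 37) ?_ (by omega) (by omega)
      norm_num [primorial, Finset.prod_filter, Finset.prod_range_succ]
    · exact two_pow_succ_le_primorial_pow_of_ge (by omega)

/-- For `n = ⌊16 log M⌋` one has `M ^ 16 < 2 ^ (n + 1) ≤ primorial n ^ 16`; take 16th roots. The
assumption `M ≥ 2` gives `n ≥ 16`. -/
theorem le_primorial_size_pow {M : ℕ} (hM : 2 ≤ M) : M ≤ primorial ((M ^ 16).size - 1) := by
  have h1 : 16 < (M ^ 16).size := Nat.lt_size.2 (Nat.pow_le_pow_left hM 16)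
  have h2 := two_pow_succ_le_primorial_pow (n := (M ^ 16).size - 1) (by omega)
  rw [Nat.sub_add_cancel (by omega)] at h2
  exact (Nat.pow_le_pow_iff_left (by norm_num)).1 ((Nat.lt_size_self _).le.trans h2)

/-! ### One level of MME-B at positive depth. -/

section

/-- The primes used at positive depth. -/
def stepPrimes (d r : ℕ) : List ℕ := primeList (((d * r ^ d) ^ 16).size - 1)

theorem evalTable_lt_prod_stepPrimes {d m r s : ℕ} {g a : ℕ → ℕ} (hd : 1 ≤ d) (hr : 2 ≤ r)
    (hs : s ≤ m) (hg : ∀ u < d ^ m, g u < r ^ s) (ha : ∀ i < m, a i < r) :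
    evalTable d m g a < ((stepPrimes d r).map (· ^ m)).prod := by
  have h2 : 2 ≤ d * r ^ d := by
    calc 2 ≤ r ^ d := hr.trans (Nat.le_self_pow (by omega) r)
      _ ≤ d * r ^ d := Nat.le_mul_of_pos_left _ hd
  refine (evalTable_lt hd (by omega) hs hg ha).trans_le ?_
  rw [show ((stepPrimes d r).map (· ^ m)).prod = _ from List.prod_hom _ (powMonoidHom m),
    powMonoidHom_apply, stepPrimes, prod_primeList]
  exact Nat.pow_le_pow_left (le_primorial_size_pow h2) m

/-- The value found by Chinese remaindering. -/
theorem crt_evalTable {d m r s : ℕ} {D a p : List ℕ} (hd : 1 ≤ d) (hr : 2 ≤ r)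
    (hs : s ≤ m) (hm : 1 ≤ m) (hD : ∀ x ∈ D, x < r ^ s)
    (ha : ∀ x ∈ a, x < r) (hp : p = stepPrimes d r) :
    (∑ k ∈ Finset.range (p.map (crtWeight m (p.map (· ^ m)).prod)).length,
      evalTable d m ((D.map (· % p.getD k 0 ^ m)).getD · 0) ((a.map (· % p.getD k 0 ^ m)).getD · 0) %
        p.getD k 0 ^ m * (p.map (crtWeight m (p.map (· ^ m)).prod)).getD k 0) %
      (p.map (· ^ m)).prod = evalTable d m (D.getD · 0) (a.getD · 0) := by
  rw [List.length_map]
  have h0 : 0 < r ^ s := Nat.pow_pos (by omega)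
  refine crtWeight_eq (fun x hx => prime_of_mem_primeList (hp ▸ hx)) (hp ▸ nodup_primeList _) hm
    (hp ▸ evalTable_lt_prod_stepPrimes hd hr hs (fun u _ => getD_lt h0 hD u)
      fun i _ => getD_lt (by omega) ha i) fun k _ => ?_
  refine (Nat.mod_modEq _ _).trans (evalTable_modEq (fun u _ => ?_) fun i _ => ?_) <;>
  · rw [getD_map_mod]
    exact Nat.mod_modEq _ _

theorem IsInst.map_mod {m d p n : ℕ} {f : List ℕ} {pts : List (List ℕ)} (hn : n = p ^ m) (h0 : 0 < n)
    (hf : f.length = d ^ m) (hpts : ∀ a ∈ pts, a.length = m) :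
    IsInst m d p m (f.map (· % n)) (pts.map fun a => a.map (· % n)) := by
  subst hn
  refine ⟨by simpa using hf, fun x hx => ?_, fun a ha => ?_, fun a ha x hx => ?_⟩
  · obtain ⟨y, _, rfl⟩ := List.mem_map.1 hx
    exact Nat.mod_lt _ h0
  · obtain ⟨b, hb, rfl⟩ := List.mem_map.1 ha
    simpa using hpts b hb
  · obtain ⟨b, hb, rfl⟩ := List.mem_map.1 ha
    obtain ⟨y, _, rfl⟩ := List.mem_map.1 hx
    exact Nat.mod_lt _ h0

variable {S : ℕ} [hS : Fact (2 ≤ S)]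

set_option exponentiation.threshold 10000 in
theorem Spec.primesUpTo_bits {M : ℕ} (hM : (M ^ 16).size ≤ S) :
    Spec (MME.primesUpTo (.bits (MME.pow (.var M) 16) - 1)) (primeList ((M ^ 16).size - 1))
      (S ^ 7000) := by
  have hMs : M.size ≤ S := (Nat.size_le_size (Nat.le_self_pow (by norm_num) M)).trans hM
  have := LePow.of_le hS.1 hMs
  have := LePow.of_le hS.1 hM
  have h2 : ∀ k, k ≠ 0 → Fact (2 ≤ S ^ k) := fun k hk => ⟨hS.1.trans (Nat.le_self_pow hk S)⟩
  have := h2 5 (by norm_num)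
  have hpow := Spec.pow (S := S ^ 5) ((Spec.natVar M).mono (LePow.le_of 5))
    ((Spec.lit (v := 16) 16).mono (LePow.le_of 5)) (LePow.le_of 5) (LePow.le_of 5)
  rw [← pow_mul] at hpow
  have := h2 110 (by norm_num)
  refine (Spec.primesUpTo (S := S ^ 110) ((hpow.bits.sub (.lit (v := 1) 1)).mono ?_) ?_).mono ?_
  · exact LePow.le_of 110
  · exact LePow.le_of 110
  · exact (pow_mul S 110 60).ge.trans
      (Nat.pow_le_pow_right (by have := hS.1; omega) (by norm_num))

-- The work of the level itself is kept apart from the `T` steps of each recursive call, since only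
-- the latter is multiplied by the number of primes at every level. The bound on the length of `Q`
-- controls all moduli and weights: each `p ^ m` divides `Q`, and each weight is below `Q`.
set_option maxHeartbeats 600000 in
theorem Spec.mmeBStep {m d r s T : ℕ} {f : List ℕ} {pts : List (List ℕ)}
    {rc : Tm Ty.Val Proc Inst → Tm Ty.Val Proc (.arr .nat)}
    (hI : IsInst m d r s f pts) (h16 : 16 ≤ S) (hm : m ≤ S) (hd : d ≤ S) (hr2 : 2 ≤ r)
    (hs : 1 ≤ s) (hsm : s ≤ m) (hd1 : 1 ≤ d) (hq : (r ^ s).size ≤ S)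
    (hM : ((d * r ^ d) ^ 16).size ≤ S) (hQ : ((stepPrimes d r).map (· ^ m)).prod.size ≤ S)
    (hrc : ∀ p ∈ stepPrimes d r, ∀ f' pts', IsInst m d p m f' pts' → pts'.length = pts.length →
      ∀ u c, Spec u ((f', pts', p, m) : List ℕ × List (List ℕ) × ℕ × ℕ) c →
        Spec (rc u) (evalList m d (p ^ m) f' pts') (T + c + 1)) :
    Spec (mmeBStep (.var m) (.var d) rc (.var ((f, pts, r, s) :
      List ℕ × List (List ℕ) × ℕ × ℕ) : Tm Ty.Val Proc Inst)) (evalList m d (r ^ s) f pts)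
      (S ^ 8000 * ((expList s m).length * (d ^ m + pts.length)) +
        (expList s m).length * ((stepPrimes d r).length * T)) := by
  obtain ⟨q, hqdef⟩ : ∃ q, q = r ^ s := ⟨_, rfl⟩
  obtain ⟨E, hE⟩ : ∃ E, E = expList s m := ⟨_, rfl⟩
  obtain ⟨W, hW⟩ : ∃ W, W = d ^ m + pts.length := ⟨_, rfl⟩
  obtain ⟨M, hMdef⟩ : ∃ M, M = d * r ^ d := ⟨_, rfl⟩
  obtain ⟨p, hp⟩ : ∃ p, p = stepPrimes d r := ⟨_, rfl⟩
  obtain ⟨n, hn⟩ : ∃ n, n = p.map (· ^ m) := ⟨_, rfl⟩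
  obtain ⟨Q, hQdef⟩ : ∃ Q, Q = n.prod := ⟨_, rfl⟩
  rw [← hqdef] at hq
  rw [← hp, ← hn, ← hQdef] at hQ
  rw [← hMdef] at hM
  rw [← hp] at hrc
  have hpt := hI.point_lt
  have htab := hI.table_lt
  rw [← hqdef] at hpt htab
  rw [← hqdef, ← hE, ← hW, ← hp]
  obtain ⟨R, hR⟩ : ∃ R, R = E.length * (p.length * T) := ⟨_, rfl⟩
  rw [← hR]
  have hm1 : 1 ≤ m := hs.trans hsm
  have hrq : r ≤ q := hqdef ▸ Nat.le_self_pow (by omega) r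
  have hrs : r.size ≤ S := (Nat.size_le_size hrq).trans hq
  have hq1 : 1 < q := by omega
  have hD1 : 1 ≤ d ^ m := Nat.one_le_pow _ _ (by omega)
  have hE1 : 1 ≤ E.length := by
    have := length_expList_mono hs (Nat.zero_le m)
    simpa [hE, expList] using this
  have hW1 : 1 ≤ W := by omega
  have hEW : 1 ≤ E.length * W := Nat.mul_pos hE1 hW1
  have hM1 : 1 ≤ M := hMdef ▸ Nat.mul_pos hd1 (Nat.pow_pos (by omega))
  have hMs : M.size ≤ S := (Nat.size_le_size (Nat.le_self_pow (by norm_num) M)).trans hM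
  have hpp : ∀ x ∈ p, x.Prime := fun x hx => prime_of_mem_primeList (hp ▸ hx)
  have hpl : p.length ≤ S := by
    have h := length_primeList_le ((M ^ 16).size - 1)
    have h1 : 0 < (M ^ 16).size := Nat.size_pos.2 (Nat.pow_pos hM1)
    rw [hp, stepPrimes, ← hMdef]
    omega
  have hn0 : ∀ x ∈ n, 0 < x := fun x hx => by
    obtain ⟨y, hy, rfl⟩ := List.mem_map.1 (hn ▸ hx)
    exact Nat.pow_pos (hpp y hy).pos
  have hQ0 : 0 < Q := hQdef ▸ List.prod_pos hn0
  have hnd : ∀ x ∈ p, x ^ m ∣ Q := fun x hx =>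
    hQdef ▸ List.dvd_prod (hn ▸ List.mem_map_of_mem (f := (· ^ m)) hx)
  have hns : ∀ x ∈ p, (x ^ m).size ≤ S := fun x hx =>
    (Nat.size_le_size (Nat.le_of_dvd hQ0 (hnd x hx))).trans hQ
  have hps : ∀ x ∈ p, x.size ≤ S := fun x hx =>
    (Nat.size_le_size (Nat.le_self_pow (by omega) x)).trans (hns x hx)
  have hEl : ∀ e ∈ E, e.length ≤ S := fun e he => by
    have := ((mem_expList hs).1 (hE ▸ he)).1; omega
  have hEx : ∀ e ∈ E, ∀ x ∈ e, x ≤ S := fun e he x hx => by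
    have := ((mem_expList hs).1 (hE ▸ he)).2
    have := List.single_le_sum (fun _ _ => Nat.zero_le _) x hx
    omega
  have hsz : ∀ x, x < q → x.size ≤ S := fun x hx => (Nat.size_le_size hx.le).trans hq
  have hlt := hasseTable_lt (m := m) (d := d) (by omega : 0 < q)
  obtain ⟨D, hD⟩ : ∃ D, D = (List.range E.length).map fun j => hasseTable m d q (E.getD j []) f :=
    ⟨_, rfl⟩
  have hDget : ∀ j < E.length, D.getD j [] = hasseTable m d q (E.getD j []) f := fun j hj =>
    hD ▸ getD_map_range _ _ _ hj
  have hDl : ∀ j < E.length, (D.getD j []).length = d ^ m := fun j hj => by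
    rw [hDget j hj, length_hasseTable]
  have hDlt : ∀ j < E.length, ∀ x ∈ D.getD j [], x < q := fun j hj => by
    rw [hDget j hj]
    exact hlt _ _
  obtain ⟨red, hred⟩ : ∃ red, red = pts.map fun a => a.map (· % r) := ⟨_, rfl⟩
  have hredl : red.length = pts.length := by rw [hred, List.length_map]
  have hredm : ∀ a ∈ red, a.length = m := fun a ha => by
    obtain ⟨b, hb, rfl⟩ := List.mem_map.1 (hred ▸ ha)
    simpa using hI.length_point b hb
  have hredx : ∀ a ∈ red, ∀ x ∈ a, x < r := fun a ha x hx => by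
    obtain ⟨b, hb, rfl⟩ := List.mem_map.1 (hred ▸ ha)
    obtain ⟨y, _, rfl⟩ := List.mem_map.1 hx
    exact Nat.mod_lt _ (by omega)
  have hnget : ∀ k < p.length, n.getD k 0 = p.getD k 0 ^ m := fun k hk =>
    hn ▸ getD_map _ _ _ _ hk
  have hpm : ∀ k < p.length, p.getD k 0 ∈ p := fun k hk => getD_mem 0 hk
  have g1 : ∀ k < p.length, Spec (.get (.var n : Tm Ty.Val Proc (.arr .nat)) (.var k))
      (p.getD k 0 ^ m : ℕ) S := fun k hk =>
    ((arrVar n).getNat (.natVar k)).congr (hnget k hk) (by omega)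
  have fE := Fact.mk hE1
  have fW := Fact.mk hW1
  have fEW := Fact.mk hEW
  have fD := Fact.mk hD1
  have i1 : LePowMul S W (d ^ m) 0 := .of_le hS.1 hW1 (by omega)
  have i2 : LePowMul S W pts.length 0 := .of_le hS.1 hW1 (by omega)
  have i3 : LePowMul S (E.length * W) E.length 0 := .of_le hS.1 hEW (Nat.le_mul_of_pos_right _ hW1)
  have i4 : LePowMul S (E.length * W) pts.length 0 :=
    .of_le hS.1 hEW ((by omega : _ ≤ W).trans (Nat.le_mul_of_pos_left _ hE1))
  have i5 := LePow.of_le hS.1 hpl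
  have i6 := LePow.of_le hS.1 hMs
  have i7 := LePow.of_le hS.1 hM
  have i8 := LePow.of_le hS.1 hd
  have i9 := LePow.of_le hS.1 hq
  have i10 := LePow.of_le hS.1 hrs
  have i11 := LePow.of_le hS.1 hQ
  have htabS : ∀ x ∈ f, x.size ≤ S := fun x hx => hsz x (htab x hx)
  -- Chinese remaindering recovers the integer value of the lifted derivative, so reducing it modulo
  -- `q` afterwards is legitimate.
  have hval : ∀ j < E.length, ∀ i < pts.length, (∑ k ∈ Finset.range (p.map (crtWeight m Q)).length,
      evalTable d m (((D.getD j []).map (· % p.getD k 0 ^ m)).getD · 0)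
        (((red.getD i []).map (· % p.getD k 0 ^ m)).getD · 0) %
        p.getD k 0 ^ m * (p.map (crtWeight m Q)).getD k 0) % Q % q =
      evalTable d m ((D.getD j []).getD · 0) ((red.getD i []).getD · 0) % q := by
    intro j hj i hi
    rw [hQdef, hn, crt_evalTable hd1 hr2 hsm hm1 (hqdef ▸ hDlt j hj)
      (hredx _ (getD_mem _ (hredl.symm ▸ hi))) hp]
  have hinst : ∀ j < E.length, ∀ k < p.length, IsInst m d (p.getD k 0) m
      ((D.getD j []).map (· % p.getD k 0 ^ m)) (red.map fun a => a.map (· % p.getD k 0 ^ m)) :=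
    fun j hj k hk => IsInst.map_mod rfl (Nat.pow_pos (hpp _ (hpm k hk)).pos) (hDl j hj) hredm
  have v1 : ∀ x : ℕ, Spec (.var x : Tm Ty.Val Proc .nat) x S := fun x =>
    (Spec.natVar x).mono (by omega)
  obtain ⟨Y, hY⟩ : ∃ Y, Y = S ^ 7000 := ⟨_, rfl⟩
  have i12 : LePow S Y 7000 := ⟨hS.1, hY.le⟩
  have hB := Spec.primesUpTo_bits hM
  have hC := Spec.crtBasis (c := 1) (by omega) (v1 m) (v1 Q)
    (arrVar p) hm hm1 hQ hpl hps fun x hx => (hpp x hx).two_le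
  rw [← hY] at hB hC
  refine Spec.mono (Spec.letIn (v := f) (Spec.var _).fst (Spec.letIn (σ := .arr (.arr .nat))
    (v := pts) (Spec.var _).snd.fst
    (Spec.letIn (v := r) (Spec.var _).snd.snd.fst (Spec.letIn (v := s) (Spec.var _).snd.snd.snd
    (Spec.letIn (v := q) ((Spec.pow (.var' _) (.var' _) hrs (hsm.trans hm)).congr hqdef.symm le_rfl)
    (Spec.letIn (σ := .arr (.arr .nat)) (v := E)
      ((Spec.exponents (X := E.length) (.var' _) (.var' _) hm (hsm.trans hm) hs
        (hE ▸ le_rfl)).congr hE.symm le_rfl)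
    (Spec.letIn (σ := .arr (.arr .nat)) (v := D)
      (Spec.congr (Spec.tabulate (arrArrVar E).len fun j hj => Spec.hasse (c := 3) (by omega)
        (.var' _) (.var' _) (.var' _) ((arrArrVar E).getArr (.natVar j)) (.var' _) hm hd hq hq1
        (hEl _ (getD_mem _ hj)) (hEx _ (getD_mem _ hj)) htabS hD1 le_rfl) hD.symm le_rfl)
    (Spec.letIn (σ := .arr (.arr .nat)) (v := red)
      (Spec.congr (Spec.tabulate (g := fun i => (pts.getD i []).map (· % r)) (arrArrVar pts).len
        fun i hi => Spec.reduce (X := S)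
          (((arrArrVar pts).getArr (.natVar i)).mono (by omega)) (.var' _) hrs
          (fun x hx => hsz _ (hpt _ (getD_mem _ hi) x hx)) (by omega)
          ((hI.length_point _ (getD_mem _ hi)).le.trans hm))
        ((map_range_getD pts [] fun a => a.map (· % r)).trans hred.symm) le_rfl)
    (Spec.letIn (v := M) (Spec.congr ((Spec.natVar d).mul (Spec.pow (v1 r) (v1 d) hrs hd))
      hMdef.symm le_rfl)
    (Spec.letIn (v := p) (Spec.congr hB
      (by rw [hp, stepPrimes, hMdef]) le_rfl)
    (Spec.letIn (v := n) (Spec.congr (Spec.tabulate (g := fun k => p.getD k 0 ^ m) (arrVar p).len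
      fun k hk => Spec.pow (((arrVar p).getNat (.natVar k)).mono (by omega)) (v1 m)
        (hps _ (hpm k hk)) hm) ((map_range_getD p 0 (· ^ m)).trans hn.symm) le_rfl)
    (Spec.letIn (σ := .arr (.arr (.arr .nat))) (v := (List.range E.length).map fun j =>
        (List.range p.length).map fun k => (D.getD j []).map (· % p.getD k 0 ^ m))
      (Spec.tabulate (τ := .arr (.arr .nat)) (arrArrVar E).len fun j hj =>
        Spec.tabulate (τ := .arr .nat) (arrVar p).len fun k hk =>
        Spec.reduce (X := d ^ m) (((arrArrVar D).getArr (.natVar j)).mono (by omega)) (g1 k hk)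
          (hns _ (hpm k hk)) (fun x hx => hsz _ (hDlt j hj x hx)) hD1 (hDl j hj).le)
    (Spec.letIn (σ := .arr (.arr (.arr .nat))) (v := (List.range p.length).map fun k =>
        red.map fun a => a.map (· % p.getD k 0 ^ m))
      (Spec.tabulate (τ := .arr (.arr .nat)) (c' := S ^ 60 * W) (arrVar p).len fun k hk =>
        Spec.congr (Spec.tabulate (c' := S ^ 50) (τ := .arr .nat)
          (g := fun i => (red.getD i []).map (· % p.getD k 0 ^ m))
          (arrArrVar pts).len fun i hi => Spec.mono (Spec.reduce (X := S)
            (((arrArrVar red).getArr (.natVar i)).mono (by omega)) (g1 k hk)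
            (hns _ (hpm k hk)) ?_ (by omega) ?_) ?_)
          (hredl ▸ map_range_getD red [] fun a => a.map (· % p.getD k 0 ^ m)) ?_)
    (Spec.letIn (σ := .arr (.arr (.arr .nat))) (v := (List.range E.length).map fun j =>
        (List.range p.length).map fun k => evalList m d (p.getD k 0 ^ m)
          ((D.getD j []).map (· % p.getD k 0 ^ m)) (red.map fun a => a.map (· % p.getD k 0 ^ m)))
      (Spec.mono (c' := S ^ 50 * E.length + R)
        (Spec.tabulate (τ := .arr (.arr .nat)) (arrArrVar E).len fun j hj =>
        Spec.tabulate (τ := .arr .nat) (arrVar p).len fun k hk =>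
          hrc _ (hpm k hk) _ _ (hinst j hj k hk) (by simpa using hredl) _ _
            (Spec.pair (Spec.congr (((arrArrArrVar _).getArrArr (.natVar j)).getArr (.natVar k)) ?_ le_rfl)
              (Spec.pair (Spec.congr ((arrArrArrVar _).getArrArr (.natVar k)) ?_ le_rfl)
              (Spec.pair ((arrVar p).getNat (.natVar k)) (.natVar m))))) ?_)
    (Spec.letIn (v := Q) (Spec.congr (Spec.arrProd (S := S) ((Spec.arrVar n).mono (by omega))
      ?_ ?_ hn0) hQdef.symm le_rfl)
    (Spec.letIn (v := p.map (crtWeight m Q)) hC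
    (Spec.letIn (σ := .arr (.arr .nat)) (v := (List.range E.length).map fun j =>
        (List.range pts.length).map fun i =>
          evalTable d m ((D.getD j []).getD · 0) ((red.getD i []).getD · 0) % q)
      (Spec.tabulate (τ := .arr .nat) (c' := S ^ 100 * W) (arrArrVar E).len fun j hj => Spec.mono
        (Spec.tabulate (τ := .nat) (c' := S ^ 80) (arrArrVar pts).len fun i hi =>
        Spec.congr ((Spec.crt (w := fun k =>
          evalTable d m (((D.getD j []).map (· % p.getD k 0 ^ m)).getD · 0)
            (((red.getD i []).map (· % p.getD k 0 ^ m)).getD · 0) % p.getD k 0 ^ m)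
          (v1 Q) (.var' _) ?_ ?_ hQ ?_ ?_).mod (.natVar q)) (hval j hj i hi) ?_) ?_)
    (Spec.congr (c' := S ^ 270 * (E.length * W)) (Spec.tabulate (c' := S ^ 250 * E.length)
      (g := fun i => evalTable d m (f.getD · 0)
      ((pts.getD i []).getD · 0) % q) (arrArrVar pts).len fun i hi => ?_)
      (map_range_getD pts [] fun a => evalTable d m (f.getD · 0) (a.getD · 0) % q) ?_)))))))))))))))))) ?_
  · exact fun x hx => hsz _ ((hredx _ (getD_mem _ (hredl.symm ▸ hi)) x hx).trans_le hrq)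
  · exact (hredm _ (getD_mem _ (hredl.symm ▸ hi))).le.trans hm
  · exact LePow.le_of 50
  · generalize pts.length = N at *
    exact LePowMul.le_of 60
  · rw [getD_map_range _ _ _ hj, getD_map_range _ _ _ hk]
  · rw [getD_map_range _ _ _ hk]
  · rw [hR]
    generalize E.length = L at *
    generalize p.length = k at *
    have h := LePowMul.le_of (S := S) (X := L) (a := 1 + 1 + 1 + L * (1 + 1 + 1 + 1 + k * (16 + 1))) 50
    calc _ = 1 + 1 + 1 + L * (1 + 1 + 1 + 1 + k * (16 + 1)) + L * (k * T) := by ring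
      _ ≤ _ := by gcongr
  · rwa [hn, List.length_map]
  · rwa [← hQdef]
  · intro k hk
    rw [List.length_map] at hk
    refine Spec.congr ((((arrArrArrVar _).getArrArr (.natVar j)).getArr (.natVar k)).getNat
      (.natVar i)) ?_ (by omega)
    rw [getD_map_range _ _ _ hj, getD_map_range _ _ _ hk, evalList, List.map_map,
      getD_map _ _ [] _ (hredl.symm ▸ hi)]
    rfl
  · intro k hk
    rw [List.length_map] at hk
    have hx := hpm k hk
    exact (Nat.size_le_size (Nat.mod_lt _ (Nat.pow_pos (hpp _ hx).pos)).le).trans (hns _ hx)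
  · rwa [List.length_map]
  · intro x hx
    obtain ⟨y, hy, rfl⟩ := List.mem_map.1 hx
    exact (Nat.size_le_size (crtWeight_lt (hpp y hy).pos hQ0 (hnd y hy)).le).trans hQ
  · have : NeZero Q := ⟨hQ0.ne'⟩
    generalize (∑ k ∈ Finset.range (p.map (crtWeight m Q)).length,
      evalTable d m (((D.getD j []).map (· % p.getD k 0 ^ m)).getD · 0)
        (((red.getD i []).map (· % p.getD k 0 ^ m)).getD · 0) %
        p.getD k 0 ^ m * (p.map (crtWeight m Q)).getD k 0) = x
    exact LePow.le_of 80
  · generalize pts.length = N at *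
    exact LePowMul.le_of 100
  · have hpi := getD_mem [] hi
    have hri : red.getD i [] = (pts.getD i []).map (· % r) := hred ▸ getD_map _ _ _ _ hi
    refine Spec.congr (Spec.taylor (X := E.length) (c := 1) (w := fun j =>
      evalTable d m ((D.getD j []).getD · 0) ((red.getD i []).getD · 0) % q)
      (by omega) (v1 q) (arrArrVar E) (((arrArrVar pts).getArr (.natVar i)).mono (by omega))
      (((arrArrVar red).getArr (.natVar i)).mono (by omega)) (fun j hj => ?_)
      (fun j hj => hsz _ (Nat.mod_lt _ (by omega))) hq hq1 (fun x hx => hsz _ (hpt _ hpi x hx))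
      (fun x hx => hsz _ ((hredx _ (getD_mem _ (hredl.symm ▸ hi)) x hx).trans_le hrq)) hEl hEx hE1
      le_rfl) ?_ ?_
    · refine Spec.congr (((arrArrVar _).getArr (.natVar j)).getNat (.natVar i)) ?_ (by omega)
      rw [getD_map_range _ _ _ hj, getD_map_range _ _ _ hi]
    · rw [hri]
      refine taylor_eq hs hqdef hE fun j hj => ?_
      rw [← hDget j hj]
      exact Nat.mod_modEq _ _
    · generalize E.length = L at *
      exact LePowMul.le_of 250
  · generalize pts.length = N at *
    generalize E.length = L at *
    rw [mul_comm N]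
    exact LePowMul.le_of 270
  · have i13 : LePow S (r ^ d).size 1 := .of_le hS.1
      ((Nat.size_le_size (hMdef ▸ Nat.le_mul_of_pos_left _ hd1)).trans hMs)
    generalize pts.length = N at *
    generalize E.length = L at *
    generalize p.length = k at *
    generalize d ^ m = A at *
    generalize (r ^ d).size = z at *
    -- The accumulated cost of all bindings except the contribution `R` of the recursive calls,
    -- which stands on both sides.
    have h := LePowMul.le_of (S := S) (X := L * W) (a := 1 + 1 + (1 + 1 + 1 + (1 + 1 + 1 + 1 +
      (1 + 1 + 1 + 1 + (S ^ 20 + (S ^ 100 * L + (1 + 1 + L * (S ^ 200 * A + 1) + 1 + (1 + 1 + N *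
      (S ^ 30 * S + 1) + 1 + (1 + S ^ 20 + (d.size + 1) * (z + 1) + (Y + (1 + 1 + k * (S ^ 20 + 1)
      + 1 + (1 + 1 + L * (1 + 1 + k * (S ^ 30 * A + 1) + 1 + 1) + 1 + (1 + 1 + k * (S ^ 60 * W +
      1) + 1 + (S ^ 50 * L + (S ^ 30 + (Y + (1 + 1 + L * (S ^ 100 * W + 1) + 1 + S ^ 270 * (L * W)
      + 1) + 1) + 1) + 1) + 1) + 1) + 1) + 1) + 1) + 1) + 1) + 1) + 1) + 1) + 1) + 1) + 1) 8000
      (by norm_num)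
    linarith only [h]

end

/-! ### The recurrence for the running time, and correctness at every depth. -/

/-- An upper bound for the primes used at positive depth and for their number. -/
def primeBound (d r : ℕ) : ℕ := ((d * r ^ d) ^ 16).size

theorem primeBound_pos {d r : ℕ} (hd : 1 ≤ d) (hr : 1 ≤ r) : 0 < primeBound d r :=
  Nat.size_pos.2 (Nat.pow_pos (Nat.mul_pos hd (Nat.pow_pos hr)))

theorem le_primeBound {d r p : ℕ} (h : p ∈ stepPrimes d r) : p ≤ primeBound d r :=
  (le_of_mem_primeList h).trans (Nat.sub_le _ _)

theorem length_stepPrimes_le {d r : ℕ} (hd : 1 ≤ d) (hr : 1 ≤ r) :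
    (stepPrimes d r).length ≤ primeBound d r := by
  have h := length_primeList_le (primeBound d r - 1)
  rwa [Nat.sub_add_cancel (primeBound_pos hd hr)] at h

theorem primeBound_mono (d : ℕ) {r r' : ℕ} (h : r ≤ r') : primeBound d r ≤ primeBound d r' := by
  exact Nat.size_le_size (by gcongr)

theorem size_pow_le_mul {r b m : ℕ} (hr : r.size ≤ b) : (r ^ m).size ≤ b * m + 1 := by
  rw [Nat.size_le, pow_succ]
  have : r ^ m ≤ 2 ^ (b * m) := by
    rw [pow_mul]
    exact Nat.pow_le_pow_left (Nat.size_le.1 hr).le m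
  have := Nat.two_pow_pos (b * m)
  omega

/-- From `d < 2 ^ d` and `r < 2 ^ b` one gets `d * r ^ d < 2 ^ (d * (1 + b))`. -/
theorem primeBound_le {d r b : ℕ} (hr : r.size ≤ b) :
    primeBound d r ≤ 16 * d * (1 + b) := by
  rw [primeBound, Nat.size_le]
  have h1 : d * r ^ d < 2 ^ (d * (1 + b)) := by
    rw [mul_add, pow_add, mul_one, mul_comm d b, pow_mul]
    exact Nat.mul_lt_mul_of_lt_of_le Nat.lt_two_pow_self
      (Nat.pow_le_pow_left (Nat.size_le.1 hr).le d) (by positivity)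
  calc (d * r ^ d) ^ 16 < (2 ^ (d * (1 + b))) ^ 16 := Nat.pow_lt_pow_left h1 (by norm_num)
    _ = 2 ^ (16 * d * (1 + b)) := by rw [← pow_mul]; ring_nf

/-- By `primorial n ≤ 4 ^ n` the length of `Q` is linear in the bound for the primes. -/
theorem size_prod_stepPrimes_le {d r : ℕ} (hd : 1 ≤ d) (hr : 1 ≤ r) (m : ℕ) :
    ((stepPrimes d r).map (· ^ m)).prod.size ≤ 2 * primeBound d r * m + 1 := by
  rw [show ((stepPrimes d r).map (· ^ m)).prod = _ from List.prod_hom _ (powMonoidHom m),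
    powMonoidHom_apply]
  refine size_pow_le_mul ?_
  rw [stepPrimes, prod_primeList, Nat.size_le, pow_mul]
  exact (primorial_le_four_pow _).trans_lt
    (Nat.pow_lt_pow_right (by norm_num) (Nat.sub_lt (primeBound_pos hd hr) one_pos))

/-- A bound for the running time of MME-B at depth `t`. -/
def depthCost (S m d N : ℕ) : ℕ → ℕ → ℕ → ℕ
  | 0, s, r => S ^ 300 * ((expList s m).length * (max d r ^ m + N))
  | t + 1, s, r => S ^ 8000 * ((expList s m).length * (d ^ m + N)) +
      (expList s m).length * (primeBound d r * depthCost S m d N t m (primeBound d r))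

theorem depthCost_mono (S m d N : ℕ) (t s : ℕ) {r r' : ℕ} (h : r ≤ r') :
    depthCost S m d N t s r ≤ depthCost S m d N t s r' := by
  induction t generalizing s r r' with
  | zero => unfold depthCost; gcongr
  | succ t ih =>
    have h1 := primeBound_mono d h
    have h2 := ih m h1
    unfold depthCost
    gcongr

/-- The hypothesis `hb` makes the length bound `b` self-reproducing: a base of length at most `b`
leads to primes of length at most `b`. Hence one `S` serves all depths, and the cost follows the
recurrence of `depthCost`. -/
theorem Spec.mmeB {S m d t r s b : ℕ} {f : List ℕ} {pts : List (List ℕ)} [hS : Fact (2 ≤ S)]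
    (hI : IsInst m d r s f pts) (hr2 : 2 ≤ r) (hs : 1 ≤ s) (hsm : s ≤ m) (hd1 : 1 ≤ d)
    (hrb : r.size ≤ b) (hb : (16 * d * (1 + b)).size ≤ b)
    (h16 : 16 ≤ S) (hm : m ≤ S) (hd : d ≤ S) (h1 : b * m + 1 ≤ S)
    (h2 : 2 * (16 * d * (1 + b)) * m + 1 ≤ S) :
    Spec (mmeB Ty.Val Proc ((m, d, t, f, pts, r, s) :
      ℕ × ℕ × ℕ × List ℕ × List (List ℕ) × ℕ × ℕ)) (evalList m d (r ^ s) f pts)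
      (depthCost S m d pts.length t s r + 30) := by
  have hm1 : 1 ≤ m := hs.trans hsm
  have hq : ∀ r' s' : ℕ, r'.size ≤ b → s' ≤ m → (r' ^ s').size ≤ S := fun r' s' hr hs =>
    (size_pow_le_mul hr).trans ((by gcongr : b * s' + 1 ≤ b * m + 1).trans h1)
  have h3 : 16 * d * (1 + b) ≤ S := by nlinarith
  refine Spec.mono (Spec.letIn (v := m) (Spec.var _).fst (Spec.letIn (v := d) (Spec.var _).snd.fst
    (Spec.letIn (v := t) (Spec.var _).snd.snd.fst
    (Spec.letIn (σ := Inst) (v := (f, pts, r, s)) (Spec.var _).snd.snd.snd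
    (Spec.recursion (σ := Inst) (τ := .arr .nat) (c := depthCost S m d pts.length t s r)
      (fun (j : ℕ) (y : List ℕ × List (List ℕ) × ℕ × ℕ) (w : List ℕ) (c : ℕ) =>
        IsInst m d y.2.2.1 y.2.2.2 y.1 y.2.1 ∧ 2 ≤ y.2.2.1 ∧ 1 ≤ y.2.2.2 ∧ y.2.2.2 ≤ m ∧
        y.2.2.1.size ≤ b ∧ w = evalList m d (y.2.2.1 ^ y.2.2.2) y.1 y.2.1 ∧
        c = depthCost S m d y.2.1.length j y.2.2.2 y.2.2.1)
      (.natVar t) (.var _) ?_ ?_ ⟨hI, hr2, hs, hsm, hrb, rfl, rfl⟩))))) (by omega)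
  · rintro ⟨f, pts, r, s⟩ w c ⟨hI, hr2, hs, hsm, hrb, rfl, rfl⟩
    exact Spec.productSet hI h16 hm hd hr2 hs hsm hd1 (hq _ _ hrb hsm) (le_max_left _ _)
      (le_max_right _ _)
  · rintro j hj rc hrc ⟨f, pts, r, s⟩ w c ⟨hI, hr2, hs, hsm, hrb, rfl, rfl⟩
    replace hr2 : 2 ≤ r := hr2
    have hB : primeBound d r ≤ 16 * d * (1 + b) := primeBound_le hrb
    refine (Spec.mmeBStep (T := depthCost S m d pts.length j m (primeBound d r)) hI h16 hm hd hr2 hs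
      hsm hd1 (hq _ _ hrb hsm) (hB.trans h3) ?_ ?_).mono ?_
    · refine (size_prod_stepPrimes_le hd1 (one_le_two.trans hr2) m).trans (le_trans ?_ h2)
      gcongr
    · intro p hp f' pts' hI' hl u c hu
      have hpB : p ≤ primeBound d r := le_primeBound hp
      refine (hrc u _ _ _ c ⟨hI', (prime_of_mem_primeList hp).two_le, hm1, le_rfl,
        (Nat.size_le_size (hpB.trans hB)).trans hb, rfl, rfl⟩ hu).mono ?_
      have := depthCost_mono S m d pts.length j m hpB
      simp only [hl]
      omega
    · have := length_stepPrimes_le hd1 (one_le_two.trans hr2)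
      simp only [depthCost]
      gcongr

/-! ### The running time in closed form -/

theorem size_le_logb_add_one {n : ℕ} (hn : 1 ≤ n) : (n.size : ℝ) ≤ Real.logb 2 n + 1 := by
  have h0 : 0 < n.size := Nat.size_pos.2 hn
  have h1 : 2 ^ (n.size - 1) ≤ n := Nat.lt_size.1 (Nat.sub_lt h0 one_pos)
  have h2 : ((n.size - 1 : ℕ) : ℝ) ≤ Real.logb 2 n := by
    rw [Real.le_logb_iff_rpow_le (by norm_num) (by exact_mod_cast hn), Real.rpow_natCast]
    exact_mod_cast h1
  rw [Nat.cast_sub h0] at h2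
  push_cast at h2
  linarith

theorem one_le_logb_two {x : ℝ} (hx : 2 ≤ x) : 1 ≤ Real.logb 2 x := by
  rw [Real.le_logb_iff_rpow_le (by norm_num) (by linarith)]
  simpa using hx

theorem logb_two_le_sub_one {n : ℕ} (hn : 1 ≤ n) : Real.logb 2 n ≤ n - 1 := by
  rw [Real.logb_le_iff_le_rpow (by norm_num) (by exact_mod_cast hn),
    show (n : ℝ) - 1 = ((n - 1 : ℕ) : ℝ) by push_cast [hn]; rfl, Real.rpow_natCast]
  have := Nat.lt_two_pow_self (n := n - 1)
  exact_mod_cast (by omega : n ≤ 2 ^ (n - 1))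

/-- A bound for the primes that MME-B uses for a modulus with base `x`. -/
noncomputable def primeLog (d : ℕ) (x : ℝ) : ℝ := 32 * d * Real.logb 2 x

theorem le_primeLog {d : ℕ} {x : ℝ} (hd : 1 ≤ d) (hx : 2 ≤ x) : 32 * (d : ℝ) ≤ primeLog d x :=
  le_mul_of_one_le_right (by positivity) (one_le_logb_two hx)

theorem two_le_iterate_primeLog {d : ℕ} {x : ℝ} (hd : 1 ≤ d) (hx : 2 ≤ x) (i : ℕ) :
    2 ≤ (primeLog d)^[i] x := by
  have hd' : (1 : ℝ) ≤ d := by exact_mod_cast hd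
  induction i with
  | zero => exact hx
  | succ i ih =>
    rw [Function.iterate_succ_apply']
    have := le_primeLog hd ih
    linarith

theorem two_le_primeBound {d r : ℕ} (hd : 1 ≤ d) (hr : 2 ≤ r) : 2 ≤ primeBound d r := by
  have h2 : 2 ≤ d * r ^ d := by
    calc 2 ≤ r ^ d := hr.trans (Nat.le_self_pow (by omega) r)
      _ ≤ d * r ^ d := Nat.le_mul_of_pos_left _ hd
  have : 1 < primeBound d r :=
    Nat.lt_size.2 ((by norm_num : 2 ^ 1 ≤ 2 ^ 16).trans (Nat.pow_le_pow_left h2 16))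
  omega

/-- The constant 32: `16 * (log d + d * log r) + 1` is at most `32 * d * log x`, because `log d ≤ d
- 1` and `log x ≥ 1`. -/
theorem primeBound_le_primeLog {d r : ℕ} {x : ℝ} (hd : 1 ≤ d) (hr : 2 ≤ r) (hx : (r : ℝ) ≤ x) :
    (primeBound d r : ℝ) ≤ primeLog d x := by
  have hd' : (1 : ℝ) ≤ d := by exact_mod_cast hd
  have hr' : (2 : ℝ) ≤ r := by exact_mod_cast hr
  have h1 := size_le_logb_add_one (n := (d * r ^ d) ^ 16)
    (Nat.pow_pos (Nat.mul_pos hd (Nat.pow_pos (by omega))))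
  push_cast at h1
  rw [Real.logb_pow, Real.logb_mul (by positivity) (by positivity), Real.logb_pow] at h1
  have h2 := logb_two_le_sub_one hd
  have h3 := one_le_logb_two hr'
  have h4 : Real.logb 2 r ≤ Real.logb 2 x :=
    Real.logb_le_logb_of_le (by norm_num) (by linarith) hx
  have h5 : (d : ℝ) * Real.logb 2 r ≤ d * Real.logb 2 x := by gcongr
  have h6 : (d : ℝ) * 1 ≤ d * Real.logb 2 x := by gcongr; linarith
  unfold primeBound primeLog
  push_cast at h1
  linarith

theorem length_expList_le {s m : ℕ} (hs : 1 ≤ s) (hsm : s ≤ m) : (expList s m).length ≤ 4 ^ m := by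
  rw [length_expList hs]
  calc (m + s - 1).choose (s - 1) ≤ 2 ^ (m + s - 1) := Nat.choose_le_two_pow _ _
    _ ≤ 2 ^ (2 * m) := Nat.pow_le_pow_right (by norm_num) (by omega)
    _ = 4 ^ m := pow_mul 2 2 m

/-- The number of exponents at the top level is kept exactly; below it `s = m`, and the number is at
most `4 ^ m`. The work of each level is at most the contribution of the bottom level, whence the
factor `t + 1`. A real bound `x` for `r` is carried along, so that the induction can pass from `x`
to `primeLog d x`. -/
theorem depthCost_le {S m d N : ℕ} (hS : 2 ≤ S) (hm : 1 ≤ m) (hd : 1 ≤ d) (t s : ℕ) {r : ℕ} {x : ℝ}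
    (hr : 2 ≤ r) (hx : (r : ℝ) ≤ x) :
    (depthCost S m d N t s r : ℝ) ≤ (S : ℝ) ^ 8000 * (expList s m).length * ((t + 1) * (4 ^ m) ^ t *
      (∏ i ∈ Finset.range t, (primeLog d)^[i + 1] x) *
        (max (d : ℝ) ((primeLog d)^[t] x) ^ m + N)) := by
  have hS1 : (1 : ℝ) ≤ S := by exact_mod_cast (by omega : 1 ≤ S)
  have hr' : (2 : ℝ) ≤ r := by exact_mod_cast hr
  induction t generalizing s r x with
  | zero =>
    simp only [depthCost, Finset.range_zero, Finset.prod_empty, Function.iterate_zero_apply]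
    push_cast
    have h1 : (S : ℝ) ^ 300 ≤ S ^ 8000 := pow_le_pow_right₀ hS1 (by norm_num)
    have h2 : max (d : ℝ) r ≤ max (d : ℝ) x := max_le_max le_rfl hx
    calc (S : ℝ) ^ 300 * ((expList s m).length * (max (d : ℝ) r ^ m + N))
        ≤ (S : ℝ) ^ 8000 * ((expList s m).length * (max (d : ℝ) x ^ m + N)) := by gcongr
      _ = _ := by ring
  | succ t ih =>
    have hx2 : 2 ≤ x := hr'.trans hx
    have hit := two_le_iterate_primeLog hd hx2
    have h1 := primeBound_le_primeLog hd hr hx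
    have h2 := two_le_primeBound hd hr
    have h3 := ih m h2 h1 (by exact_mod_cast h2)
    simp only [depthCost]
    push_cast
    rw [Finset.prod_range_succ']
    simp only [Function.iterate_succ_apply] at h3 ⊢
    simp only [Function.iterate_zero_apply]
    set Y := ∏ i ∈ Finset.range t, (primeLog d)^[i] (primeLog d (primeLog d x)) with hY
    set V := max (d : ℝ) ((primeLog d)^[t] (primeLog d x)) with hV
    set g := primeLog d x with hg
    have hg1 : 1 ≤ g := by have := hit 1; simp only [Function.iterate_one] at this; linarith
    have hY1 : 1 ≤ Y := by
      refine Finset.prod_induction _ (1 ≤ ·) (fun _ _ => one_le_mul_of_one_le_of_one_le) le_rfl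
        fun i _ => ?_
      have := hit (i + 2)
      simp only [Function.iterate_succ_apply] at this
      linarith
    have hL : ((expList m m).length : ℝ) ≤ 4 ^ m := by exact_mod_cast length_expList_le hm le_rfl
    have hdV : (d : ℝ) ^ m + N ≤ V ^ m + N := by
      gcongr
      exact le_max_left _ _
    have hVN : 0 ≤ V ^ m + N := by positivity
    have h4 : (1 : ℝ) ≤ (4 ^ m) ^ (t + 1) * (Y * g) :=
      one_le_mul_of_one_le_of_one_le (one_le_pow₀ (one_le_pow₀ (by norm_num)))
        (one_le_mul_of_one_le_of_one_le hY1 hg1)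
    have h5 : (depthCost S m d N t m (primeBound d r) : ℝ) ≤ (S : ℝ) ^ 8000 * (4 ^ m *
        ((t + 1) * (4 ^ m) ^ t * Y * (V ^ m + N))) := by
      refine h3.trans ?_
      rw [mul_assoc]
      gcongr
    calc (S : ℝ) ^ 8000 * ((expList s m).length * ((d : ℝ) ^ m + N)) +
          (expList s m).length * ((primeBound d r : ℝ) * depthCost S m d N t m (primeBound d r))
        ≤ (S : ℝ) ^ 8000 * ((expList s m).length * (((4 ^ m) ^ (t + 1) * (Y * g)) * (V ^ m + N))) +
          (expList s m).length * (g * ((S : ℝ) ^ 8000 * (4 ^ m *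
            ((t + 1) * (4 ^ m) ^ t * Y * (V ^ m + N))))) := by
          gcongr
          exact hdV.trans (le_mul_of_one_le_left hVN h4)
      _ = _ := by ring

/-! ### Iterated logarithms -/

theorem iterLog_zero (x : ℝ) : iterLog 0 x = x := rfl

theorem iterLog_succ (c : ℕ) (x : ℝ) : iterLog (c + 1) x = Real.logb 2 (iterLog c x) :=
  Function.iterate_succ_apply' _ _ _

theorem iterLog_succ' (c : ℕ) (x : ℝ) : iterLog (c + 1) x = iterLog c (Real.logb 2 x) :=
  Function.iterate_succ_apply _ _ _

theorem exists_iterLog_le_one (x : ℝ) : ∃ c, iterLog c x ≤ 1 := by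
  obtain ⟨n, hn⟩ := exists_nat_ge x
  induction n generalizing x with
  | zero => exact ⟨0, hn.trans (by simp)⟩
  | succ n ih =>
    rcases le_or_gt x 1 with h | h
    · exact ⟨0, h⟩
    · obtain ⟨c, hc⟩ := ih (Real.logb 2 x) ((Real.logb_le_logb_of_le (by norm_num) (by linarith)
        hn).trans ((logb_two_le_sub_one (by omega)).trans (by simp)))
      exact ⟨c + 1, by rwa [iterLog_succ']⟩

theorem one_lt_iterLog {c : ℕ} {x : ℝ} (h : c < logStar x) : 1 < iterLog c x := by
  by_contra! hc
  exact absurd (Nat.sInf_le (s := {c : ℕ | iterLog c x ≤ 1}) hc) (not_le.2 h)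

theorem le_logStar {t : ℕ} {x : ℝ} (h : ∀ c < t, 1 < iterLog c x) : t ≤ logStar x := by
  by_contra! ht
  exact absurd (Nat.sInf_mem (s := {c : ℕ | iterLog c x ≤ 1}) (exists_iterLog_le_one x))
    (not_le.2 (h _ ht))

theorem lam_sub_one (n : ℕ) (x : ℝ) :
    lam ((n : ℤ) - 1) x = ∏ i ∈ Finset.range (min n (logStar x)), iterLog i x := by
  refine Finset.prod_nbij' Int.toNat Int.ofNat ?_ ?_ ?_ ?_ fun _ _ => rfl
  · intro i hi
    rw [Finset.mem_Icc] at hi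
    rw [Finset.mem_range]
    omega
  · intro i hi
    rw [Finset.mem_range] at hi
    rw [Finset.mem_Icc]
    simp only [Int.ofNat_eq_natCast]
    omega
  · intro i hi
    rw [Finset.mem_Icc] at hi
    exact Int.toNat_of_nonneg hi.1
  · intro i _
    rfl

theorem lam_natCast (n : ℕ) (x : ℝ) :
    lam n x = ∏ i ∈ Finset.range (min (n + 1) (logStar x)), iterLog i x := by
  rw [← lam_sub_one]
  simp

/-- The truncation in `lam` is inactive here, since `t < logStar x` keeps the iterated logarithms of
`x` above 1 up to the `t`-fold one. -/
theorem lam_logb {t : ℕ} {x : ℝ} (ht : t < logStar x) :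
    lam ((t : ℤ) - 1) (Real.logb 2 x) = ∏ i ∈ Finset.range t, iterLog (i + 1) x := by
  have : t ≤ logStar (Real.logb 2 x) := le_logStar fun c hc => by
    rw [← iterLog_succ']
    exact one_lt_iterLog (by omega)
  rw [lam_sub_one, min_eq_left this]
  simp only [iterLog_succ']

theorem prod_range_iterLog_le {k n : ℕ} {x : ℝ} (hkn : k ≤ n) (hn : n ≤ logStar x) :
    ∏ i ∈ Finset.range k, iterLog i x ≤ ∏ i ∈ Finset.range n, iterLog i x := by
  have h : ∀ i < n, 1 < iterLog i x := fun i hi => one_lt_iterLog (by omega)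
  rw [← Finset.prod_range_mul_prod_Ico _ hkn]
  refine le_mul_of_one_le_right (Finset.prod_nonneg fun i hi => ?_)
    (Finset.prod_induction _ (1 ≤ ·) (fun _ _ => one_le_mul_of_one_le_of_one_le) le_rfl fun i hi => ?_)
  · have := h i (by rw [Finset.mem_range] at hi; omega)
    linarith
  · exact (h i (Finset.mem_Ico.1 hi).2).le

theorem one_le_logStar {x : ℝ} (hx : 1 < x) : 1 ≤ logStar x :=
  le_logStar fun c hc => by
    obtain rfl : c = 0 := by omega
    exact hx

theorem le_lam {x : ℝ} (hx : 1 ≤ x) (t : ℕ) : x ≤ lam t x := by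
  rw [lam_natCast]
  rcases hx.eq_or_lt with rfl | h
  -- At `x = 1` the product is empty, so its value 1 is still at least `x`.
  · have : logStar (1 : ℝ) = 0 := Nat.le_zero.1 (Nat.sInf_le (by simp [iterLog_zero]))
    simp [this]
  · have h1 := one_le_logStar h
    have := prod_range_iterLog_le (x := x) (k := 1) (n := min (t + 1) (logStar x)) (by omega)
      (by omega)
    simpa [iterLog_zero] using this

/-- Only the first two factors of `lam` are used; `t ≥ 1` makes the second one available, and the
others exceed 1. -/
theorem mul_max_logb_le_lam {x : ℝ} (hx : 1 ≤ x) {t : ℕ} (ht : 1 ≤ t) :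
    x * max 1 (Real.logb 2 x) ≤ lam t x := by
  rcases le_or_gt (Real.logb 2 x) 1 with h | h
  · rw [max_eq_left h, mul_one]
    exact le_lam hx t
  · rw [max_eq_right h.le, lam_natCast]
    have h1 : 1 < x := by
      refine hx.lt_of_ne fun h1 => ?_
      rw [← h1, Real.logb_one] at h
      linarith
    have h2 : 2 ≤ logStar x := le_logStar fun c hc => by
      interval_cases c
      · exact h1
      · exact h
    have := prod_range_iterLog_le (x := x) (k := 2) (n := min (t + 1) (logStar x)) (by omega)
      (by omega)
    simpa [Finset.prod_range_succ, iterLog_zero, iterLog_succ] using this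

theorem logb_two_le_self {x : ℝ} (hx : 1 ≤ x) : Real.logb 2 x ≤ x := by
  rw [Real.logb_le_iff_le_rpow (by norm_num) (by linarith)]
  have := one_add_mul_self_le_rpow_one_add (s := 1) (by norm_num) hx
  norm_num at this
  linarith

/-- The factor `d * D` with `D = max 1 (log d)` does not pile up, because every iteration puts the
previous bound under a logarithm. With `l` the next iterated logarithm of `x`, that logarithm is `9
+ log d + log D + l ≤ 16 * D * l`, as `D, l ≥ 1`; multiplication by `32 * d` restores the constant
`512 = 32 * 16`. -/
theorem iterate_primeLog_le {d t : ℕ} {x : ℝ} (hd : 1 ≤ d) (hx : 2 ≤ x) (ht : t < logStar x) (j : ℕ)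
    (hj : j < t) : (primeLog d)^[j + 1] x ≤
      512 * (d * max 1 (Real.logb 2 d)) * iterLog (j + 1) x := by
  have hd' : (1 : ℝ) ≤ d := by exact_mod_cast hd
  set D := max 1 (Real.logb 2 d) with hD
  have hD1 : 1 ≤ D := le_max_left _ _
  induction j with
  | zero =>
    have h1 := one_lt_iterLog (x := x) (c := 1) (by omega)
    simp only [zero_add, Function.iterate_one, primeLog]
    rw [iterLog_succ, iterLog_zero] at h1 ⊢
    gcongr
    · norm_num
    · exact le_mul_of_one_le_right (by linarith) hD1
  | succ j ih =>
    have h1 := one_lt_iterLog (x := x) (c := j + 1) (by omega)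
    have h2 := one_lt_iterLog (x := x) (c := j + 1 + 1) (by omega)
    have h3 := ih (by omega)
    have h4 := two_le_iterate_primeLog hd hx (j + 1)
    have h5 := Real.logb_le_logb_of_le (b := 2) (by norm_num) (by linarith) h3
    rw [Real.logb_mul (by positivity) (by positivity), Real.logb_mul (by positivity) (by positivity),
      Real.logb_mul (by positivity) (by positivity), ← iterLog_succ,
      show Real.logb 2 512 = 9 by
        rw [show (512 : ℝ) = 2 ^ 9 by norm_num, Real.logb_pow]; simp] at h5
    have h6 := logb_two_le_self hD1
    have h7 : Real.logb 2 d ≤ D := le_max_right _ _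
    rw [Function.iterate_succ_apply']
    generalize iterLog (j + 1 + 1) x = l at *
    have h8 : Real.logb 2 ((primeLog d)^[j + 1] x) ≤ 16 * (D * l) := by nlinarith
    calc primeLog d ((primeLog d)^[j + 1] x) ≤ 32 * d * (16 * (D * l)) := by
          exact mul_le_mul_of_nonneg_left h8 (by positivity)
      _ = _ := by ring

/-- The exponent 21 is `1 + 2 + 9 + 9`: from `t + 1 ≤ 2 ^ (t * m)`, from `(4 ^ m) ^ t`, and twice
from `512 = 2 ^ 9`, once in the product of the iterates and once in the `m`-th power. Depth 0 needs
only `d ≤ lam 0 d`. -/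
theorem closed_form_le {d m t N : ℕ} {x : ℝ} (hd : 1 ≤ d) (hm : 1 ≤ m) (hx : 2 ≤ x)
    (ht : t < logStar x) :
    ((t : ℝ) + 1) * (4 ^ m) ^ t * (∏ i ∈ Finset.range t, (primeLog d)^[i + 1] x) *
        (max (d : ℝ) ((primeLog d)^[t] x) ^ m + N) ≤
      (2 : ℝ) ^ ((21 : ℝ) * t * m) * lam t d ^ t * lam ((t : ℤ) - 1) (Real.logb 2 x) *
        ((lam t d * iterLog t x) ^ m + N) := by
  have hd' : (1 : ℝ) ≤ d := by exact_mod_cast hd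
  have hΛ := le_lam hd' t
  have hl := (one_lt_iterLog ht).le
  have hΛl : (1 : ℝ) ≤ lam t d * iterLog t x := one_le_mul_of_one_le_of_one_le (hd'.trans hΛ) hl
  have hmul : 1 ≤ t → (d : ℝ) * max 1 (Real.logb 2 d) ≤ lam t d := mul_max_logb_le_lam hd'
  rw [lam_logb ht]
  set Λ := lam t d with hΛdef
  have hU : (t : ℝ) + 1 ≤ 2 ^ (t * m) := by
    have h1 : t + 1 ≤ 2 ^ t := Nat.lt_two_pow_self
    have h2 : 2 ^ t ≤ 2 ^ (t * m) := Nat.pow_le_pow_right (by norm_num) (Nat.le_mul_of_pos_right _ hm)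
    exact_mod_cast h1.trans h2
  have hprod : ∏ i ∈ Finset.range t, (primeLog d)^[i + 1] x ≤
      512 ^ (t * m) * (Λ ^ t * ∏ i ∈ Finset.range t, iterLog (i + 1) x) := by
    calc ∏ i ∈ Finset.range t, (primeLog d)^[i + 1] x
        ≤ ∏ i ∈ Finset.range t, 512 * Λ * iterLog (i + 1) x := by
          refine Finset.prod_le_prod (fun i _ => ?_) fun i hi => ?_
          · linarith [two_le_iterate_primeLog hd hx (i + 1)]
          · rw [Finset.mem_range] at hi
            refine (iterate_primeLog_le hd hx ht i hi).trans ?_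
            have := (one_lt_iterLog (x := x) (c := i + 1) (by omega)).le
            gcongr
            exact hmul (by omega)
      _ = 512 ^ t * (Λ ^ t * ∏ i ∈ Finset.range t, iterLog (i + 1) x) := by
          rw [Finset.prod_mul_distrib, Finset.prod_const, Finset.card_range, mul_pow, mul_assoc]
      _ ≤ _ := by
          have : 0 ≤ ∏ i ∈ Finset.range t, iterLog (i + 1) x := Finset.prod_nonneg fun i hi => by
            rw [Finset.mem_range] at hi
            linarith [one_lt_iterLog (x := x) (c := i + 1) (by omega)]
          have hΛ0 : 0 ≤ Λ := by linarith
          gcongr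
          · norm_num
          · exact Nat.le_mul_of_pos_right _ hm
  have hmax : max (d : ℝ) ((primeLog d)^[t] x) ≤ 512 ^ t * (Λ * iterLog t x) := by
    rcases t with _ | t
    · rw [pow_zero, one_mul, iterLog_zero, Function.iterate_zero_apply]
      refine max_le ?_ ?_
      · exact hΛ.trans (le_mul_of_one_le_right (by linarith) (by linarith))
      · exact le_mul_of_one_le_left (by linarith) (by linarith)
    · have h1 : (1 : ℝ) ≤ 512 ^ t := one_le_pow₀ (by norm_num)
      have h2 : (512 : ℝ) * 1 ≤ 512 ^ (t + 1) := by rw [pow_succ']; gcongr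
      refine max_le ?_ ((iterate_primeLog_le hd hx ht t (by omega)).trans ?_)
      · refine (hΛ.trans (le_mul_of_one_le_right (by linarith) hl)).trans ?_
        exact le_mul_of_one_le_left (by linarith) (by linarith)
      · rw [mul_assoc]
        gcongr
        · linarith
        · exact hmul (by omega)
  have hfac : max (d : ℝ) ((primeLog d)^[t] x) ^ m + N ≤
      512 ^ (t * m) * ((Λ * iterLog t x) ^ m + N) := by
    rw [mul_add, pow_mul, ← mul_pow]
    have h1 : (1 : ℝ) ≤ (512 ^ t) ^ m := one_le_pow₀ (one_le_pow₀ (by norm_num))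
    gcongr
    exact le_mul_of_one_le_left (by positivity) h1
  have hpow : (2 : ℝ) ^ ((21 : ℝ) * t * m) =
      2 ^ (t * m) * (4 ^ m) ^ t * 512 ^ (t * m) * 512 ^ (t * m) := by
    rw [show (21 : ℝ) * t * m = ((21 * (t * m) : ℕ) : ℝ) by push_cast; ring, Real.rpow_natCast,
      ← pow_mul, mul_comm m t, ← mul_pow, ← mul_pow, ← mul_pow, pow_mul]
    norm_num
  rw [hpow]
  have hp0 : 0 ≤ ∏ i ∈ Finset.range t, (primeLog d)^[i + 1] x := Finset.prod_nonneg fun i _ => by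
    linarith [two_le_iterate_primeLog hd hx (i + 1)]
  have hq0 := hp0.trans hprod
  calc _ ≤ 2 ^ (t * m) * (4 ^ m) ^ t *
        (512 ^ (t * m) * (Λ ^ t * ∏ i ∈ Finset.range t, iterLog (i + 1) x)) *
        (512 ^ (t * m) * ((Λ * iterLog t x) ^ m + N)) := by
        gcongr
    _ = _ := by ring

/-! ### Polynomials and their coefficient tables -/

theorem cast_evalTable_coeffTable {m n d : ℕ} [NeZero n] {f : MvPolynomial (Fin m) (ZMod n)}
    (hf : ∀ l, f.degreeOf l < d) (a : Fin m → ZMod n) :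
    (evalTable d m ((coeffTable d f).getD · 0) ((List.ofFn fun l => (a l).val).getD · 0) : ZMod n) =
      MvPolynomial.eval a f := by
  rw [evalTable_eq_sum, MvPolynomial.eval_eq']
  push_cast
  symm
  -- The degree bound places the support of `f` inside the box of exponents; box entries outside the
  -- support have coefficient zero.
  refine Finset.sum_of_injOn (fun k => ⇑k) (fun _ _ _ _ h => DFunLike.coe_injective h)
    (fun k hk => ?_) (fun k hk hk' => ?_) (fun k hk => ?_)
  · exact Finset.mem_coe.2 (Fintype.mem_piFinset.2 fun l => Finset.mem_range.2
      ((MvPolynomial.monomial_le_degreeOf l (Finset.mem_coe.1 hk)).trans_lt (hf l)))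
  · have h0 : f.coeff (Finsupp.equivFunOnFinite.symm k) = 0 := by
      rw [← MvPolynomial.notMem_support_iff]
      exact fun h => hk' ⟨_, Finset.mem_coe.2 h, rfl⟩
    rw [coeffTable, getD_map_range _ _ _ (code_lt hk)]
    simp only [digit_code hk, h0]
    simp
  · have hk' : ⇑k ∈ expBox d m := Fintype.mem_piFinset.2 fun l => Finset.mem_range.2
      ((MvPolynomial.monomial_le_degreeOf l hk).trans_lt (hf l))
    rw [coeffTable, getD_map_range _ _ _ (code_lt hk')]
    simp only [digit_code hk', ZMod.natCast_val, ZMod.cast_id', id_eq]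
    congr 1
    · congr 1
      ext l
      rfl
    · refine Finset.prod_congr rfl fun l _ => ?_
      simp

theorem isInst_coeffTable {m d r s N : ℕ} [NeZero (r ^ s)] (f : MvPolynomial (Fin m) (ZMod (r ^ s)))
    (a : Fin N → Fin m → ZMod (r ^ s)) :
    IsInst m d r s (coeffTable d f) (List.ofFn fun i => List.ofFn fun l => (a i l).val) := by
  refine ⟨by simp [coeffTable], fun x hx => ?_, fun b hb => ?_, fun b hb x hx => ?_⟩
  · obtain ⟨k, _, rfl⟩ := List.mem_map.1 hx
    exact ZMod.val_lt _
  · obtain ⟨i, rfl⟩ := List.mem_ofFn.1 hb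
    simp
  · obtain ⟨i, rfl⟩ := List.mem_ofFn.1 hb
    obtain ⟨l, rfl⟩ := List.mem_ofFn.1 hx
    exact ZMod.val_lt _

theorem evalList_coeffTable {m d n N : ℕ} [NeZero n] {f : MvPolynomial (Fin m) (ZMod n)}
    (hf : ∀ l, f.degreeOf l < d) (a : Fin N → Fin m → ZMod n) :
    evalList m d n (coeffTable d f) (List.ofFn fun i => List.ofFn fun l => (a i l).val) =
      List.ofFn fun i => (MvPolynomial.eval (a i) f).val := by
  rw [evalList, List.map_ofFn]
  congr 1
  funext i
  rw [Function.comp_apply, ← ZMod.val_natCast, cast_evalTable_coeffTable hf]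

/-! ### The choice of the scale `S` and the final estimate. -/

/-- A bound for the lengths of the binary expansions of the bases of all moduli in a run of MME-B. -/
def sizeBound (d r : ℕ) : ℕ := r.size + 10 * d + 100

/-- A bound for the auxiliary numbers that are not table entries, and for the lengths of the binary
expansions of all numbers in a run of MME-B. -/
def scale (m d r : ℕ) : ℕ := 100 * (1 + m) * (1 + d) * (1 + sizeBound d r)

theorem two_mul_mul_succ_lt_two_pow {b : ℕ} (hb : 100 ≤ b) : 2 * b * (1 + b) < 2 ^ b := by
  induction b, hb using Nat.le_induction with
  | base => norm_num
  | succ b hb ih =>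
    rw [pow_succ]
    nlinarith

/-- This is the self-reproducing condition on `b` in `Spec.mmeB`: `b ≥ 10 * d` gives `16 * d ≤ 2 *
b`, and `b ≥ 100` gives `2 * b * (1 + b) < 2 ^ b`. -/
theorem size_le_sizeBound (d r : ℕ) : (16 * d * (1 + sizeBound d r)).size ≤ sizeBound d r := by
  rw [Nat.size_le]
  refine lt_of_le_of_lt ?_ (two_mul_mul_succ_lt_two_pow (by unfold sizeBound; omega))
  gcongr ?_ * _
  unfold sizeBound
  omega

theorem one_le_depthCost {S m d N : ℕ} (hS : 1 ≤ S) (hd : 1 ≤ d) {s : ℕ} (hs : 1 ≤ s) (t r : ℕ) :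
    1 ≤ depthCost S m d N t s r := by
  have hE : 1 ≤ (expList s m).length := by
    have := length_expList_mono hs (Nat.zero_le m)
    simpa [expList] using this
  have key : ∀ k x : ℕ, 1 ≤ x → 1 ≤ S ^ k * ((expList s m).length * (x ^ m + N)) := fun k x hx =>
    Nat.mul_pos (Nat.pow_pos hS) (Nat.mul_pos hE (Nat.add_pos_left (Nat.pow_pos hx) N))
  cases t with
  | zero => exact key _ _ (hd.trans (le_max_left _ _))
  | succ t => exact (key 8000 d hd).trans (Nat.le_add_right _ _)

theorem time_le {m d r s t N : ℕ} {f : MvPolynomial (Fin m) (ZMod (r ^ s))}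
    {a : Fin N → Fin m → ZMod (r ^ s)} (hs : 1 ≤ s) (hsm : s ≤ m) (hf : ∀ l, f.degreeOf l < d)
    (hr : 2 ≤ r) :
    mmeB.output (mmeInput m d r s t N f a) = List.ofFn (fun i => (MvPolynomial.eval (a i) f).val) ∧
      mmeB.time (mmeInput m d r s t N f a) ≤
        scale m d r * depthCost (scale m d r) m d N t s r := by
  have : NeZero (r ^ s) := ⟨(Nat.pow_pos (by omega)).ne'⟩
  have hd : 1 ≤ d := by
    have := hf ⟨0, by omega⟩
    omega
  set b := sizeBound d r with hb
  have hb100 : 100 ≤ b := by rw [hb, sizeBound]; omega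
  have hS : 100 * (1 + m) * (1 + d) * (1 + b) = scale m d r := rfl
  generalize scale m d r = S at *
  have h1 := Nat.zero_le (m * d)
  have h2 := Nat.zero_le (m * d * b)
  have h3 := Nat.zero_le (m * b)
  have h4 := Nat.zero_le (d * b)
  -- With `depthCost ≥ 1` this lets a single factor `S` absorb the additive 30 of `Spec.mmeB`.
  have h31 : 31 ≤ S := by nlinarith
  have := Fact.mk (show 2 ≤ S by omega)
  have key := Spec.mmeB (S := S) (t := t) (b := b) (isInst_coeffTable (d := d) f a) hr hs hsm hd
    (by rw [hb, sizeBound]; omega) (size_le_sizeBound d r) (by omega)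
    (by nlinarith) (by nlinarith)
    (by nlinarith) (by nlinarith)
  rw [evalList_coeffTable hf, List.length_ofFn] at key
  refine ⟨key.1, key.2.trans ?_⟩
  have := one_le_depthCost (S := S) (m := m) (N := N) (by omega) hd hs t r
  nlinarith

theorem scale_le {m d r : ℕ} (hr : 2 ≤ r) :
    (scale m d r : ℝ) ≤ 20000 * (1 + m) * (1 + d) ^ 2 * (1 + Real.logb 2 r) := by
  have h1 := size_le_logb_add_one (n := r) (by omega)
  have h2 := one_le_logb_two (x := r) (by exact_mod_cast hr)
  have h3 : 1 + (sizeBound d r : ℝ) ≤ 200 * ((1 + d) * (1 + Real.logb 2 r)) := by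
    unfold sizeBound
    push_cast
    have : 0 ≤ (d : ℝ) * Real.logb 2 r := by positivity
    nlinarith [Nat.cast_nonneg (α := ℝ) d]
  unfold scale
  push_cast
  calc 100 * (1 + (m : ℝ)) * (1 + d) * (1 + sizeBound d r)
      ≤ 100 * (1 + (m : ℝ)) * (1 + d) * (200 * ((1 + d) * (1 + Real.logb 2 r))) := by gcongr
    _ = _ := by ring

end MME

theorem mainTheorem7 :
    ∃ (C K : ℝ) (P : MvPolynomial (Fin 3) ℕ), 0 < C ∧ 0 < K ∧
      ∀ (m d r s t N : ℕ) (f : MvPolynomial (Fin m) (ZMod (r ^ s)))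
        (a : Fin N → Fin m → ZMod (r ^ s)),
        1 ≤ s → s ≤ m → (∀ l : Fin m, f.degreeOf l < d) → t < MME.logStar r →
        MME.mmeB.output (MME.mmeInput m d r s t N f a) =
            List.ofFn (fun i : Fin N => (MvPolynomial.eval (a i) f).val) ∧
          (MME.mmeB.time (MME.mmeInput m d r s t N f a) : ℝ) ≤
            K * ((m + s - 1).choose (s - 1) * (2 : ℝ) ^ (C * t * m) * MME.lam t d ^ t *
                MME.lam ((t : ℤ) - 1) (Real.logb 2 r) *
                ((MME.lam t d * MME.iterLog t r) ^ m + N)) *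
              MvPolynomial.aeval ![(m : ℝ), (d : ℝ), Real.logb 2 r] P := by
  -- The base is the bound of `scale_le`; of its exponent, 8000 comes from `depthCost_le` and 1 from
  -- `time_le`.
  refine ⟨21, 1, (MvPolynomial.C 20000 * (1 + MvPolynomial.X 0) * (1 + MvPolynomial.X 1) ^ 2 *
    (1 + MvPolynomial.X 2)) ^ 8001, by norm_num, one_pos, ?_⟩
  intro m d r s t N f a hs hsm hf ht
  have hr : 2 ≤ r := by
    have h := MME.one_lt_iterLog (Nat.zero_lt_of_lt ht)
    rw [MME.iterLog_zero] at h
    exact_mod_cast h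
  have hr' : (2 : ℝ) ≤ r := by exact_mod_cast hr
  have hm : 1 ≤ m := hs.trans hsm
  have hd : 1 ≤ d := by
    have := hf ⟨0, by omega⟩
    omega
  obtain ⟨hout, htime⟩ := MME.time_le (t := t) (a := a) hs hsm hf hr
  refine ⟨hout, ?_⟩
  have hS2 : 2 ≤ MME.scale m d r := by
    unfold MME.scale
    nlinarith [Nat.zero_le (m * d), Nat.zero_le (m * d * MME.sizeBound d r)]
  have h1 := MME.depthCost_le (N := N) hS2 hm hd t s hr le_rfl
  have h2 := MME.closed_form_le (N := N) hd hm hr' ht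
  have h3 := MME.scale_le (m := m) (d := d) hr
  rw [MME.length_expList hs] at h1
  have haeval : MvPolynomial.aeval ![(m : ℝ), (d : ℝ), Real.logb 2 r]
      (MvPolynomial.C 20000 * (1 + MvPolynomial.X 0) * (1 + MvPolynomial.X 1) ^ 2 *
        (1 + MvPolynomial.X 2) : MvPolynomial (Fin 3) ℕ) =
      20000 * (1 + m) * (1 + d) ^ 2 * (1 + Real.logb 2 r) := by
    simp
  rw [map_pow, haeval]
  generalize (20000 : ℝ) * (1 + m) * (1 + d) ^ 2 * (1 + Real.logb 2 r) = p at *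
  generalize MME.scale m d r = S at *
  have hS0 : (0 : ℝ) < S := by exact_mod_cast (by omega : 0 < S)
  have hc : (0 : ℝ) < ((m + s - 1).choose (s - 1) : ℕ) := by
    exact_mod_cast Nat.choose_pos (by omega)
  generalize (((m + s - 1).choose (s - 1) : ℕ) : ℝ) = c at *
  rw [one_mul]
  -- The closed form is nonnegative because a positive multiple of it bounds a natural number.
  have hF := nonneg_of_mul_nonneg_right ((Nat.cast_nonneg _).trans h1)
    (mul_pos (pow_pos hS0 8000) hc)
  have htime' : (MME.mmeB.time (MME.mmeInput m d r s t N f a) : ℝ) ≤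
      S * MME.depthCost S m d N t s r := by exact_mod_cast htime
  refine htime'.trans ((mul_le_mul h3 (h1.trans (mul_le_mul
    (mul_le_mul_of_nonneg_right (pow_le_pow_left₀ hS0.le h3 8000) hc.le) h2 hF
    (mul_nonneg (pow_nonneg (hS0.le.trans h3) _) hc.le))) (Nat.cast_nonneg _)
    (hS0.le.trans h3)).trans (le_of_eq ?_))
  rw [pow_succ p 8000]
  generalize p ^ 8000 = y
  ring
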